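/- **Setting.** A rooted dipole is a 2-cell embedding, in an oriented surface of genus $g$, of a loopless graph with two vertices, with a distinguished root vertex and root edge; $\mathcal D$ is the set of rooted dipoles. A bi-rooted dipole has in addition a secondary edge different from the root edge; $\widehat{\mathcal D}$ is the set of these. At the root vertex, Region 1 is the sector passed counterclockwise from the root edge to the secondary edge, and Region 2 is the complementary sector; at the non-root vertex, Region 3 is the sector passed counterclockwise from the root edge to the secondary edge, and Region 4 is the complementary sector. An edge other than the root and the secondary edge is an $a$-, $b$-, $c$- or $d$-edge according as its ends at the root and non-root vertex lie in Regions $(2,3)$, $(1,3)$, $(2,4)$, $(1,4)$; let $\alpha(D),\beta(D),\gamma(D),\delta(D)$ be the numbers of these edges of $D\in\widehat{\mathcal D}$. Mark corners at the root vertex by $\bullet$ in Region 1 and by $\circ$ in Region 2. The root corner is the one immediately counterclockwise of the root edge at the root vertex, and the face containing it is the root face. Let $R(D)$ be the binary string read on a counterclockwise boundary walk of the root face starting at the root corner, and $\Lambda(D)$ the multiset of cyclic binary strings read in the same way on the non-root faces. With indeterminates $g_R$ ($R$ a binary string) and $f_{(S)}$ ($(S)$ a cyclic binary string), put $f_{\Lambda(D)}=\prod_{(S)\in\Lambda(D)}f_{(S)}$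 and $$\Gamma=\sum_{D\in\widehat{\mathcal D}}\frac{x^{\alpha(D)+1}}{(\alpha(D)+1)!}\frac{y^{\beta(D)}}{\beta(D)!}\frac{v^{\gamma(D)+\delta(D)}}{(\gamma(D)+\delta(D))!}\,w^{\delta(D)}u^{2g(D)}g_{R(D)}f_{\Lambda(D)} .$$ Let $B$ be the same sum restricted to $\gamma(D)=\delta(D)=0$, and let $\Gamma^{(1)}=[u^2]\Gamma$, $B^{(1)}=[u^2]B$. For a partition $\lambda\vdash n$ let $\psi_\lambda$ be the number of rooted dipoles in $\mathcal D$ with $n$ edges and face-degree sequence $2\lambda$, and $\mathcal C_\lambda$ the conjugacy class of $\mathfrak S_n$ of cycle type $\lambda$. **Functions.** For $i\ge 0$ let $\phi(z,x_1,\dots,x_i)=\sum_{n\ge i}h_{n-i}(x_1,\dots,x_i)\frac{z^n}{n!}$, with $h_j$ the complete symmetric function (so $\phi=1$ if $i=0$). For a binary string $S=S_1\cdots S_i$ let $\phi_S=\phi(v,x_1,\dots,x_i)$ with $x_j=f_{(\circ)}$ if $S_j=\circ$ and $x_j=wf_{(\bullet)}$ if $S_j=\bullet$; let $\phi_i(y)=\phi(y,f_{(\bullet)},\dots,f_{(\bullet)})$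 ($i$ arguments $f_{(\bullet)}$). Let $\mathcal C_k(R)$ be the set of sequences $\eta=(\eta_1,\dots,\eta_k)$ of non-empty strings with concatenation $R$, $\eta_{j,1}$ the first symbol of $\eta_j$, $\iota(\eta)=|\{2\le j\le k:\eta_{j,1}=\bullet\}|$ and $\Omega(\eta)=\prod_{1\le j\le k-1}f_{(\eta_j\eta_{j+1,1})}$. With $\epsilon$ the empty string, $\tau_{\epsilon,S}=g_\bullet\phi_{\bullet S}$, and for $R\neq\epsilon$ $$\tau_{R,S}=\sum_{k\ge1}\sum_{\eta\in\mathcal C_k(R)}\Big(w^{\iota(\eta)}g_{\bullet\eta_k}\Omega(\eta)\,\phi_{\eta_{k,1}\cdots\eta_{1,1}S}+w^{\iota(\eta)+1}g_\bullet f_{(\bullet\eta_k)}\Omega(\eta)\,\phi_{\bullet\eta_{k,1}\cdots\eta_{1,1}S}\Big),$$ $$\tau_{R,k}=\sum_{i\ge1}\phi_{k+i}(y)\sum_{\eta\in\mathcal C_i(R)}g_{\bullet\eta_1}\prod_{2\le j\le i}f_{(\bullet\eta_j)}\qquad(k\ge0).$$ **Theorem.** Put $\Psi=\sum_{n\ge3}\frac{x^n}{n!}\psi_{(3,1^{n-3})}f_{(\circ\circ\circ)}f_{(\circ)}^{n-3}+\sum_{n\ge4}\frac{x^n}{n!}\psi_{(2^2,1^{n-4})}f_{(\circ\circ)}^2f_{(\circ)}^{n-4}$.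 Then the $(a,b,c,d)$-dipole series for the torus is $$\begin{aligned}\Gamma^{(1)}&=(wf_{(\bullet)}\tau_{\circ\circ,\bullet}+\tau_{\circ\circ,\epsilon})\,x\exp(xf_{(\circ)})\\&\quad+(w^2\tau_{\bullet\bullet,\bullet}+w^3f_{(\bullet)}\tau_{\bullet\bullet,\bullet\bullet})(\exp(xf_{(\circ)})-1)\\&\quad+(wf_{(\bullet\bullet\circ)}\tau_{\epsilon,\epsilon}+wf_{(\bullet)}\tau_{\bullet\circ,\epsilon}+f_{(\bullet\circ)}\tau_{\circ,\epsilon})\,\phi_1(y)\,x\exp(xf_{(\circ)})\\&\quad+(wf_{(\bullet\bullet)}\tau_{\epsilon,\epsilon}+wf_{(\bullet)}\tau_{\bullet,\epsilon})\,f_{(\bullet\circ)}\,\phi_2(y)\,x\exp(xf_{(\circ)})\\&\quad+wf_{(\bullet)}\tau_{\epsilon,\epsilon}\Psi+B^{(1)},\end{aligned}$$ where $B^{(1)}=\tau_{\bullet\circ,0}\,x\exp(xf_{(\circ)})+g_\bullet\Psi$, and where, for $\lambda=(3,1^{n-3})$ with $n\ge3$ and for $\lambda=(2^2,1^{n-4})$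 with $n\ge4$, $$\psi_\lambda=\frac1n|\mathcal C_\lambda|\sum_{0\le k\le n-1}\binom{n-1}{k}^{-1}[y^k]\,(1+y)^{-1}\prod_i\big(1-(-y)^{\lambda_i}\big).$$ -/

import Mathlib

noncomputable section

namespace Dipole

open Equiv

/-! ### Rooted and bi-rooted dipoles

A loopless dipole with `n` edges in an oriented surface is a pair of rotations (full cycles) on its
set of edges, one for each vertex, both read counterclockwise. For a rooted dipole the edges are
labelled `0, 1, …, n - 1` in counterclockwise order around the root vertex, starting with the root
edge `0`; every rooted dipole, up to isomorphism, arises from exactly one rotation `rot` of the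
non-root vertex. -/

/-- A rooted loopless dipole with `n` edges. The rotation at the root vertex is `i ↦ i + 1`,
the root edge is `0`, and `rot` is the counterclockwise rotation at the non-root vertex. -/
structure RootedDipole (n : ℕ) where
  pos : 0 < n
  rot : Perm (Fin n)
  full : rot.IsCycleOn Set.univ

namespace RootedDipole

variable {n : ℕ}

instance : Finite (RootedDipole n) :=
  Finite.of_injective (fun D : RootedDipole n => D.rot) (by
    rintro ⟨_, a, _⟩ ⟨_, b, _⟩ h
    simpa using h)

instance : Fintype (RootedDipole n) := Fintype.ofFinite _

/-- The root edge. -/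
def root (D : RootedDipole n) : Fin n := ⟨0, D.pos⟩

/-- The corner at the root vertex between edge `i` and the next edge `i + 1` counterclockwise is
called corner `i`. On the counterclockwise boundary walk of a face, corner `i` is followed by edge
`i` (traversed towards the non-root vertex), then by the edge clockwise next to it at the non-root
vertex (traversed towards the root vertex), and then by corner `nextCorner i`. The root corner is
corner `root`. -/
def nextCorner (D : RootedDipole n) : Perm (Fin n) := (D.rot * finRotate n)⁻¹

/-- The corners at the root vertex met on the counterclockwise boundary walk of a face,
starting at corner `i`. -/
def walk (D : RootedDipole n) (i : Fin n) : List (Fin n) :=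
  List.iterate D.nextCorner i (Function.minimalPeriod D.nextCorner i)

/-- The faces, each given by the cyclic sequence of its corners at the root vertex.
A face `c` has degree `2 * c.length`. -/
def faces (D : RootedDipole n) : Finset (Cycle (Fin n)) :=
  Finset.univ.image fun i => (D.walk i : Cycle (Fin n))

/-- The root face. -/
def rootFace (D : RootedDipole n) : Cycle (Fin n) := (D.walk D.root : Cycle (Fin n))

/-- Twice the genus: `2 - n + m = 2 - 2g` by the Euler–Poincaré formula, `m` the number of faces. -/
def twiceGenus (D : RootedDipole n) : ℕ := n - D.faces.card

/-- The half face-degree sequence. -/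
def halfFaceDegrees (D : RootedDipole n) : Multiset ℕ := D.faces.val.map Cycle.length

end RootedDipole

/-- `psi lam` is the number of rooted dipoles with face-degree sequence `2 * lam`. -/
def psi (lam : Multiset ℕ) : ℕ :=
  Fintype.card {D : RootedDipole lam.sum // D.halfFaceDegrees = lam}

/-- The size of the conjugacy class of permutations of cycle type `lam` (fixed points listed). -/
def classSize (lam : Multiset ℕ) : ℕ :=
  Fintype.card {s : Perm (Fin lam.sum) // s.partition.parts = lam}

/-- The closed form
`(1/n) |C_lam| ∑_{0 ≤ k ≤ n-1} binom(n-1,k)⁻¹ [y^k] (1+y)⁻¹ ∏ᵢ (1 - (-y)^{lamᵢ})`, `n = |lam|`. -/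
def psiClosed (lam : Multiset ℕ) : ℚ :=
  (1 / (lam.sum : ℚ)) * (classSize lam : ℚ) * ∑ k ∈ Finset.range lam.sum,
    ((lam.sum - 1).choose k : ℚ)⁻¹ *
      PowerSeries.coeff k ((1 + PowerSeries.X : PowerSeries ℚ)⁻¹ *
        (lam.map fun l => 1 - (-PowerSeries.X : PowerSeries ℚ) ^ l).prod)

/-- The two markings of corners at the root vertex. -/
inductive Dot where
  | black : Dot
  | white : Dot
  deriving DecidableEq

notation "●" => Dot.black
notation "○" => Dot.white

/-- A rooted dipole with a secondary edge, different from the root edge. -/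
structure BiRootedDipole (n : ℕ) extends RootedDipole n where
  sec : Fin n
  sec_ne : sec ≠ toRootedDipole.root

namespace BiRootedDipole

variable {n : ℕ}

instance : Finite (BiRootedDipole n) :=
  Finite.of_injective (fun D : BiRootedDipole n => (D.toRootedDipole, D.sec)) (by
    rintro ⟨a, s, _⟩ ⟨b, t, _⟩ h
    simpa using h)

instance : Fintype (BiRootedDipole n) := Fintype.ofFinite _

/-- The marking of the corners at the root vertex: the corners in Region 1, which is passed
counterclockwise from the root edge to the secondary edge, are black; the others, in Region 2,
are white. -/
def color (D : BiRootedDipole n) (i : Fin n) : Dot := if i < D.sec then ● else ○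

/-- Position of an edge in the counterclockwise order around the non-root vertex, counted from
the root edge (which has position `0`). -/
def posNonroot (D : BiRootedDipole n) (j : Fin n) : ℕ :=
  (List.iterate D.rot D.root n).idxOf j

/-- The ordinary edge `j` leaves the root vertex through Region 1 (from the root edge
counterclockwise to the secondary edge). -/
def InRegion1 (D : BiRootedDipole n) (j : Fin n) : Prop := D.root < j ∧ j < D.sec

/-- The ordinary edge `j` leaves the root vertex through Region 2. -/
def InRegion2 (D : BiRootedDipole n) (j : Fin n) : Prop := D.sec < j

/-- The ordinary edge `j` reaches the non-root vertex through Region 3 (from the root edge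
counterclockwise to the secondary edge). -/
def InRegion3 (D : BiRootedDipole n) (j : Fin n) : Prop :=
  0 < D.posNonroot j ∧ D.posNonroot j < D.posNonroot D.sec

/-- The ordinary edge `j` reaches the non-root vertex through Region 4. -/
def InRegion4 (D : BiRootedDipole n) (j : Fin n) : Prop :=
  D.posNonroot D.sec < D.posNonroot j

/-- Number of `a`-edges. -/
def numA (D : BiRootedDipole n) : ℕ := {j | D.InRegion2 j ∧ D.InRegion3 j}.ncard

/-- Number of `b`-edges. -/
def numB (D : BiRootedDipole n) : ℕ := {j | D.InRegion1 j ∧ D.InRegion3 j}.ncard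

/-- Number of `c`-edges. -/
def numC (D : BiRootedDipole n) : ℕ := {j | D.InRegion2 j ∧ D.InRegion4 j}.ncard

/-- Number of `d`-edges. -/
def numD (D : BiRootedDipole n) : ℕ := {j | D.InRegion1 j ∧ D.InRegion4 j}.ncard

/-- The binary string of the root face, read from the root corner. -/
def rootString (D : BiRootedDipole n) : List Dot := (D.walk D.root).map D.color

/-- The multiset of cyclic binary strings of the non-root faces. -/
def nonrootStrings (D : BiRootedDipole n) : Multiset (Cycle Dot) :=
  (D.faces.erase D.rootFace).val.map (Cycle.map D.color)

end BiRootedDipole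

/-! ### The rings of formal power series -/

/-- The indeterminates `x, y, v, w`. -/
inductive Var where
  | x : Var
  | y : Var
  | v : Var
  | w : Var
  deriving DecidableEq

/-- Polynomials in the indeterminates `g_R` (`R` a binary string) and `f_(S)` (`(S)` a cyclic
binary string). -/
abbrev Coeffs : Type := MvPolynomial (List Dot ⊕ Cycle Dot) ℚ

/-- Formal power series in `x, y, v, w` whose coefficients are polynomials in the `g_R`, `f_(S)`. -/
abbrev Series : Type := MvPowerSeries Var Coeffs

/-- The indeterminate `x`. -/
def x : Series := MvPowerSeries.X Var.x
/-- The indeterminate `y`. -/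
def y : Series := MvPowerSeries.X Var.y
/-- The indeterminate `v`. -/
def v : Series := MvPowerSeries.X Var.v
/-- The indeterminate `w`. -/
def w : Series := MvPowerSeries.X Var.w
/-- The indeterminate `g_R`. -/
def g (R : List Dot) : Series := MvPowerSeries.C (MvPolynomial.X (Sum.inl R))
/-- The indeterminate `f_(S)` of a cyclic binary string. -/
def fc (S : Cycle Dot) : Series := MvPowerSeries.C (MvPolynomial.X (Sum.inr S))
/-- The indeterminate `f_(S)`, where `(S)` is represented by the string `S`. -/
def f (S : List Dot) : Series := fc (S : Cycle Dot)

/-- The sum of a locally finite family of power series (every monomial has a non-zero coefficient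
in only finitely many members); all families summed below are of this kind. -/
def formalSum {ι : Type} (F : ι → Series) : Series :=
  fun m => ∑ᶠ i, MvPowerSeries.coeff m (F i)

/-! ### The dipole series -/

/-- The contribution of a bi-rooted dipole to the `(a,b,c,d)`-dipole series, without its factor
`u ^ (2 g(D))`. -/
def BiRootedDipole.weight {n : ℕ} (D : BiRootedDipole n) : Series :=
  (1 / (((D.numA + 1).factorial * D.numB.factorial * (D.numC + D.numD).factorial : ℕ) : ℚ)) •
    (x ^ (D.numA + 1) * y ^ D.numB * v ^ (D.numC + D.numD) * w ^ D.numD *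
      g D.rootString * (D.nonrootStrings.map fc).prod)

/-- The `(a,b,c,d)`-dipole series `Γ`, a power series in `u`. -/
def Gam : PowerSeries Series :=
  PowerSeries.mk fun h => formalSum fun D : (Σ n, BiRootedDipole n) =>
    if D.2.twiceGenus = h then D.2.weight else 0

/-- The `(a,b,0,0)`-dipole series `B`, a power series in `u`. -/
def B : PowerSeries Series :=
  PowerSeries.mk fun h =>
    formalSum fun D : {D : (Σ n, BiRootedDipole n) // D.2.numC = 0 ∧ D.2.numD = 0} =>
      if D.1.2.twiceGenus = h then D.1.2.weight else 0

/-- `Γ^{(k)} = [u^{2k}] Γ`. -/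
def GamGenus (k : ℕ) : Series := PowerSeries.coeff (2 * k) Gam

/-- `B^{(k)} = [u^{2k}] B`. -/
def BGenus (k : ℕ) : Series := PowerSeries.coeff (2 * k) B

/-! ### The functions in which the solution is expressed -/

/-- `exp t = ∑ tⁿ / n!`, for `t` without constant term. -/
def expS (t : Series) : Series := formalSum fun n : ℕ => (1 / (n.factorial : ℚ)) • t ^ n

/-- `phi z [x₁, …, xᵢ] = ∑_{n ≥ i} h_{n-i}(x₁, …, xᵢ) zⁿ / n!`, where `h_j` is the complete
symmetric function (the sum is written over `j = n - i`). -/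
def phi (z : Series) (xs : List Series) : Series :=
  formalSum fun j : ℕ => (1 / ((j + xs.length).factorial : ℚ)) •
    (MvPolynomial.aeval xs.get (MvPolynomial.hsymm (Fin xs.length) ℚ j) * z ^ (j + xs.length))

/-- The value at which the variable of `phi` is taken for a symbol: `f_(○)` or `w f_(●)`. -/
def phiArg : Dot → Series
  | ● => w * f [●]
  | ○ => f [○]

/-- The function `φ_S(v)`. -/
def phiStr (S : List Dot) : Series := phi v (S.map phiArg)

/-- The function `φ_i(y)`. -/
def phiNum (i : ℕ) : Series := phi y (List.replicate i (f [●]))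

/-- The parts of the string composition of `R` with the given lengths; for `c` ranging over all
compositions of the length of `R`, these are the string compositions of `R`. -/
def parts (R : List Dot) (c : Composition R.length) : List (List Dot) := R.splitWrtComposition c

/-- The first symbols of the parts. -/
def heads (η : List (List Dot)) : List Dot := η.filterMap List.head?

/-- `ι(η₁, …, η_k)`: the number of parts other than the first that start with `●`. -/
def iota (η : List (List Dot)) : ℕ := (heads η).tail.count ●

/-- `Ω(η)`: the product over `1 ≤ j ≤ k - 1` of `f_(η_j η_{j+1,1})`. -/
def Omega (η : List (List Dot)) : Series :=
  (List.zipWith (fun a b => f (a ++ b.take 1)) η η.tail).prod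

/-- The function `τ_{R,S}`, indexed by two binary strings. -/
def tau (R S : List Dot) : Series :=
  if R = [] then g [●] * phiStr (● :: S)
  else ∑ c : Composition R.length,
    let η := parts R c
    (w ^ iota η * g (● :: η.getLastD []) * Omega η * phiStr ((heads η).reverse ++ S) +
      w ^ (iota η + 1) * g [●] * f (● :: η.getLastD []) * Omega η *
        phiStr (● :: ((heads η).reverse ++ S)))

/-- The function `τ_{R,k}`, indexed by a non-empty binary string and an integer. -/
def tauNum (R : List Dot) (k : ℕ) : Series :=
  ∑ c : Composition R.length,
    let η := parts R c
    phiNum (k + η.length) * (g (● :: η.headD []) * (η.tail.map fun e => f (● :: e)).prod)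

/-- The partition `(3, 1^{n-3})`, with `n = k + 3`. -/
def lam3 (k : ℕ) : Multiset ℕ := {3} + Multiset.replicate k 1

/-- The partition `(2², 1^{n-4})`, with `n = k + 4`. -/
def lam22 (k : ℕ) : Multiset ℕ := {2, 2} + Multiset.replicate k 1

/-- `∑_{n ≥ 3} xⁿ/n! ψ_{(3,1^{n-3})} f_(○○○) f_(○)^{n-3}
  + ∑_{n ≥ 4} xⁿ/n! ψ_{(2²,1^{n-4})} f_(○○)² f_(○)^{n-4}`. -/
def psiSum : Series :=
  (formalSum fun k : ℕ => ((psi (lam3 k) : ℚ) / ((k + 3).factorial : ℚ)) •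
      (x ^ (k + 3) * f [○, ○, ○] * f [○] ^ k)) +
    formalSum fun k : ℕ => ((psi (lam22 k) : ℚ) / ((k + 4).factorial : ℚ)) •
      (x ^ (k + 4) * f [○, ○] ^ 2 * f [○] ^ k)

end Dipole

end

/-! A dipole is encoded by its face permutation `nextCorner` on the corners at the root vertex. On
the torus Euler's formula gives n − 2 faces, so this permutation is a 3-cycle or a product of two
disjoint transpositions. The rotation at the non-root vertex must be a single cycle; this excludes
3-cycles of the wrong orientation and non-crossing pairs of transpositions, and nothing else
(`exists_quad`, `ofQuad`). What remains is, uniformly, `swap b d * swap a c` with a < b < c ≤ d,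
where c = d is the 3-cycle. Thus ψ is C(n,3) or C(n,4), and a discrete beta integral evaluates the
closed form to the same numbers.

Around the non-root vertex the edges follow the planar order 0, n−1, …, 1, except that the blocks
(a,b], (b,c], (c,d] are met in the opposite order (`quadPos`). Hence, once it is known in which of
the five intervals cut out by a, b, c, d the secondary edge s lies, the numbers of a-, b-, c- and
d-edges are linear in the gaps (`Config.counts`), and all corners outside the support form faces of
their own. Fixing also whether a = 0 (the root corner is in the support) and whether c = d leaves
sixteen non-empty cases. In each the gaps are independent natural numbers and the weight factors, so
the sum is a product of three series `ESum`, in x, y and v (`sumsTo_case`); the functions φ are the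
`ESum z k u` in which k is the number of arguments.

In every case the v-series has one argument more than k, the last being w f_(●). Splitting off that
argument gives φ(u₁,…,u_k) + w f_(●) φ(u₁,…,u_{k+1}), which is where the pairs τ_{R,S}, w f_(●)
τ_{R,S●} come from. The intervals for s then match the lines of the formula, and B comes from the
same sums with 0 in place of v, since this kills exactly the dipoles with c- or d-edges. -/

noncomputable section

namespace Dipole

open Equiv Function

/-! ### Locally finite sums of power series -/

/-- `F` is a locally finite family of power series with sum `S`. -/
def SumsTo {ι : Type} (F : ι → Series) (S : Series) : Prop :=
  ∀ m, (support fun i => MvPowerSeries.coeff m (F i)).Finite ∧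
    ∑ᶠ i, MvPowerSeries.coeff m (F i) = MvPowerSeries.coeff m S

namespace SumsTo

variable {ι κ : Type} {F : ι → Series} {G : κ → Series} {S T : Series}

theorem formalSum_eq (h : SumsTo F S) : formalSum F = S := by
  ext1 m
  exact (h m).2

theorem unique (h : SumsTo F S) (h' : SumsTo F T) : S = T :=
  h.formalSum_eq.symm.trans h'.formalSum_eq

theorem congr {F' : ι → Series} (h : SumsTo F S) (hF : ∀ i, F' i = F i) : SumsTo F' S := by
  rwa [funext hF]

theorem zero : SumsTo (fun _ : ι => 0) 0 := fun m => by simp [support]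

theorem add {F' : ι → Series} {S' : Series} (h : SumsTo F S) (h' : SumsTo F' S') :
    SumsTo (fun i => F i + F' i) (S + S') := fun m => by
  refine ⟨((h m).1.union (h' m).1).subset fun i hi => ?_, ?_⟩
  · simp only [Set.mem_union, mem_support, map_add] at hi ⊢
    by_contra! hc
    simp [hc.1, hc.2] at hi
  · simp only [map_add]
    rw [finsum_add_distrib (h m).1 (h' m).1, (h m).2, (h' m).2]

theorem finset_sum {τ : Type} (s : Finset τ) {F : τ → ι → Series} {S : τ → Series}
    (h : ∀ t ∈ s, SumsTo (F t) (S t)) : SumsTo (fun i => ∑ t ∈ s, F t i) (∑ t ∈ s, S t) := by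
  classical
  induction s using Finset.induction_on with
  | empty => simpa using zero
  | insert a s ha ih =>
    simp only [Finset.sum_insert ha]
    exact (h a (by simp)).add (ih fun t ht => h t (by simp [ht]))

/-- Vanishing members change neither supports nor sums. One direction reduces a sum over all dipoles
to a parametrised part; the other restricts the sum for Γ at v = 0 to the index type of B. -/
theorem comp_injective_iff {φ : κ → ι} (hφ : Injective φ) (h0 : ∀ i, i ∉ Set.range φ → F i = 0) :
    SumsTo (F ∘ φ) S ↔ SumsTo F S := by
  refine forall_congr' fun m => ?_
  have hs : (support fun i => MvPowerSeries.coeff m (F i)) =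
      φ '' (support fun k => MvPowerSeries.coeff m (F (φ k))) := by
    ext i
    simp only [mem_support, Set.mem_image]
    constructor
    · intro hi
      by_cases hr : i ∈ Set.range φ
      · obtain ⟨k, rfl⟩ := hr
        exact ⟨k, hi, rfl⟩
      · simp [h0 i hr] at hi
    · rintro ⟨k, hk, rfl⟩
      exact hk
  have hsum : ∑ᶠ i, MvPowerSeries.coeff m (F i) = ∑ᶠ k, MvPowerSeries.coeff m (F (φ k)) := by
    rw [← finsum_mem_range hφ (f := fun i => MvPowerSeries.coeff m (F i)), finsum_mem_def]
    refine finsum_congr fun i => ?_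
    by_cases hr : i ∈ Set.range φ
    · rw [Set.indicator_of_mem hr]
    · rw [Set.indicator_of_notMem hr, h0 i hr, map_zero]
  rw [hs, hsum, Set.finite_image_iff hφ.injOn]
  rfl

theorem of_injective {φ : κ → ι} (hφ : Injective φ) (h0 : ∀ i, i ∉ Set.range φ → F i = 0)
    (h : SumsTo (F ∘ φ) S) : SumsTo F S :=
  (comp_injective_iff hφ h0).1 h

theorem equiv_iff (e : κ ≃ ι) : SumsTo (F ∘ e) S ↔ SumsTo F S :=
  comp_injective_iff e.injective fun i hi => absurd (e.surjective i) hi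

/-- The Cauchy product of two locally finite families. -/
theorem mul (h : SumsTo F S) (h' : SumsTo G T) :
    SumsTo (fun p : ι × κ => F p.1 * G p.2) (S * T) := fun m => by
  classical
  -- Finite index sets containing every member that meets some monomial dividing m; both sums and
  -- their product can then be taken over finsets.
  let A : Finset ι := (Finset.HasAntidiagonal.antidiagonal m).biUnion fun p => (h p.1).1.toFinset
  let A' : Finset κ := (Finset.HasAntidiagonal.antidiagonal m).biUnion fun p => (h' p.2).1.toFinset
  have hA : ∀ p ∈ Finset.HasAntidiagonal.antidiagonal m, ∑ i ∈ A, MvPowerSeries.coeff p.1 (F i) =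
      MvPowerSeries.coeff p.1 S := fun p hp => by
    rw [← (h p.1).2]
    refine (finsum_eq_finsetSum_of_support_subset _ fun i hi => ?_).symm
    simp only [A, Finset.coe_biUnion, Set.mem_iUnion]
    exact ⟨p, hp, by simpa using hi⟩
  have hA' : ∀ p ∈ Finset.HasAntidiagonal.antidiagonal m, ∑ i ∈ A', MvPowerSeries.coeff p.2 (G i) =
      MvPowerSeries.coeff p.2 T := fun p hp => by
    rw [← (h' p.2).2]
    refine (finsum_eq_finsetSum_of_support_subset _ fun i hi => ?_).symm
    simp only [A', Finset.coe_biUnion, Set.mem_iUnion]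
    exact ⟨p, hp, by simpa using hi⟩
  have hsub : (support fun q : ι × κ => MvPowerSeries.coeff m (F q.1 * G q.2)) ⊆
      (A ×ˢ A' : Finset (ι × κ)) := by
    intro q hq
    rw [mem_support, MvPowerSeries.coeff_mul] at hq
    obtain ⟨p, hp, hne⟩ := Finset.exists_ne_zero_of_sum_ne_zero hq
    simp only [A, A', Finset.coe_product, Set.mem_prod, Finset.coe_biUnion, Set.mem_iUnion]
    exact ⟨⟨p, hp, by simpa using left_ne_zero_of_mul hne⟩,
      ⟨p, hp, by simpa using right_ne_zero_of_mul hne⟩⟩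
  refine ⟨(Finset.finite_toSet _).subset hsub, ?_⟩
  rw [finsum_eq_finsetSum_of_support_subset _ hsub, MvPowerSeries.coeff_mul]
  simp only [MvPowerSeries.coeff_mul]
  rw [Finset.sum_comm]
  refine Finset.sum_congr rfl fun p hp => ?_
  rw [Finset.sum_product, ← hA p hp, ← hA' p hp, Finset.sum_mul_sum]

theorem const_mul (c : Series) (h : SumsTo F S) : SumsTo (fun i => c * F i) (c * S) := by
  have hc : SumsTo (fun _ : Unit => c) c := fun m => ⟨Set.toFinite _, finsum_unique _⟩
  exact (equiv_iff (Equiv.punitProd ι).symm).2 (hc.mul h)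

/-- Summation along finite fibres. -/
theorem fiberwise {A : κ → Type} [∀ k, Fintype (A k)] {F : (Σ k, A k) → Series}
    (h : SumsTo F S) : SumsTo (fun k => ∑ a, F ⟨k, a⟩) S := fun m => by
  classical
  have hsub : (support fun k => MvPowerSeries.coeff m (∑ a, F ⟨k, a⟩)) ⊆
      ((h m).1.toFinset.image Sigma.fst : Finset κ) := by
    intro k hk
    rw [mem_support, map_sum] at hk
    obtain ⟨a, -, ha⟩ := Finset.exists_ne_zero_of_sum_ne_zero hk
    simp only [Finset.coe_image, Set.mem_image]
    exact ⟨⟨k, a⟩, by simpa using ha, rfl⟩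
  refine ⟨(Finset.finite_toSet _).subset hsub, ?_⟩
  have hsub' : (support fun i => MvPowerSeries.coeff m (F i)) ⊆
      (((h m).1.toFinset.image Sigma.fst).sigma fun k => (Finset.univ : Finset (A k)) :
        Finset (Σ k, A k)) := by
    intro i hi
    simp only [Finset.coe_sigma, Set.mem_sigma_iff, Finset.coe_image, Set.mem_image]
    exact ⟨⟨i, by simpa using hi, rfl⟩, by simp⟩
  have hs := (finsum_eq_finsetSum_of_support_subset _ hsub').symm.trans (h m).2
  rw [Finset.sum_sigma] at hs
  rw [finsum_eq_finsetSum_of_support_subset _ hsub]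
  simpa using hs

/-- A sum over a type that is partitioned into finitely many parametrised pieces. -/
theorem of_cases {τ : Type} [Fintype τ] [DecidableEq τ] (case : ι → τ) {S : τ → Series}
    (h : ∀ t, SumsTo (fun i => if case i = t then F i else 0) (S t)) : SumsTo F (∑ t, S t) :=
  (finset_sum Finset.univ fun t _ => h t).congr fun i => by simp

end SumsTo

/-! ### Exponential sums of complete symmetric functions -/

/-- The term of exponent `e` in `ESum z k u`. -/
def eTerm (z : Series) (k : ℕ) {n : ℕ} (u : Fin n → Series) (e : Fin n → ℕ) : Series :=
  (1 / (((∑ i, e i) + k).factorial : ℚ)) • ((∏ i, u i ^ e i) * z ^ ((∑ i, e i) + k))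

/-- `∑_e u^e z^{|e|+k} / (|e|+k)!`, over all exponents `e`. -/
def ESum (z : Series) (k : ℕ) {n : ℕ} (u : Fin n → Series) : Series := formalSum (eTerm z k u)

variable {z : Series} {n : ℕ}

/-- A series without constant term has order at least 1, so its N-th power has order at least N.
Local finiteness of the exponential families rests on this. -/
theorem coeff_mul_pow_eq_zero (hz : MvPowerSeries.constantCoeff z = 0) (a : Series) {m : Var →₀ ℕ}
    {N : ℕ} (h : m.degree < N) : MvPowerSeries.coeff m (a * z ^ N) = 0 := by
  apply MvPowerSeries.coeff_of_lt_order
  calc ((m.degree : ℕ) : ℕ∞) < N := by exact_mod_cast h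
    _ ≤ (z ^ N).order := MvPowerSeries.le_order_pow_of_constantCoeff_eq_zero N hz
    _ ≤ a.order + (z ^ N).order := le_add_self
    _ ≤ _ := MvPowerSeries.le_order_mul

theorem sumsTo_eTerm (hz : MvPowerSeries.constantCoeff z = 0) (k : ℕ) (u : Fin n → Series) :
    SumsTo (eTerm z k u) (ESum z k u) := fun m => by
  refine ⟨?_, rfl⟩
  -- Only exponents with all entries at most the degree of m can contribute, because the power of z
  -- is at least each entry.
  refine (Set.Finite.pi' (ι := Fin n) (t := fun _ => Set.Iic m.degree)
    fun i => Set.finite_Iic _).subset fun e he i => ?_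
  by_contra hi
  refine he ?_
  simp only [Set.mem_Iic, not_le] at hi
  have hle : e i ≤ ∑ i, e i := Finset.single_le_sum (fun _ _ => Nat.zero_le _) (Finset.mem_univ i)
  change MvPowerSeries.coeff m (_ • (_ * _)) = 0
  rw [← Algebra.smul_mul_assoc]
  exact coeff_mul_pow_eq_zero hz _ (by omega)

/-- Splitting off one argument. -/
theorem ESum_succAbove (hz : MvPowerSeries.constantCoeff z = 0) (k : ℕ) (u : Fin (n + 1) → Series)
    (p : Fin (n + 1)) :
    ESum z k u = ESum z k (fun i => u (p.succAbove i)) + u p * ESum z (k + 1) u := by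
  have hsplit : SumsTo (fun q : ℕ × (Fin n → ℕ) =>
      eTerm z k u (Fin.insertNthEquiv (fun _ => ℕ) p q)) (ESum z k u) :=
    (SumsTo.equiv_iff (Fin.insertNthEquiv (fun _ => ℕ) p)).2 (sumsTo_eTerm hz k u)
  -- The exponents with entry 0 at p lose an argument; in the others (`h2`) one factor `u p` is
  -- pulled out, and the shift of the total degree turns k into k + 1.
  have h1 : SumsTo (fun q : ℕ × (Fin n → ℕ) => if q.1 = 0 then
      eTerm z k u (Fin.insertNthEquiv (fun _ => ℕ) p q) else 0)
      (ESum z k (fun i => u (p.succAbove i))) := by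
    refine SumsTo.of_injective (φ := fun e => (0, e)) (fun a b h => (Prod.ext_iff.1 h).2) ?_
      ((sumsTo_eTerm hz k _).congr fun e => ?_)
    · rintro ⟨a, e⟩ h
      rw [if_neg]
      rintro rfl
      exact h ⟨e, rfl⟩
    · simp [eTerm, Fin.sum_univ_succAbove _ p, Fin.prod_univ_succAbove _ p]
  have h2 : SumsTo (fun q : ℕ × (Fin n → ℕ) => if q.1 = 0 then 0 else
      eTerm z k u (Fin.insertNthEquiv (fun _ => ℕ) p q)) (u p * ESum z (k + 1) u) := by
    refine SumsTo.of_injective (φ := fun q : ℕ × (Fin n → ℕ) => (q.1 + 1, q.2)) ?_ ?_ ?_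
    · rintro ⟨a, e⟩ ⟨b, e'⟩ h
      simpa using h
    · rintro ⟨_ | a, e⟩ h
      · simp
      · exact absurd ⟨(a, e), rfl⟩ h
    · refine (((SumsTo.equiv_iff (Fin.insertNthEquiv (fun _ => ℕ) p)).2
        (sumsTo_eTerm hz (k + 1) u)).const_mul (u p)).congr fun q => ?_
      simp only [comp_apply, eTerm, Fin.insertNthEquiv_apply, Fin.sum_univ_succAbove _ p,
        Fin.prod_univ_succAbove _ p, Fin.insertNth_apply_same, Fin.insertNth_apply_succAbove,
        mul_smul_comm, Nat.add_eq_zero_iff, one_ne_zero, and_false, if_false]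
      rw [show q.1 + 1 + ∑ i, q.2 i + k = q.1 + ∑ i, q.2 i + (k + 1) by ring]
      ring_nf
  refine hsplit.unique ((h1.add h2).congr fun q => ?_)
  by_cases h : q.1 = 0 <;> simp [h]

theorem ESum_snoc (hz : MvPowerSeries.constantCoeff z = 0) (k : ℕ) (u : Fin (n + 1) → Series) :
    ESum z k u = ESum z k (fun i : Fin n => u i.castSucc) + u (Fin.last n) * ESum z (k + 1) u := by
  simpa using ESum_succAbove hz k u (Fin.last n)

theorem ESum_elim0 (z : Series) (u : Fin 0 → Series) : ESum z 0 u = 1 := by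
  ext1 m
  change ∑ᶠ i, _ = _
  rw [finsum_unique]
  simp [eTerm]

/-- Only the zero exponent survives at z = 0. With `ESum_zero_succ` this evaluates the case sums at
v = 0, that is, the series B. -/
theorem ESum_zero_zero (u : Fin n → Series) : ESum 0 0 u = 1 := by
  refine (SumsTo.formalSum_eq (F := eTerm 0 0 u) ?_)
  refine SumsTo.of_injective (φ := fun _ : Unit => (0 : Fin n → ℕ)) (fun _ _ _ => rfl)
    (fun e he => ?_) fun m => ⟨Set.toFinite _, by rw [finsum_unique]; simp [eTerm]⟩
  have h : ∑ i, e i ≠ 0 := by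
    intro h
    refine he ⟨(), ?_⟩
    funext i
    simp only [Finset.sum_eq_zero_iff, Finset.mem_univ, true_implies] at h
    simp [h i]
  simp [eTerm, h]

theorem ESum_zero_succ (k : ℕ) (u : Fin n → Series) : ESum 0 (k + 1) u = 0 := by
  refine (SumsTo.formalSum_eq (F := eTerm 0 (k + 1) u) ?_)
  refine SumsTo.zero.congr fun e => ?_
  simp [eTerm]

/-- Exponents, as multisets of given cardinality. -/
def symEquivExponent (n : ℕ) : (Σ j, Sym (Fin n) j) ≃ (Fin n → ℕ) :=
  ((Equiv.sigmaFiberEquiv Multiset.card).trans Multiset.toFinsupp.toEquiv).trans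
    Finsupp.equivFunOnFinite

theorem eTerm_symEquivExponent (k : ℕ) (u : Fin n → Series) (s : Σ j, Sym (Fin n) j) :
    eTerm z k u (symEquivExponent n s) =
      (1 / ((s.1 + k).factorial : ℚ)) • ((s.2.1.map u).prod * z ^ (s.1 + k)) := by
  obtain ⟨j, s, hs⟩ := s
  have h1 : ∀ i, symEquivExponent n ⟨j, s, hs⟩ i = s.count i := fun i => rfl
  have h2 : ∑ i, s.count i = j := by rw [← hs]; simp
  have h3 : (s.map u).prod = ∏ i, u i ^ s.count i := Finset.prod_multiset_map_count s u ▸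
    -- Indices outside the multiset have multiplicity 0 and contribute a factor 1.
    Finset.prod_subset (Finset.subset_univ _) fun i _ hi => by
      simp [Multiset.count_eq_zero.2 (by simpa using hi)]
  simp only [eTerm, h1, h2, h3]

/-- Summation by the total degree. -/
theorem sumsTo_hsymm (hz : MvPowerSeries.constantCoeff z = 0) (k : ℕ) (u : Fin n → Series) :
    SumsTo (fun j : ℕ => (1 / ((j + k).factorial : ℚ)) •
      (MvPolynomial.aeval u (MvPolynomial.hsymm (Fin n) ℚ j) * z ^ (j + k))) (ESum z k u) := by
  refine (((SumsTo.equiv_iff (symEquivExponent n)).2 (sumsTo_eTerm hz k u)).fiberwise).congr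
    fun j => ?_
  simp only [comp_apply, eTerm_symEquivExponent]
  rw [← Finset.smul_sum, ← Finset.sum_mul, MvPolynomial.hsymm, map_sum]
  simp [map_multiset_prod]

/-- A complete symmetric function is the sum of all monomials of its degree, so φ is the diagonal
case in which k equals the number of arguments. -/
theorem phi_eq_ESum (hz : MvPowerSeries.constantCoeff z = 0) (xs : List Series) :
    phi z xs = ESum z xs.length xs.get :=
  (sumsTo_hsymm hz _ _).formalSum_eq

/-- With equal arguments all monomials of degree j coincide, and there are `n.multichoose j` of
them. -/
theorem sumsTo_const (hz : MvPowerSeries.constantCoeff z = 0) (k : ℕ) (c : Series) :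
    SumsTo (fun j : ℕ => (((n.multichoose j : ℕ) : ℚ) / ((j + k).factorial : ℚ)) •
      (c ^ j * z ^ (j + k))) (ESum z k fun _ : Fin n => c) := by
  refine (sumsTo_hsymm hz k _).congr fun j => ?_
  have h : MvPolynomial.aeval (fun _ : Fin n => c) (MvPolynomial.hsymm (Fin n) ℚ j) =
      ((n.multichoose j : ℕ) : ℚ) • c ^ j := by
    rw [MvPolynomial.hsymm, map_sum]
    simp [map_multiset_prod, Sym.card_sym_fin_eq_multichoose, Nat.cast_smul_eq_nsmul]
  rw [h, smul_mul_assoc, smul_smul]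
  ring_nf

/-! ### Faces and the dipoles of genus one -/

theorem val_finRotate {n : ℕ} (i : Fin n) :
    (finRotate n i : ℕ) = if (i : ℕ) + 1 = n then 0 else (i : ℕ) + 1 := by
  obtain _ | n := n
  · exact i.elim0
  · rw [coe_finRotate]
    simp [Fin.ext_iff]

theorem val_finRotate_symm {n : ℕ} (i : Fin n) :
    ((finRotate n).symm i : ℕ) = if (i : ℕ) = 0 then n - 1 else (i : ℕ) - 1 := by
  have h := val_finRotate ((finRotate n).symm i)
  rw [apply_symm_apply] at h
  split_ifs at h ⊢ <;> omega

namespace RootedDipole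

variable {n : ℕ} (D : RootedDipole n)

theorem mem_periodicPts (i : Fin n) : i ∈ periodicPts D.nextCorner :=
  D.nextCorner.injective.mem_periodicPts i

theorem walk_eq (i : Fin n) : (D.walk i : Cycle (Fin n)) = periodicOrbit D.nextCorner i := by
  rw [walk, ← List.range_map_iterate]
  rfl

theorem mem_faces {c : Cycle (Fin n)} : c ∈ D.faces ↔ ∃ i, periodicOrbit D.nextCorner i = c := by
  simp [faces, walk_eq]

theorem periodicOrbit_eq_iff {i j : Fin n} :
    periodicOrbit D.nextCorner i = periodicOrbit D.nextCorner j ↔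
      i ∈ periodicOrbit D.nextCorner j := by
  constructor
  · intro h
    rw [← h]
    exact self_mem_periodicOrbit (D.mem_periodicPts i)
  · intro h
    obtain ⟨m, rfl⟩ := (mem_periodicOrbit_iff (D.mem_periodicPts j)).1 h
    exact periodicOrbit_apply_iterate_eq (D.mem_periodicPts j) m

/-- The fibres of the map sending a corner to its face are the faces themselves, each a
duplicate-free orbit. -/
theorem sum_length_faces : ∑ c ∈ D.faces, c.length = n := by
  have h := Finset.card_eq_sum_card_image (fun i => periodicOrbit D.nextCorner i) Finset.univ
  rw [Finset.card_univ, Fintype.card_fin] at h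
  refine Eq.trans ?_ h.symm
  have hf : D.faces = Finset.univ.image fun i => periodicOrbit D.nextCorner i := by
    simp only [faces, walk_eq]
  rw [hf]
  refine Finset.sum_congr rfl fun c hc => ?_
  obtain ⟨j, -, rfl⟩ := Finset.mem_image.1 hc
  simp only [periodicOrbit_eq_iff]
  have hn : (periodicOrbit D.nextCorner j).Nodup := nodup_periodicOrbit
  have hcard : (periodicOrbit D.nextCorner j).toFinset.card =
      (periodicOrbit D.nextCorner j).length := by
    revert hn
    induction periodicOrbit D.nextCorner j using Quotient.inductionOn'
    intro hn
    simpa using List.toFinset_card_of_nodup hn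
  rw [← hcard]
  congr 1
  ext i
  simp only [Finset.mem_filter, Finset.mem_univ, true_and]
  induction periodicOrbit D.nextCorner j using Quotient.inductionOn'
  simp

theorem one_le_length {c : Cycle (Fin n)} (hc : c ∈ D.faces) : 1 ≤ c.length := by
  obtain ⟨i, rfl⟩ := D.mem_faces.1 hc
  rw [periodicOrbit_length]
  exact minimalPeriod_pos_of_mem_periodicPts (D.mem_periodicPts i)

/-- The right side is `twiceGenus`: twice the genus is the total excess of the orbit lengths over 1,
and genus one leaves an excess of 2 to distribute. -/
theorem sum_length_sub_one : ∑ c ∈ D.faces, (c.length - 1) = n - D.faces.card := by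
  have h : ∑ c ∈ D.faces, (c.length - 1) + D.faces.card = n := by
    conv_rhs => rw [← D.sum_length_faces]
    rw [Finset.card_eq_sum_ones, ← Finset.sum_add_distrib]
    refine Finset.sum_congr rfl fun c hc => ?_
    have := D.one_le_length hc
    omega
  omega

/-- A permutation with `n - 2` cycles is a cycle of length three or a product of two disjoint
transpositions. -/
theorem exists_shape (h : D.twiceGenus = 2) :
    (∃ i j k, i ≠ j ∧ i ≠ k ∧ j ≠ k ∧ D.nextCorner i = j ∧ D.nextCorner j = k ∧
      D.nextCorner k = i ∧ ∀ l, l ≠ i → l ≠ j → l ≠ k → D.nextCorner l = l) ∨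
    (∃ i j k l, i ≠ j ∧ i ≠ k ∧ i ≠ l ∧ j ≠ k ∧ j ≠ l ∧ k ≠ l ∧ D.nextCorner i = j ∧
      D.nextCorner j = i ∧ D.nextCorner k = l ∧ D.nextCorner l = k ∧
      ∀ m, m ≠ i → m ≠ j → m ≠ k → m ≠ l → D.nextCorner m = m) := by
  classical
  have hsum := D.sum_length_sub_one
  rw [← twiceGenus, h] at hsum
  have hfix : ∀ l, (periodicOrbit D.nextCorner l).length - 1 = 0 → D.nextCorner l = l := by
    intro l hl
    have h1 := D.one_le_length (D.mem_faces.2 ⟨l, rfl⟩)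
    rw [periodicOrbit_length] at h1 hl
    exact minimalPeriod_eq_one_iff_isFixedPt.1 (by omega)
  have hmem : ∀ {i l m}, 0 < m → D.nextCorner^[m] i = i → l ∈ periodicOrbit D.nextCorner i →
      ∃ r < m, l = D.nextCorner^[r] i := by
    intro i l m hm hi hl
    obtain ⟨r, rfl⟩ := (mem_periodicOrbit_iff (D.mem_periodicPts i)).1 hl
    exact ⟨r % m, Nat.mod_lt _ hm, (IsPeriodicPt.iterate_mod_apply hi r).symm⟩
  have horb : ∀ {i}, periodicOrbit D.nextCorner i ∈ D.faces := fun {i} => D.mem_faces.2 ⟨i, rfl⟩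
  obtain ⟨c, hc, hne⟩ := Finset.exists_ne_zero_of_sum_ne_zero (by rw [hsum]; norm_num :
    ∑ c ∈ D.faces, (c.length - 1) ≠ 0)
  obtain ⟨i, rfl⟩ := D.mem_faces.1 hc
  rw [← Finset.add_sum_erase _ _ hc] at hsum
  have h2 : ∀ {i}, minimalPeriod D.nextCorner i = 2 →
      D.nextCorner i ≠ i ∧ D.nextCorner (D.nextCorner i) = i := by
    intro i hi
    obtain ⟨h1, h2⟩ := (minimalPeriod_eq_prime_iff (hp := ⟨Nat.prime_two⟩)).1 hi
    exact ⟨h2, h1⟩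
  -- An excess of 2 is either concentrated in one orbit of length three or shared by two orbits of
  -- length two; every remaining orbit is a fixed corner.
  rcases (by omega : (periodicOrbit D.nextCorner i).length - 1 = 2 ∨
      (periodicOrbit D.nextCorner i).length - 1 = 1)
    with hl | hl
  · left
    rw [hl] at hsum
    rw [periodicOrbit_length] at hl
    obtain ⟨h3, h1⟩ := (minimalPeriod_eq_prime_iff (hp := ⟨Nat.prime_three⟩)).1
      (by omega : minimalPeriod D.nextCorner i = 3)
    replace h3 : D.nextCorner (D.nextCorner (D.nextCorner i)) = i := h3
    replace h1 : D.nextCorner i ≠ i := h1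
    refine ⟨i, D.nextCorner i, D.nextCorner (D.nextCorner i), h1.symm, fun he => h1 ?_,
      fun he => h1 (D.nextCorner.injective he.symm),
      rfl, rfl, h3, fun l ha hb hd => hfix l ?_⟩
    · conv_rhs => rw [← h3, ← he]
    · refine Finset.sum_eq_zero_iff.1 (Nat.add_eq_left.1 hsum) _
        (Finset.mem_erase.2 ⟨fun he => ?_, horb⟩)
      obtain ⟨r, hr, hlr⟩ := hmem (m := 3) (by norm_num) h3 (D.periodicOrbit_eq_iff.1 he)
      interval_cases r
      · exact ha hlr
      · exact hb hlr
      · exact hd hlr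
  · right
    rw [hl] at hsum
    rw [periodicOrbit_length] at hl
    obtain ⟨hi1, hi2⟩ := h2 (by omega : minimalPeriod D.nextCorner i = 2)
    obtain ⟨c, hc', hne'⟩ := Finset.exists_ne_zero_of_sum_ne_zero (by omega :
      ∑ c ∈ D.faces.erase (periodicOrbit D.nextCorner i), (c.length - 1) ≠ 0)
    obtain ⟨k, rfl⟩ := D.mem_faces.1 (Finset.mem_of_mem_erase hc')
    have hki := Finset.ne_of_mem_erase hc'
    rw [← Finset.add_sum_erase _ _ hc'] at hsum
    have hk : (periodicOrbit D.nextCorner k).length - 1 = 1 := by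
      omega
    rw [hk, ← add_assoc] at hsum
    rw [periodicOrbit_length] at hk
    obtain ⟨hk1, hk2⟩ := h2 (by omega : minimalPeriod D.nextCorner k = 2)
    have hne : ∀ r s, D.nextCorner^[r] k ≠ D.nextCorner^[s] i := by
      intro r s hrs
      refine hki ?_
      rw [← periodicOrbit_apply_iterate_eq (D.mem_periodicPts k) r,
        ← periodicOrbit_apply_iterate_eq (D.mem_periodicPts i) s]
      rw [hrs]
    refine ⟨i, D.nextCorner i, k, D.nextCorner k, hi1.symm, fun h => hne 0 0 h.symm,
      fun h => hne 1 0 h.symm,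
      fun h => hne 0 1 h.symm, fun h => hne 1 1 h.symm, hk1.symm, rfl, hi2, rfl, hk2,
      fun l ha hb hd he => hfix l ?_⟩
    refine Finset.sum_eq_zero_iff.1 ((Nat.add_eq_left (a := 2)).1 hsum) _
      (Finset.mem_erase.2 ⟨fun hl => ?_, Finset.mem_erase.2 ⟨fun hl => ?_, horb⟩⟩)
    · obtain ⟨r, hr, hlr⟩ := hmem (m := 2) (by norm_num) hk2 (D.periodicOrbit_eq_iff.1 hl)
      interval_cases r
      · exact hd hlr
      · exact he hlr
    · obtain ⟨r, hr, hlr⟩ := hmem (m := 2) (by norm_num) hi2 (D.periodicOrbit_eq_iff.1 hl)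
      interval_cases r
      · exact ha hlr
      · exact hb hlr

theorem rot_finRotate_nextCorner (i : Fin n) : D.rot (finRotate n (D.nextCorner i)) = i := by
  have h : (D.rot * finRotate n) (D.nextCorner i) = i :=
    (D.rot * finRotate n).apply_symm_apply i
  exact h

/-- The rotation of the non-root vertex cannot preserve an interval of edges. -/
theorem not_preserves_interval {p q : Fin n} (hpq : p < q)
    (h : ∀ j, p ≤ j → j < q → ∃ i, D.nextCorner i = j ∧ p < i ∧ i ≤ q) : False := by
  -- `rot` sends m to the corner whose successor is m − 1, so it maps the interval (p,q] into
  -- itself. A full cycle through q would have to reach p, which lies outside.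
  have hstep : ∀ m, p < m → m ≤ q → p < D.rot m ∧ D.rot m ≤ q := by
    intro m hpm hmq
    have hv := val_finRotate_symm m
    rw [if_neg (by omega)] at hv
    obtain ⟨i, hi, h1, h2⟩ := h ((finRotate n).symm m) (by omega) (by omega)
    have := D.rot_finRotate_nextCorner i
    rw [hi, apply_symm_apply] at this
    rw [this]
    exact ⟨h1, h2⟩
  have hall : ∀ k, p < (D.rot ^ k) q ∧ (D.rot ^ k) q ≤ q := by
    intro k
    induction k with
    | zero => exact ⟨hpq, le_rfl⟩
    | succ k ih =>
      rw [pow_succ', Perm.mul_apply]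
      exact hstep _ ih.1 ih.2
  have hc : D.rot.IsCycleOn ((Finset.univ : Finset (Fin n)) : Set (Fin n)) := by
    simpa using D.full
  obtain ⟨k, -, hk⟩ := hc.exists_pow_eq (Finset.mem_univ q) (Finset.mem_univ p)
  exact absurd (hall k).1 (by simp [hk])

/-- With the least corner first, the cycle runs either upwards, which is the quadruple with c = d,
or downwards; in the latter case the rotation would preserve the edges in (i,k]. -/
theorem exists_quad_of_three {i j k : Fin n} (hij : i < j) (hik : i < k) (hjk : j ≠ k)
    (h1 : D.nextCorner i = j) (h2 : D.nextCorner j = k) (h3 : D.nextCorner k = i)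
    (h4 : ∀ l, l ≠ i → l ≠ j → l ≠ k → D.nextCorner l = l) :
    ∃ a b c d : Fin n, a < b ∧ b < c ∧ c ≤ d ∧ D.nextCorner = swap b d * swap a c := by
  rcases lt_or_gt_of_ne hjk with hlt | hlt
  · refine ⟨i, j, k, k, hij, hlt, le_rfl, Equiv.ext fun l => ?_⟩
    by_cases hi : l = i
    · subst hi; simp [h1]
    by_cases hj : l = j
    · subst hj
      rw [Perm.mul_apply, swap_apply_of_ne_of_ne hi hjk, swap_apply_left, h2]
    by_cases hk : l = k
    · subst hk
      rw [Perm.mul_apply, swap_apply_right, swap_apply_of_ne_of_ne hij.ne hik.ne, h3]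
    rw [Perm.mul_apply, swap_apply_of_ne_of_ne hi hk, swap_apply_of_ne_of_ne hj hk, h4 l hi hj hk]
  · refine (D.not_preserves_interval hik fun l hl1 hl2 => ?_).elim
    rcases hl1.eq_or_lt with rfl | hl1
    · exact ⟨k, h3, hik, le_rfl⟩
    · exact ⟨l, h4 l hl1.ne' (hl2.trans hlt).ne hl2.ne, hl1, hl2.le⟩

/-- Two transpositions are disjoint, crossing or nested. If they do not cross, the edges between the
ends of one of them form an interval invariant under the rotation. -/
theorem exists_quad_of_two {i j k l : Fin n} (hij : i < j) (hkl : k < l) (hik : i < k)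
    (hjk : j ≠ k) (hjl : j ≠ l) (h1 : D.nextCorner i = j) (h2 : D.nextCorner j = i)
    (h3 : D.nextCorner k = l) (h4 : D.nextCorner l = k)
    (h5 : ∀ m, m ≠ i → m ≠ j → m ≠ k → m ≠ l → D.nextCorner m = m) :
    ∃ a b c d : Fin n, a < b ∧ b < c ∧ c ≤ d ∧ D.nextCorner = swap b d * swap a c := by
  rcases lt_or_gt_of_ne hjk with hlt | hlt
  · refine (D.not_preserves_interval hij fun m hm1 hm2 => ?_).elim
    rcases hm1.eq_or_lt with rfl | hm1
    · exact ⟨j, h2, hij, le_rfl⟩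
    · exact ⟨m, h5 m hm1.ne' hm2.ne (hm2.trans hlt).ne (hm2.trans (hlt.trans hkl)).ne, hm1, hm2.le⟩
  rcases lt_or_gt_of_ne hjl with hlt' | hlt'
  · refine ⟨i, k, j, l, hik, hlt, hlt'.le, Equiv.ext fun m => ?_⟩
    by_cases hi : m = i
    · subst hi
      rw [Perm.mul_apply, swap_apply_left, swap_apply_of_ne_of_ne hjk hjl, h1]
    by_cases hj : m = j
    · subst hj
      rw [Perm.mul_apply, swap_apply_right, swap_apply_of_ne_of_ne hik.ne (hik.trans hkl).ne, h2]
    by_cases hk : m = k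
    · subst hk
      rw [Perm.mul_apply, swap_apply_of_ne_of_ne hi hj, swap_apply_left, h3]
    by_cases hl : m = l
    · subst hl
      rw [Perm.mul_apply, swap_apply_of_ne_of_ne hi hj, swap_apply_right, h4]
    rw [Perm.mul_apply, swap_apply_of_ne_of_ne hi hj, swap_apply_of_ne_of_ne hk hl,
      h5 m hi hj hk hl]
  · refine (D.not_preserves_interval hkl fun m hm1 hm2 => ?_).elim
    rcases hm1.eq_or_lt with rfl | hm1
    · exact ⟨l, h4, hkl, le_rfl⟩
    · exact ⟨m, h5 m (hik.trans hm1).ne' (hm2.trans hlt').ne hm1.ne' hm2.ne, hm1, hm2.le⟩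

/-- The face permutation of a dipole of genus one. -/
theorem exists_quad (h : D.twiceGenus = 2) :
    ∃ a b c d : Fin n, a < b ∧ b < c ∧ c ≤ d ∧ D.nextCorner = swap b d * swap a c := by
  rcases D.exists_shape h with ⟨i, j, k, hij, hik, hjk, h1, h2, h3, h4⟩ |
    ⟨i, j, k, l, hij, hik, hil, hjk, hjl, hkl, h1, h2, h3, h4, h5⟩
  -- A 3-cycle may be rotated so that its least corner comes first; for two transpositions the least
  -- corner is brought to the front by exchanging ends and factors.
  · by_cases hmi : i < j ∧ i < k
    · exact D.exists_quad_of_three hmi.1 hmi.2 hjk h1 h2 h3 h4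
    by_cases hmj : j < k ∧ j < i
    · exact D.exists_quad_of_three hmj.1 hmj.2 hik.symm h2 h3 h1 fun l a b c => h4 l c a b
    · exact D.exists_quad_of_three (by omega : k < i) (by omega : k < j) hij h3 h1 h2
        fun l a b c => h4 l b c a
  · have key : ∀ {i j k l}, i ≠ j → k ≠ l → i < k → i < l → j ≠ k → j ≠ l → i < j →
        D.nextCorner i = j → D.nextCorner j = i → D.nextCorner k = l → D.nextCorner l = k →
        (∀ m, m ≠ i → m ≠ j → m ≠ k → m ≠ l → D.nextCorner m = m) →
        ∃ a b c d : Fin n, a < b ∧ b < c ∧ c ≤ d ∧ D.nextCorner = swap b d * swap a c := by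
      intro i j k l hij hkl hik hil hjk hjl hij' h1 h2 h3 h4 h5
      rcases lt_or_gt_of_ne hkl with hlt | hlt
      · exact D.exists_quad_of_two hij' hlt hik hjk hjl h1 h2 h3 h4 h5
      · exact D.exists_quad_of_two hij' hlt hil hjl hjk h1 h2 h4 h3
          fun m a b c d => h5 m a b d c
    by_cases hmi : i < j ∧ i < k ∧ i < l
    · exact key hij hkl hmi.2.1 hmi.2.2 hjk hjl hmi.1 h1 h2 h3 h4 h5
    by_cases hmj : j < i ∧ j < k ∧ j < l
    · exact key hij.symm hkl hmj.2.1 hmj.2.2 hik hil hmj.1 h2 h1 h3 h4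
        fun m a b c d => h5 m b a c d
    by_cases hmk : k < l ∧ k < i ∧ k < j
    · exact key hkl hij hmk.2.1 hmk.2.2 hil.symm hjl.symm hmk.1 h3 h4 h1 h2
        fun m a b c d => h5 m c d a b
    · exact key hkl.symm hij (by omega : l < i) (by omega) hik.symm hjk.symm (by omega) h4 h3 h1 h2
        fun m a b c d => h5 m c d b a

end RootedDipole

/-- The position, counted from the root edge, of edge `j` around the non-root vertex of the dipole
of genus one whose non-trivial face permutation is supported on `a < b < c ≤ d`. -/
def quadPos (n a b c d j : ℕ) : ℕ :=
  if j = 0 then 0 else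
  if j ≤ a then n - j else
  if j ≤ b then n - d + (b - j) else
  if j ≤ c then n - d + (b - a) + (c - j) else
  if j ≤ d then n - d + (c - a) + (d - j) else n - j

theorem val_swap {n : ℕ} (i j k : Fin n) :
    (swap i j k : ℕ) = if (k : ℕ) = i then (j : ℕ) else if (k : ℕ) = j then (i : ℕ) else k := by
  rw [swap_apply_def]
  simp only [Fin.ext_iff]
  split_ifs <;> rfl

/-! ### The rotation at the non-root vertex, and existence of the toroidal dipoles -/

section Quad

variable {n : ℕ} {a b c d : Fin n} {ρ : Perm (Fin n)}

/-- The order claimed by `quadPos` is 0; n−1,…,d+1; b,…,a+1; c,…,b+1; d,…,c+1; a,…,1. Inside a run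
the rotation is j ↦ j − 1, and the two transpositions make the jumps between runs. The hypothesis
leaves out only the last position, from which the rotation returns to 0. -/
theorem quadPos_apply (hab : a < b) (hbc : b < c) (hcd : c ≤ d)
    (hρ : ∀ j, ρ j = swap a c (swap b d ((finRotate n).symm j))) (j : Fin n)
    (hj : quadPos n a b c d j + 1 < n) :
    quadPos n a b c d (ρ j) = quadPos n a b c d j + 1 := by
  have h0 := val_finRotate_symm j
  have h1 := val_swap b d ((finRotate n).symm j)
  have h2 := val_swap a c (swap b d ((finRotate n).symm j))
  rw [← hρ] at h2
  rw [Fin.lt_def] at hab hbc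
  rw [Fin.le_def] at hcd
  have := j.2
  have := d.2
  generalize (ρ j : ℕ) = r at *
  generalize (swap b d ((finRotate n).symm j) : ℕ) = s at *
  generalize ((finRotate n).symm j : ℕ) = t at *
  generalize (j : ℕ) = j at *
  generalize (a : ℕ) = a at *
  generalize (b : ℕ) = b at *
  generalize (c : ℕ) = c at *
  generalize (d : ℕ) = d at *
  -- The table of `swap a c ∘ swap b d`; the value at b depends on whether c = d, since then d is
  -- moved once more.
  have hr : (t = a ∧ r = c) ∨ (t = b ∧ c < d ∧ r = d) ∨ (t = b ∧ c = d ∧ r = a) ∨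
      (t = c ∧ c < d ∧ r = a) ∨
      (t = d ∧ r = b) ∨ (t ≠ a ∧ t ≠ b ∧ t ≠ c ∧ t ≠ d ∧ r = t) := by
    split_ifs at h1 <;> split_ifs at h2 <;> omega
  clear h1 h2
  have ht : (j = 0 ∧ t = n - 1) ∨ (0 < j ∧ t = j - 1) := by
    split_ifs at h0 <;> omega
  clear h0
  unfold quadPos at *
  split_ifs at hj ⊢ <;> omega

theorem quadPos_iterate (hab : a < b) (hbc : b < c) (hcd : c ≤ d)
    (hρ : ∀ j, ρ j = swap a c (swap b d ((finRotate n).symm j))) (z : Fin n) (hz : (z : ℕ) = 0)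
    {k : ℕ} (hk : k < n) : quadPos n a b c d (ρ^[k] z) = k := by
  induction k with
  | zero => simp [quadPos, hz]
  | succ k ih =>
    rw [iterate_succ_apply', quadPos_apply hab hbc hcd hρ _ (by rw [ih (by omega)]; exact hk),
      ih (by omega)]

/-- The first n iterates of the root edge have different positions, hence exhaust the edges. So
every quadruple a < b < c ≤ d does give a single cycle at the non-root vertex. -/
theorem exists_iterate_eq (hab : a < b) (hbc : b < c) (hcd : c ≤ d)
    (hρ : ∀ j, ρ j = swap a c (swap b d ((finRotate n).symm j))) (z : Fin n) (hz : (z : ℕ) = 0)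
    (j : Fin n) : ∃ k < n, ρ^[k] z = j := by
  have hinj : Injective fun k : Fin n => ρ^[k] z := fun k l hkl => by
    have h := congrArg (fun i : Fin n => quadPos n a b c d i) hkl
    simp only [quadPos_iterate hab hbc hcd hρ z hz k.2,
      quadPos_iterate hab hbc hcd hρ z hz l.2] at h
    exact Fin.ext h
  obtain ⟨k, hk⟩ := (Finite.injective_iff_surjective.1 hinj) j
  exact ⟨k, k.2, hk⟩

/-- The rooted dipole of genus one with the given support of the face permutation. -/
def ofQuad (hab : a < b) (hbc : b < c) (hcd : c ≤ d) : RootedDipole n where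
  pos := a.pos
  rot := swap a c * swap b d * (finRotate n).symm
  full := by
    refine ⟨⟨fun _ _ => trivial, (Equiv.injective _).injOn, fun x _ =>
      ⟨_, trivial, (Equiv.apply_symm_apply _ x)⟩⟩, fun i _ j _ => ?_⟩
    have h : ∀ j, Perm.SameCycle (swap a c * swap b d * (finRotate n).symm) ⟨0, a.pos⟩ j := by
      intro j
      obtain ⟨k, -, hk⟩ := exists_iterate_eq (ρ := swap a c * swap b d * (finRotate n).symm)
        hab hbc hcd (fun _ => rfl) ⟨0, a.pos⟩ rfl j
      exact ⟨k, by rw [zpow_natCast, Perm.coe_pow]; exact hk⟩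
    exact (h i).symm.trans (h j)

theorem nextCorner_ofQuad (hab : a < b) (hbc : b < c) (hcd : c ≤ d) :
    (ofQuad hab hbc hcd).nextCorner = swap b d * swap a c := by
  refine (congrArg (·⁻¹) (inv_mul_cancel_right (Equiv.swap a c * Equiv.swap b d)
    (finRotate n))).trans ?_
  rw [mul_inv_rev, swap_inv, swap_inv]

end Quad

/-! ### Faces of a toroidal dipole and uniqueness of its support -/

namespace RootedDipole

variable {n : ℕ} {a b c d : Fin n}

theorem nextCorner_injective {D D' : RootedDipole n} (h : D.nextCorner = D'.nextCorner) :
    D = D' := by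
  obtain ⟨p, r, f⟩ := D
  obtain ⟨p', r', f'⟩ := D'
  have : r = r' := by simpa [nextCorner] using h
  subst this
  rfl

/-- The face permutation of `D` is the one of genus one with support `a < b < c ≤ d`. -/
structure IsQuad (D : RootedDipole n) (a b c d : Fin n) : Prop where
  hab : a < b
  hbc : b < c
  hcd : c ≤ d
  nextCorner_eq : D.nextCorner = swap b d * swap a c

namespace IsQuad

variable {D : RootedDipole n}

theorem rot_eq (h : D.IsQuad a b c d) (j : Fin n) :
    D.rot j = swap a c (swap b d ((finRotate n).symm j)) := by
  have h' : D.rot = (D.nextCorner)⁻¹ * (finRotate n)⁻¹ := by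
    rw [nextCorner, inv_inv, mul_inv_cancel_right]
  rw [h', h.nextCorner_eq, mul_inv_rev, swap_inv, swap_inv]
  rfl

/-- Identifies the position in the list of iterates with the explicit `quadPos`, so that all region
counts become arithmetic. -/
theorem idxOf_iterate (h : D.IsQuad a b c d) (j : Fin n) :
    (List.iterate D.rot D.root n).idxOf j = quadPos n a b c d j := by
  have hq := fun {k} (hk : k < n) =>
    quadPos_iterate h.hab h.hbc h.hcd h.rot_eq D.root rfl hk
  obtain ⟨k, hk, rfl⟩ := exists_iterate_eq h.hab h.hbc h.hcd h.rot_eq D.root rfl j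
  rw [hq hk]
  have hnd : (List.iterate D.rot D.root n).Nodup := by
    rw [← List.range_map_iterate]
    refine List.Nodup.map_on (fun x hx y hy hxy => ?_) List.nodup_range
    rw [← hq (List.mem_range.1 hx), hxy, hq (List.mem_range.1 hy)]
  have := hnd.idxOf_getElem k (by simpa using hk)
  rwa [List.getElem_iterate] at this

theorem nextCorner_of_ne (h : D.IsQuad a b c d) {i : Fin n} (ha : i ≠ a) (hb : i ≠ b)
    (hc : i ≠ c) (hd : i ≠ d) : D.nextCorner i = i := by
  rw [h.nextCorner_eq, Perm.mul_apply, swap_apply_of_ne_of_ne ha hc, swap_apply_of_ne_of_ne hb hd]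

theorem periodicOrbit_of_ne (h : D.IsQuad a b c d) {i : Fin n} (ha : i ≠ a) (hb : i ≠ b)
    (hc : i ≠ c) (hd : i ≠ d) : periodicOrbit D.nextCorner i = ([i] : List (Fin n)) := by
  have hm : minimalPeriod D.nextCorner i = 1 :=
    minimalPeriod_eq_one_iff_isFixedPt.2 (h.nextCorner_of_ne ha hb hc hd)
  rw [periodicOrbit_def, hm]
  rfl

end IsQuad

end RootedDipole

namespace RootedDipole

namespace IsQuad

variable {n : ℕ} {a b c d : Fin n} {D : RootedDipole n}

theorem eq_ofQuad (h : D.IsQuad a b c d) : D = ofQuad h.hab h.hbc h.hcd :=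
  nextCorner_injective (h.nextCorner_eq.trans (nextCorner_ofQuad h.hab h.hbc h.hcd).symm)

theorem ac (h : D.IsQuad a b c d) : a < c := h.hab.trans h.hbc
theorem bd (h : D.IsQuad a b c d) : b < d := h.hbc.trans_le h.hcd
theorem ad (h : D.IsQuad a b c d) : a < d := h.hab.trans h.bd

/-- For c = d the two transpositions share the corner c, and their product is the cycle a → b → c →
a. -/
theorem periodicOrbit_three (h : D.IsQuad a b c c) :
    periodicOrbit D.nextCorner a = ([a, b, c] : List (Fin n)) := by
  have h1 : D.nextCorner a = b := by simp [h.nextCorner_eq]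
  have h2 : D.nextCorner b = c := by
    rw [h.nextCorner_eq, Perm.mul_apply, swap_apply_of_ne_of_ne h.hab.ne' h.hbc.ne, swap_apply_left]
  have h3 : D.nextCorner c = a := by
    rw [h.nextCorner_eq, Perm.mul_apply, swap_apply_right, swap_apply_of_ne_of_ne h.hab.ne h.ac.ne]
  have hm : minimalPeriod D.nextCorner a = 3 :=
    (minimalPeriod_eq_prime_iff (hp := ⟨Nat.prime_three⟩)).2
      ⟨show D.nextCorner (D.nextCorner (D.nextCorner a)) = a by rw [h1, h2, h3],
        show D.nextCorner a ≠ a by rw [h1]; exact h.hab.ne'⟩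
  rw [periodicOrbit_def, hm]
  simp [List.range_succ, h1, h2]

theorem nextCorner_a (h : D.IsQuad a b c d) (hcd : c < d) : D.nextCorner a = c := by
  rw [h.nextCorner_eq, Perm.mul_apply, swap_apply_left, swap_apply_of_ne_of_ne h.hbc.ne' hcd.ne]

theorem nextCorner_b (h : D.IsQuad a b c d) : D.nextCorner b = d := by
  rw [h.nextCorner_eq, Perm.mul_apply, swap_apply_of_ne_of_ne h.hab.ne' h.hbc.ne, swap_apply_left]

theorem nextCorner_c (h : D.IsQuad a b c d) : D.nextCorner c = a := by
  rw [h.nextCorner_eq, Perm.mul_apply, swap_apply_right, swap_apply_of_ne_of_ne h.hab.ne h.ad.ne]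

theorem nextCorner_d (h : D.IsQuad a b c d) (hcd : c < d) : D.nextCorner d = b := by
  rw [h.nextCorner_eq, Perm.mul_apply, swap_apply_of_ne_of_ne h.ad.ne' hcd.ne', swap_apply_right]

theorem periodicOrbit_a (h : D.IsQuad a b c d) (hcd : c < d) :
    periodicOrbit D.nextCorner a = ([a, c] : List (Fin n)) := by
  have h1 := h.nextCorner_a hcd
  have hm : minimalPeriod D.nextCorner a = 2 :=
    (minimalPeriod_eq_prime_iff (hp := ⟨Nat.prime_two⟩)).2
      ⟨show D.nextCorner (D.nextCorner a) = a by rw [h1, h.nextCorner_c],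
        show D.nextCorner a ≠ a by rw [h1]; exact h.ac.ne'⟩
  rw [periodicOrbit_def, hm]
  simp [List.range_succ, h1]

theorem periodicOrbit_b (h : D.IsQuad a b c d) (hcd : c < d) :
    periodicOrbit D.nextCorner b = ([b, d] : List (Fin n)) := by
  have h1 := h.nextCorner_b
  have hm : minimalPeriod D.nextCorner b = 2 :=
    (minimalPeriod_eq_prime_iff (hp := ⟨Nat.prime_two⟩)).2
      ⟨show D.nextCorner (D.nextCorner b) = b by rw [h1, h.nextCorner_d hcd],
        show D.nextCorner b ≠ b by rw [h1]; exact h.bd.ne'⟩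
  rw [periodicOrbit_def, hm]
  simp [List.range_succ, h1]

theorem faces_three (h : D.IsQuad a b c c) :
    D.faces = insert (([a, b, c] : List (Fin n)) : Cycle (Fin n))
      ((Finset.univ \ {a, b, c}).image fun i => (([i] : List (Fin n)) : Cycle (Fin n))) := by
  ext z
  rw [mem_faces, Finset.mem_insert, Finset.mem_image]
  have hb : periodicOrbit D.nextCorner b = ([a, b, c] : List (Fin n)) := by
    rw [← h.periodicOrbit_three, D.periodicOrbit_eq_iff, h.periodicOrbit_three]
    simp
  have hc : periodicOrbit D.nextCorner c = ([a, b, c] : List (Fin n)) := by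
    rw [← h.periodicOrbit_three, D.periodicOrbit_eq_iff, h.periodicOrbit_three]
    simp
  constructor
  · rintro ⟨i, rfl⟩
    by_cases hi : i = a ∨ i = b ∨ i = c
    · left
      rcases hi with rfl | rfl | rfl
      exacts [h.periodicOrbit_three, hb, hc]
    · push Not at hi
      exact Or.inr ⟨i, by simp [hi], (h.periodicOrbit_of_ne hi.1 hi.2.1 hi.2.2 hi.2.2).symm⟩
  · rintro (rfl | ⟨i, hi, rfl⟩)
    · exact ⟨a, h.periodicOrbit_three⟩
    · simp only [Finset.mem_sdiff, Finset.mem_univ, true_and, Finset.mem_insert,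
        Finset.mem_singleton, not_or] at hi
      exact ⟨i, h.periodicOrbit_of_ne hi.1 hi.2.1 hi.2.2 hi.2.2⟩

theorem faces_two (h : D.IsQuad a b c d) (hcd : c < d) :
    D.faces = insert (([a, c] : List (Fin n)) : Cycle (Fin n))
      (insert (([b, d] : List (Fin n)) : Cycle (Fin n))
      ((Finset.univ \ {a, b, c, d}).image fun i => (([i] : List (Fin n)) : Cycle (Fin n)))) := by
  ext z
  rw [mem_faces, Finset.mem_insert, Finset.mem_insert, Finset.mem_image]
  have hc : periodicOrbit D.nextCorner c = ([a, c] : List (Fin n)) := by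
    rw [← h.periodicOrbit_a hcd, D.periodicOrbit_eq_iff, h.periodicOrbit_a hcd]
    simp
  have hd : periodicOrbit D.nextCorner d = ([b, d] : List (Fin n)) := by
    rw [← h.periodicOrbit_b hcd, D.periodicOrbit_eq_iff, h.periodicOrbit_b hcd]
    simp
  constructor
  · rintro ⟨i, rfl⟩
    by_cases hi : i = a ∨ i = c
    · left
      rcases hi with rfl | rfl
      exacts [h.periodicOrbit_a hcd, hc]
    by_cases hi' : i = b ∨ i = d
    · right; left
      rcases hi' with rfl | rfl
      exacts [h.periodicOrbit_b hcd, hd]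
    · push Not at hi hi'
      exact Or.inr (Or.inr ⟨i, by simp [hi, hi'],
        (h.periodicOrbit_of_ne hi.1 hi'.1 hi.2 hi'.2).symm⟩)
  · rintro (rfl | rfl | ⟨i, hi, rfl⟩)
    · exact ⟨a, h.periodicOrbit_a hcd⟩
    · exact ⟨b, h.periodicOrbit_b hcd⟩
    · simp only [Finset.mem_sdiff, Finset.mem_univ, true_and, Finset.mem_insert,
        Finset.mem_singleton, not_or] at hi
      exact ⟨i, h.periodicOrbit_of_ne hi.1 hi.2.1 hi.2.2.1 hi.2.2.2⟩

end IsQuad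

end RootedDipole

section Cycles

variable {n : ℕ} {a b c d : Fin n}

theorem cycle_singleton_injective :
    Injective fun i : Fin n => (([i] : List (Fin n)) : Cycle (Fin n)) := fun i j h => by
  have h' : [i] ~r [j] := Cycle.coe_eq_coe.1 h
  simpa using h'

theorem coe_ne_singleton {l : List (Fin n)} (hl : 2 ≤ l.length) (i : Fin n) :
    (l : Cycle (Fin n)) ≠ ([i] : List (Fin n)) := fun h => by
  have := congrArg Cycle.length h
  simp at this
  omega

theorem coe_notMem_image_singleton {l : List (Fin n)} (hl : 2 ≤ l.length) (S : Finset (Fin n)) :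
    (l : Cycle (Fin n)) ∉ S.image fun i => (([i] : List (Fin n)) : Cycle (Fin n)) := by
  intro h
  obtain ⟨i, -, hi⟩ := Finset.mem_image.1 h
  exact coe_ne_singleton hl i hi.symm

theorem map_val_image_singleton {β : Type*} (S : Finset (Fin n)) (F : Cycle (Fin n) → β) :
    (S.image fun i => (([i] : List (Fin n)) : Cycle (Fin n))).val.map F =
      S.val.map fun i => F (([i] : List (Fin n)) : Cycle (Fin n)) := by
  rw [Finset.image_val_of_injOn cycle_singleton_injective.injOn, Multiset.map_map]
  rfl

theorem pair_ne_pair (hab : a < b) (had : a < d) :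
    (([a, c] : List (Fin n)) : Cycle (Fin n)) ≠ ([b, d] : List (Fin n)) := by
  intro h
  have h' : a ∈ (([b, d] : List (Fin n)) : Cycle (Fin n)) := by rw [← h]; simp
  simp [hab.ne, had.ne] at h'

theorem image_singleton_erase (S : Finset (Fin n)) (i : Fin n) :
    (S.image fun i => (([i] : List (Fin n)) : Cycle (Fin n))).erase (([i] : List (Fin n))) =
      (S.erase i).image fun i => (([i] : List (Fin n)) : Cycle (Fin n)) :=
  (Finset.image_erase cycle_singleton_injective S i).symm

end Cycles

namespace RootedDipole

namespace IsQuad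

variable {n : ℕ} {a b c d : Fin n} {D : RootedDipole n}

theorem card_three (h : D.IsQuad a b c c) :
    (Finset.univ \ {a, b, c} : Finset (Fin n)).card = n - 3 := by
  rw [Finset.card_sdiff_of_subset (Finset.subset_univ _), Finset.card_univ, Fintype.card_fin,
    Finset.card_eq_three.2 ⟨a, b, c, h.hab.ne, h.ac.ne, h.hbc.ne, rfl⟩]

theorem card_two (h : D.IsQuad a b c d) (hcd : c < d) :
    (Finset.univ \ {a, b, c, d} : Finset (Fin n)).card = n - 4 := by
  rw [Finset.card_sdiff_of_subset (Finset.subset_univ _), Finset.card_univ, Fintype.card_fin,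
    Finset.card_insert_of_notMem (by simp [h.hab.ne, h.ac.ne, h.ad.ne]),
    Finset.card_eq_three.2 ⟨b, c, d, h.hbc.ne, h.bd.ne, hcd.ne, rfl⟩]

theorem halfFaceDegrees_three (h : D.IsQuad a b c c) :
    D.halfFaceDegrees = {3} + Multiset.replicate (n - 3) 1 := by
  rw [halfFaceDegrees, h.faces_three, Finset.insert_val_of_notMem
    (coe_notMem_image_singleton (by simp) _), Multiset.map_cons, map_val_image_singleton]
  simp only [Cycle.length_coe, List.length_cons, List.length_nil, Multiset.map_const',
    Finset.card_val, ← h.card_three]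
  rfl

theorem halfFaceDegrees_two (h : D.IsQuad a b c d) (hcd : c < d) :
    D.halfFaceDegrees = {2, 2} + Multiset.replicate (n - 4) 1 := by
  rw [halfFaceDegrees, h.faces_two hcd, Finset.insert_val_of_notMem, Finset.insert_val_of_notMem
    (coe_notMem_image_singleton (by simp) _), Multiset.map_cons, Multiset.map_cons,
    map_val_image_singleton]
  · simp only [Cycle.length_coe, List.length_cons, List.length_nil, Multiset.map_const',
      Finset.card_val, ← h.card_two hcd]
    rfl
  · rw [Finset.mem_insert, not_or]
    exact ⟨pair_ne_pair h.hab h.ad, coe_notMem_image_singleton (by simp) _⟩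

theorem card_faces (D : RootedDipole n) : D.faces.card = D.halfFaceDegrees.card := by
  simp [halfFaceDegrees]

theorem twiceGenus_eq (h : D.IsQuad a b c d) : D.twiceGenus = 2 := by
  have h1 := h.hab
  have h2 := h.hbc
  have h3 := d.2
  rcases h.hcd.eq_or_lt with rfl | hcd
  · rw [twiceGenus, card_faces, h.halfFaceDegrees_three]
    simp
    omega
  · rw [twiceGenus, card_faces, h.halfFaceDegrees_two hcd]
    simp
    omega

end IsQuad

theorem twiceGenus_eq_two_iff {n : ℕ} {D : RootedDipole n} :
    D.twiceGenus = 2 ↔ ∃ a b c d, D.IsQuad a b c d := by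
  constructor
  · intro h
    obtain ⟨a, b, c, d, h1, h2, h3, h4⟩ := D.exists_quad h
    exact ⟨a, b, c, d, h1, h2, h3, h4⟩
  · rintro ⟨a, b, c, d, h⟩
    exact h.twiceGenus_eq

theorem isQuad_ofQuad {n : ℕ} {a b c d : Fin n} (hab : a < b) (hbc : b < c) (hcd : c ≤ d) :
    (ofQuad hab hbc hcd).IsQuad a b c d :=
  ⟨hab, hbc, hcd, nextCorner_ofQuad hab hbc hcd⟩

/-- The support of the face permutation is determined by the dipole. -/
theorem IsQuad.unique {n : ℕ} {D : RootedDipole n} {a b c d a' b' c' d' : Fin n}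
    (h : D.IsQuad a b c d) (h' : D.IsQuad a' b' c' d') : a = a' ∧ b = b' ∧ c = c' ∧ d = d' := by
  -- The first and last entries of the support are the least and greatest moved corners. Then c is
  -- the preimage of a and b the preimage of d, also when c = d.
  have hne : ∀ {a b c d : Fin n}, D.IsQuad a b c d → D.nextCorner a ≠ a ∧ D.nextCorner d ≠ d := by
    intro a b c d h
    rcases h.hcd.eq_or_lt with rfl | hcd
    · have h1 : D.nextCorner a = b := by simp [h.nextCorner_eq]
      rw [h1, h.nextCorner_c]
      exact ⟨h.hab.ne', h.ac.ne⟩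
    · rw [h.nextCorner_a hcd, h.nextCorner_d hcd]
      exact ⟨h.ac.ne', h.bd.ne⟩
  have hmem : ∀ {a b c d : Fin n}, D.IsQuad a b c d → ∀ i, D.nextCorner i ≠ i →
      a ≤ i ∧ i ≤ d := by
    intro a b c d h i hi
    by_contra hc
    refine hi (h.nextCorner_of_ne ?_ ?_ ?_ ?_) <;> rintro rfl <;> refine hc ?_ <;>
      have h1 := h.hab <;> have h2 := h.hbc <;> have h3 := h.hcd <;> omega
  have ha : a = a' := le_antisymm (hmem h _ (hne h').1).1 (hmem h' _ (hne h).1).1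
  have hd : d = d' := le_antisymm (hmem h' _ (hne h).2).2 (hmem h _ (hne h').2).2
  subst ha hd
  have h1 := h.nextCorner_c
  have h1' := h'.nextCorner_c
  have hc := D.nextCorner.injective (h1.trans h1'.symm)
  subst hc
  have hb := D.nextCorner.injective (h.nextCorner_b.trans h'.nextCorner_b.symm)
  exact ⟨rfl, hb, rfl, rfl⟩

end RootedDipole

/-! ### Enumeration of the dipoles of genus one -/

/-- Since 1 / C(M,j) is (M+1) ∫ t^j (1−t)^{M−j} over [0,1], this is t + (1−t) = 1 under the
integral. Summing over a binomial expansion of (t + (1−t))^m gives the next identity. -/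
theorem inv_choose_add_inv_choose {M j : ℕ} (hj : j ≤ M) :
    ((M + 1).choose j : ℚ)⁻¹ + ((M + 1).choose (j + 1) : ℚ)⁻¹ =
      (M + 2) / ((M + 1) * (M.choose j : ℚ)) := by
  have h1 : ((M + 1 : ℕ) : ℚ) * M.choose j = (M + 1).choose j * (M + 1 - j) := by
    have h := Nat.choose_mul_succ_eq M j
    rw [mul_comm]
    have hc : ((M + 1 - j : ℕ) : ℚ) = M + 1 - j := by
      rw [Nat.cast_sub (by omega)]; push_cast; ring
    rw [← hc]
    exact_mod_cast h
  have h2 : ((M + 1 : ℕ) : ℚ) * M.choose j = (M + 1).choose (j + 1) * (j + 1) := by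
    exact_mod_cast Nat.add_one_mul_choose_eq M j
  have hM : (M.choose j : ℚ) ≠ 0 := by exact_mod_cast (Nat.choose_pos hj).ne'
  have hM1 : ((M + 1).choose j : ℚ) ≠ 0 := by exact_mod_cast (Nat.choose_pos (by omega)).ne'
  have hM2 : ((M + 1).choose (j + 1) : ℚ) ≠ 0 := by
    exact_mod_cast (Nat.choose_pos (by omega)).ne'
  have hM3 : (M + 1 : ℚ) ≠ 0 := by positivity
  push_cast at h1 h2
  have e1 : ((M + 1).choose j : ℚ)⁻¹ = (M + 1 - j) / ((M + 1) * (M.choose j : ℚ)) := by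
    rw [h1]
    have : (M + 1 - j : ℚ) ≠ 0 := by
      intro h0
      rw [h0, mul_zero] at h1
      exact mul_ne_zero hM3 hM h1
    field_simp
  have e2 : ((M + 1).choose (j + 1) : ℚ)⁻¹ = (j + 1) / ((M + 1) * (M.choose j : ℚ)) := by
    rw [h2]
    field_simp
  rw [e1, e2, ← add_div]
  ring_nf

/-- A form of the beta integral. -/
theorem sum_choose_div_choose (m : ℕ) : ∀ M j : ℕ, j ≤ M →
    ∑ i ∈ Finset.range (m + 1), (m.choose i : ℚ) * ((m + M).choose (i + j) : ℚ)⁻¹ =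
      (m + M + 1) / ((M + 1) * (M.choose j : ℚ)) := by
  induction m with
  | zero =>
    intro M j hj
    have hM : (M.choose j : ℚ) ≠ 0 := by exact_mod_cast (Nat.choose_pos hj).ne'
    have hM1 : (M + 1 : ℚ) ≠ 0 := by positivity
    simp
    field_simp
  | succ m ih =>
    intro M j hj
    have h1 := ih (M + 1) j (by omega)
    have h2 := ih (M + 1) (j + 1) (by omega)
    have hM : (M.choose j : ℚ) ≠ 0 := by exact_mod_cast (Nat.choose_pos hj).ne'
    have hsplit : ∑ i ∈ Finset.range (m + 1 + 1), ((m + 1).choose i : ℚ) *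
        ((m + 1 + M).choose (i + j) : ℚ)⁻¹ =
        ∑ i ∈ Finset.range (m + 1), (m.choose i : ℚ) * ((m + (M + 1)).choose (i + j) : ℚ)⁻¹ +
        ∑ i ∈ Finset.range (m + 1),
          (m.choose i : ℚ) * ((m + (M + 1)).choose (i + (j + 1)) : ℚ)⁻¹ := by
      rw [Finset.sum_range_succ', show m + 1 + M = m + (M + 1) by ring]
      simp only [Nat.choose_succ_succ', Nat.cast_add, add_mul, Finset.sum_add_distrib]
      rw [add_assoc, add_comm, add_assoc]
      simp only [show ∀ i, i + 1 + j = i + (j + 1) by intro i; ring]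
      rw [Finset.sum_range_succ' (fun i => (m.choose i : ℚ) *
        ((m + (M + 1)).choose (i + j) : ℚ)⁻¹), Finset.sum_range_succ (fun i =>
        (m.choose (i + 1) : ℚ) * ((m + (M + 1)).choose (i + (j + 1)) : ℚ)⁻¹)]
      simp [show ∀ i, i + 1 + j = i + (j + 1) by intro i; ring]
      ring
    rw [hsplit, h1, h2]
    have e := inv_choose_add_inv_choose hj
    push_cast
    rw [div_eq_mul_inv, div_eq_mul_inv, mul_inv, mul_inv, ← mul_add, ← mul_add, e]
    have : (M + 1 + 1 : ℚ) ≠ 0 := by positivity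
    field_simp
    ring

theorem coeff_one_add_X_pow (m j : ℕ) :
    PowerSeries.coeff j ((1 + PowerSeries.X : PowerSeries ℚ) ^ m) = (m.choose j : ℚ) := by
  have h : (1 + PowerSeries.X : PowerSeries ℚ) ^ m =
      (((1 + Polynomial.X) ^ m : Polynomial ℚ) : PowerSeries ℚ) := by simp
  rw [h, Polynomial.coeff_coe, Polynomial.coeff_one_add_X_pow]

theorem sum_inv_choose_mul_coeff (m : ℕ) {i : ℕ} (hi : i ≤ 2) :
    ∑ j ∈ Finset.range (m + 3), ((m + 2).choose j : ℚ)⁻¹ *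
      PowerSeries.coeff j (PowerSeries.X ^ i * (1 + PowerSeries.X : PowerSeries ℚ) ^ m) =
      (m + 3) / (3 * (Nat.choose 2 i : ℚ)) := by
  have h := sum_choose_div_choose m 2 i hi
  have h3 : ((m + (2 : ℕ) + 1 : ℚ) / (((2 : ℕ) + 1) * (Nat.choose 2 i : ℚ))) =
      (m + 3) / (3 * (Nat.choose 2 i : ℚ)) := by
    push_cast; ring_nf
  rw [← h3, ← h]
  simp only [PowerSeries.coeff_X_pow_mul', coeff_one_add_X_pow]
  symm
  refine Finset.sum_bij_ne_zero (fun j _ _ => j + i) ?_ ?_ ?_ ?_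
  · intro j hj _
    simp only [Finset.mem_range] at hj ⊢
    omega
  · intro a _ _ b _ _ hab
    omega
  · intro j hj hne
    have hij : i ≤ j := by
      by_contra hc
      simp [hc] at hne
    rw [if_pos hij] at hne
    refine ⟨j - i, ?_, ?_, by omega⟩
    · by_contra hc
      simp only [Finset.mem_range, not_lt] at hc
      rw [Nat.choose_eq_zero_of_lt (n := m) (k := j - i) (by omega)] at hne
      simp at hne
    · rw [show j - i + i = j by omega, mul_comm]
      exact hne
  · intro j _ _
    simp [mul_comm]

/-- The case M = 2 of the beta sum: the monomials 1, X, X² have values in the ratio 1 : 1/2 : 1.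
Both closed forms are a quadratic times a power of 1 + X. -/
theorem sum_quadratic (m : ℕ) (p q r : ℚ) :
    ∑ j ∈ Finset.range (m + 3), ((m + 2).choose j : ℚ)⁻¹ *
      PowerSeries.coeff j ((PowerSeries.C p + PowerSeries.C q * PowerSeries.X +
        PowerSeries.C r * PowerSeries.X ^ 2) * (1 + PowerSeries.X : PowerSeries ℚ) ^ m) =
      (m + 3) / 3 * (p + q / 2 + r) := by
  have h0 := sum_inv_choose_mul_coeff m (i := 0) (by norm_num)
  have h1 := sum_inv_choose_mul_coeff m (i := 1) (by norm_num)
  have h2 := sum_inv_choose_mul_coeff m (i := 2) (by norm_num)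
  have hc : ∀ j, ((m + 2).choose j : ℚ)⁻¹ *
      PowerSeries.coeff j ((PowerSeries.C p + PowerSeries.C q * PowerSeries.X +
        PowerSeries.C r * PowerSeries.X ^ 2) * (1 + PowerSeries.X : PowerSeries ℚ) ^ m) =
      p * (((m + 2).choose j : ℚ)⁻¹ *
        PowerSeries.coeff j (PowerSeries.X ^ 0 * (1 + PowerSeries.X : PowerSeries ℚ) ^ m)) +
      q * (((m + 2).choose j : ℚ)⁻¹ *
        PowerSeries.coeff j (PowerSeries.X ^ 1 * (1 + PowerSeries.X : PowerSeries ℚ) ^ m)) +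
      r * (((m + 2).choose j : ℚ)⁻¹ *
        PowerSeries.coeff j (PowerSeries.X ^ 2 * (1 + PowerSeries.X : PowerSeries ℚ) ^ m)) := by
    intro j
    rw [add_mul, add_mul, map_add, map_add, mul_assoc, mul_assoc, PowerSeries.coeff_C_mul,
      PowerSeries.coeff_C_mul, PowerSeries.coeff_C_mul, pow_zero, pow_one, one_mul]
    ring
  simp only [hc, Finset.sum_add_distrib, ← Finset.mul_sum, h0, h1, h2]
  norm_num
  ring

theorem one_add_X_inv_mul (P : PowerSeries ℚ) :
    (1 + PowerSeries.X : PowerSeries ℚ)⁻¹ * ((1 + PowerSeries.X) * P) = P := by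
  rw [← mul_assoc, PowerSeries.inv_mul_cancel _ (by simp), one_mul]

/-! ### Class sizes and the value of the closed form -/

theorem sum_lam3 (k : ℕ) : (lam3 k).sum = k + 3 := by
  simp [lam3]; ring

theorem sum_lam22 (k : ℕ) : (lam22 k).sum = k + 4 := by
  simp [lam22]; ring

/-- The parts equal to 1 are the fixed points, so filtering by 2 ≤ · recovers the cycle type. -/
theorem parts_eq_iff {n k l : ℕ} (m : Multiset ℕ) (hm : ∀ i ∈ m, 2 ≤ i) (hl : m.sum = l)
    (hn : n = k + l) (s : Perm (Fin n)) :
    s.partition.parts = m + Multiset.replicate k 1 ↔ s.cycleType = m := by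
  rw [Perm.parts_partition, Fintype.card_fin, ← Perm.sum_cycleType]
  constructor
  · intro h
    have h' := congrArg (Multiset.filter (2 ≤ ·)) h
    rw [Multiset.filter_add, Multiset.filter_add, Multiset.filter_eq_self.2 hm,
      Multiset.filter_eq_self.2 fun i hi => Perm.two_le_of_mem_cycleType hi,
      Multiset.filter_eq_nil.2 fun i hi => by simp [Multiset.eq_of_mem_replicate hi],
      Multiset.filter_eq_nil.2 fun i hi => by simp [Multiset.eq_of_mem_replicate hi]] at h'
    simpa using h'
  · rintro rfl
    rw [hl, show n - l = k by omega]

theorem card_parts_mul (n k : ℕ) (m : Multiset ℕ) (hm : ∀ i ∈ m, 2 ≤ i) (hn : n = k + m.sum) :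
    Fintype.card {s : Perm (Fin n) // s.partition.parts = m + Multiset.replicate k 1} *
      (k.factorial * m.prod * ∏ i ∈ m.toFinset, (m.count i).factorial) = n.factorial := by
  have h := Perm.card_of_cycleType_mul_eq (Fin n) m
  rw [Fintype.card_fin, if_pos ⟨by omega, hm⟩, show n - m.sum = k by omega] at h
  rw [Fintype.card_subtype, ← h]
  simp_rw [parts_eq_iff m hm rfl hn]

theorem classSize_lam3 (k : ℕ) : classSize (lam3 k) = 2 * (k + 3).choose 3 := by
  have h := card_parts_mul (lam3 k).sum k {3} (by simp) (sum_lam3 k)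
  have h' := Nat.choose_mul_factorial_mul_factorial (show 3 ≤ k + 3 by omega)
  rw [Nat.add_sub_cancel] at h'
  rw [sum_lam3 k |> congrArg Nat.factorial, ← h'] at h
  change classSize (lam3 k) * _ = _ at h
  simp [Nat.factorial] at h
  refine Nat.eq_of_mul_eq_mul_right (Nat.factorial_pos k) ?_
  linarith

theorem classSize_lam22 (k : ℕ) : classSize (lam22 k) = 3 * (k + 4).choose 4 := by
  have h := card_parts_mul (lam22 k).sum k {2, 2} (by simp) (sum_lam22 k)
  have h' := Nat.choose_mul_factorial_mul_factorial (show 4 ≤ k + 4 by omega)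
  rw [Nat.add_sub_cancel] at h'
  rw [sum_lam22 k |> congrArg Nat.factorial, ← h'] at h
  change classSize (lam22 k) * _ = _ at h
  simp [Nat.factorial] at h
  refine Nat.eq_of_mul_eq_mul_right (Nat.factorial_pos k) ?_
  linarith

theorem psiClosed_lam3 (k : ℕ) : psiClosed (lam3 k) = ((k + 3).choose 3 : ℚ) := by
  -- (1 + X³)/(1 + X) = 1 − X + X², and each part 1 contributes a factor 1 + X.
  have hp : (1 + PowerSeries.X : PowerSeries ℚ)⁻¹ *
      ((lam3 k).map fun l => 1 - (-PowerSeries.X : PowerSeries ℚ) ^ l).prod =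
      (PowerSeries.C 1 + PowerSeries.C (-1) * PowerSeries.X +
        PowerSeries.C 1 * PowerSeries.X ^ 2) * (1 + PowerSeries.X : PowerSeries ℚ) ^ k := by
    rw [← one_add_X_inv_mul ((PowerSeries.C 1 + _ + _) * _)]
    congr 1
    simp [lam3]
    ring
  rw [psiClosed, hp, sum_lam3, classSize_lam3, show k + 3 - 1 = k + 2 by omega, sum_quadratic]
  push_cast
  have : (k + 3 : ℚ) ≠ 0 := by positivity
  field_simp
  ring

theorem psiClosed_lam22 (k : ℕ) : psiClosed (lam22 k) = ((k + 4).choose 4 : ℚ) := by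
  -- (1 − X²)²/(1 + X) = (1 − X)²(1 + X); the remaining factor 1 + X raises the power to k + 1.
  have hp : (1 + PowerSeries.X : PowerSeries ℚ)⁻¹ *
      ((lam22 k).map fun l => 1 - (-PowerSeries.X : PowerSeries ℚ) ^ l).prod =
      (PowerSeries.C 1 + PowerSeries.C (-2) * PowerSeries.X +
        PowerSeries.C 1 * PowerSeries.X ^ 2) * (1 + PowerSeries.X : PowerSeries ℚ) ^ (k + 1) := by
    rw [← one_add_X_inv_mul ((PowerSeries.C 1 + _ + _) * _)]
    congr 1
    simp [lam22, show (PowerSeries.C 2 : PowerSeries ℚ) = 2 from map_ofNat _ 2]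
    ring
  have h := sum_quadratic (k + 1) 1 (-2) 1
  rw [psiClosed, hp, sum_lam22, classSize_lam22, show k + 4 - 1 = k + 1 + 2 by omega,
    show k + 4 = k + 1 + 3 by omega, h]
  push_cast
  have : (k + 1 + 3 : ℚ) ≠ 0 := by positivity
  field_simp
  ring

/-! ### Counting rooted dipoles of genus one -/

theorem card_orderEmbedding (n r : ℕ) : Fintype.card (Fin r ↪o Fin n) = n.choose r := by
  rw [← Nat.card_eq_fintype_card, Nat.card_congr Set.powersetCard.ofFinEmbEquiv,
    Set.powersetCard.card, Nat.card_eq_fintype_card, Fintype.card_fin]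

open RootedDipole in
theorem psi_lam3 (k : ℕ) : psi (lam3 k) = (k + 3).choose 3 := by
  have hn := sum_lam3 k
  rw [← hn, ← card_orderEmbedding, psi]
  -- The number of edges enters the type through the sum of the partition, so it is replaced by a
  -- variable n with n = k + 3.
  generalize (lam3 k).sum = n at *
  have hlt : ∀ e : Fin 3 ↪o Fin n, e 0 < e 1 ∧ e 1 < e 2 := fun e =>
    ⟨e.strictMono (by decide), e.strictMono (by decide)⟩
  have hk : n - 3 = k := by omega
  refine (Fintype.card_of_bijective (f := fun e : Fin 3 ↪o Fin n =>
    (⟨ofQuad (hlt e).1 (hlt e).2 le_rfl, by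
      rw [(isQuad_ofQuad _ _ _).halfFaceDegrees_three, hk]; rfl⟩ :
      {D : RootedDipole n // D.halfFaceDegrees = lam3 k})) ⟨?_, ?_⟩).symm
  · intro e e' h
    have he : ofQuad (hlt e).1 (hlt e).2 le_rfl = ofQuad (hlt e').1 (hlt e').2 le_rfl :=
      Subtype.ext_iff.1 h
    obtain ⟨h0, h1, h2, -⟩ := (isQuad_ofQuad (hlt e).1 (hlt e).2 le_rfl).unique
      (he ▸ isQuad_ofQuad (hlt e').1 (hlt e').2 le_rfl)
    ext i
    fin_cases i <;> simp [h0, h1, h2]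
  · rintro ⟨D, hD⟩
    -- The partition has n − 2 parts, hence the dipole has genus one and a support; the multiplicity
    -- of 3 among the half-degrees then rules out c < d.
    obtain ⟨a, b, c, d, h⟩ := (twiceGenus_eq_two_iff (D := D)).1 (by
      rw [twiceGenus, IsQuad.card_faces, hD]
      simp [lam3]
      omega)
    rcases h.hcd.eq_or_lt with rfl | hcd
    · refine ⟨OrderEmbedding.ofStrictMono ![a, b, c] (Fin.strictMono_iff_lt_succ.2 fun i => ?_),
        Subtype.ext h.eq_ofQuad.symm⟩
      fin_cases i
      exacts [h.hab, h.hbc]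
    · have := congrArg (Multiset.count 3) ((h.halfFaceDegrees_two hcd).symm.trans hD)
      simp [lam3, Multiset.count_replicate] at this

open RootedDipole in
theorem psi_lam22 (k : ℕ) : psi (lam22 k) = (k + 4).choose 4 := by
  have hn := sum_lam22 k
  rw [← hn, ← card_orderEmbedding, psi]
  generalize (lam22 k).sum = n at *
  have hlt : ∀ e : Fin 4 ↪o Fin n, e 0 < e 1 ∧ e 1 < e 2 ∧ e 2 < e 3 := fun e =>
    ⟨e.strictMono (by decide), e.strictMono (by decide), e.strictMono (by decide)⟩
  have hk : n - 4 = k := by omega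
  refine (Fintype.card_of_bijective (f := fun e : Fin 4 ↪o Fin n =>
    (⟨ofQuad (hlt e).1 (hlt e).2.1 (hlt e).2.2.le, by
      rw [(isQuad_ofQuad _ _ _).halfFaceDegrees_two (hlt e).2.2, hk]; rfl⟩ :
      {D : RootedDipole n // D.halfFaceDegrees = lam22 k})) ⟨?_, ?_⟩).symm
  · intro e e' h
    have he : ofQuad (hlt e).1 (hlt e).2.1 (hlt e).2.2.le =
        ofQuad (hlt e').1 (hlt e').2.1 (hlt e').2.2.le := Subtype.ext_iff.1 h
    obtain ⟨h0, h1, h2, h3⟩ := (isQuad_ofQuad (hlt e).1 (hlt e).2.1 (hlt e).2.2.le).unique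
      (he ▸ isQuad_ofQuad (hlt e').1 (hlt e').2.1 (hlt e').2.2.le)
    ext i
    fin_cases i <;> simp [h0, h1, h2, h3]
  · rintro ⟨D, hD⟩
    obtain ⟨a, b, c, d, h⟩ := (twiceGenus_eq_two_iff (D := D)).1 (by
      rw [twiceGenus, IsQuad.card_faces, hD]
      simp [lam22]
      omega)
    rcases h.hcd.eq_or_lt with rfl | hcd
    · have := congrArg (Multiset.count 3) (h.halfFaceDegrees_three.symm.trans hD)
      simp [lam22, Multiset.count_replicate] at this
    · refine ⟨OrderEmbedding.ofStrictMono ![a, b, c, d]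
        (Fin.strictMono_iff_lt_succ.2 fun i => ?_), Subtype.ext h.eq_ofQuad.symm⟩
      fin_cases i
      exacts [h.hab, h.hbc, hcd]

/-! ### Numbers of a-, b-, c- and d-edges -/

namespace RootedDipole.IsQuad

variable {n : ℕ} {a b c d : Fin n} {D : RootedDipole n}

theorem quadPos_injective (h : D.IsQuad a b c d) :
    Injective fun j : Fin n => quadPos n a b c d j := by
  intro i j hij
  obtain ⟨k, hk, rfl⟩ := exists_iterate_eq h.hab h.hbc h.hcd h.rot_eq D.root rfl i
  obtain ⟨l, hl, rfl⟩ := exists_iterate_eq h.hab h.hbc h.hcd h.rot_eq D.root rfl j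
  simp only [quadPos_iterate h.hab h.hbc h.hcd h.rot_eq D.root rfl hk,
    quadPos_iterate h.hab h.hbc h.hcd h.rot_eq D.root rfl hl] at hij
  rw [hij]

theorem ncard_quadPos_lt (h : D.IsQuad a b c d) {m : ℕ} (hm : m ≤ n) :
    {j : Fin n | 0 < quadPos n a b c d j ∧ quadPos n a b c d j < m}.ncard = m - 1 := by
  rw [← Set.ncard_image_of_injective _ h.quadPos_injective]
  have : (fun j : Fin n => quadPos n a b c d j) ''
      {j : Fin n | 0 < quadPos n a b c d j ∧ quadPos n a b c d j < m} =
      (Finset.Ioo 0 m : Finset ℕ) := by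
    ext k
    simp only [Set.mem_image, Set.mem_ofPred_eq, Finset.coe_Ioo, Set.mem_Ioo]
    constructor
    · rintro ⟨j, hj, rfl⟩
      exact hj
    · intro hk
      have := quadPos_iterate h.hab h.hbc h.hcd h.rot_eq D.root rfl (show k < n by omega)
      exact ⟨_, by rw [this]; exact hk, this⟩
  rw [this, Set.ncard_coe_finset, Nat.card_Ioo]
  omega

theorem quadPos_lt (h : D.IsQuad a b c d) (j : Fin n) : quadPos n a b c d j < n := by
  obtain ⟨k, hk, rfl⟩ := exists_iterate_eq h.hab h.hbc h.hcd h.rot_eq D.root rfl j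
  rwa [quadPos_iterate h.hab h.hbc h.hcd h.rot_eq D.root rfl hk]

end RootedDipole.IsQuad

theorem ncard_fin_Ioo {n : ℕ} (l u : ℕ) (hu : u ≤ n) :
    {j : Fin n | l < (j : ℕ) ∧ (j : ℕ) < u}.ncard = u - l - 1 := by
  rw [← Set.ncard_image_of_injective _ Fin.val_injective]
  have : (fun j : Fin n => (j : ℕ)) '' {j : Fin n | l < (j : ℕ) ∧ (j : ℕ) < u} =
      (Finset.Ioo l u : Finset ℕ) := by
    ext k
    simp only [Set.mem_image, Set.mem_ofPred_eq, Finset.coe_Ioo, Set.mem_Ioo]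
    constructor
    · rintro ⟨j, hj, rfl⟩
      exact hj
    · intro hk
      exact ⟨⟨k, by omega⟩, hk, rfl⟩
  rw [this, Set.ncard_coe_finset, Nat.card_Ioo]

theorem ncard_add_of_iff {α : Type} [Finite α] {p q r : α → Prop} (h : ∀ j, r j ↔ p j ∨ q j)
    (hd : ∀ j, p j → ¬ q j) : {j | p j}.ncard + {j | q j}.ncard = {j | r j}.ncard := by
  rw [← Set.ncard_union_eq (s := {j | p j}) (t := {j | q j}) (Set.disjoint_left.2 hd)]
  congr 1
  ext j
  exact (h j).symm

namespace BiRootedDipole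

variable {n : ℕ} {a b c d : Fin n} {D : BiRootedDipole n}

theorem sec_pos (D : BiRootedDipole n) : 0 < (D.sec : ℕ) := by
  have := D.sec_ne
  rw [Ne, Fin.ext_iff] at this
  exact Nat.pos_of_ne_zero this


theorem posNonroot_eq (h : D.toRootedDipole.IsQuad a b c d) (j : Fin n) :
    D.posNonroot j = quadPos n a b c d j :=
  h.idxOf_iterate j

theorem posNonroot_pos (h : D.toRootedDipole.IsQuad a b c d) {j : Fin n} (hj : 0 < (j : ℕ)) :
    0 < D.posNonroot j := by
  rw [posNonroot_eq h]
  have hne := h.quadPos_injective.ne (a₁ := j) (a₂ := D.root) (by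
    rw [Ne, Fin.ext_iff]; exact hj.ne')
  have h0 : quadPos n a b c d D.root = 0 := by simp [quadPos, RootedDipole.root]
  simp only [h0] at hne
  omega

theorem posNonroot_ne (h : D.toRootedDipole.IsQuad a b c d) {i j : Fin n} (hij : i ≠ j) :
    D.posNonroot i ≠ D.posNonroot j := by
  rw [posNonroot_eq h, posNonroot_eq h]
  exact h.quadPos_injective.ne hij

/-- Together with the totals for Region 1 and Region 3, this leaves one unknown among the four edge
counts; `numB_eq` supplies it. -/
theorem numA_add_numC (h : D.toRootedDipole.IsQuad a b c d) :
    D.numA + D.numC = n - D.sec - 1 := by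
  rw [← ncard_fin_Ioo D.sec n le_rfl]
  refine ncard_add_of_iff (fun j => ⟨fun hj => ?_, ?_⟩) ?_
  · have h1 := posNonroot_pos h (j := j) (by omega)
    have h2 := posNonroot_ne h (i := j) (j := D.sec) (by
      intro hh; rw [hh] at hj; omega)
    have h3 : D.InRegion2 j := hj.1
    rcases lt_or_gt_of_ne h2 with hlt | hlt
    · exact Or.inl ⟨h3, h1, hlt⟩
    · exact Or.inr ⟨h3, hlt⟩
  · rintro (⟨h1, -⟩ | ⟨h1, -⟩) <;> exact ⟨h1, j.2⟩
  · rintro j ⟨-, -, h1⟩ ⟨-, h2⟩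
    exact lt_asymm h1 h2

theorem numB_add_numD (h : D.toRootedDipole.IsQuad a b c d) :
    D.numB + D.numD = (D.sec : ℕ) - 1 := by
  have hc := ncard_fin_Ioo (n := n) 0 D.sec D.sec.2.le
  rw [Nat.sub_zero] at hc
  rw [← hc]
  refine ncard_add_of_iff (fun j => ⟨fun hj => ?_, ?_⟩) ?_
  · have h1 := posNonroot_pos h hj.1
    have h2 := posNonroot_ne h (i := j) (j := D.sec) (by
      intro hh; rw [hh] at hj; omega)
    have h3 : D.InRegion1 j := hj
    rcases lt_or_gt_of_ne h2 with hlt | hlt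
    · exact Or.inl ⟨h3, h1, hlt⟩
    · exact Or.inr ⟨h3, hlt⟩
  · rintro (⟨h1, -⟩ | ⟨h1, -⟩) <;> exact h1
  · rintro j ⟨-, -, h1⟩ ⟨-, h2⟩
    exact lt_asymm h1 h2

theorem numA_add_numB (h : D.toRootedDipole.IsQuad a b c d) :
    D.numA + D.numB = quadPos n a b c d D.sec - 1 := by
  rw [← h.ncard_quadPos_lt (h.quadPos_lt _).le]
  refine ncard_add_of_iff (fun j => ⟨fun hj => ?_, ?_⟩) ?_
  · have h3 : D.InRegion3 j := by
      rw [InRegion3, posNonroot_eq h, posNonroot_eq h]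
      exact hj
    have h0 : 0 < (j : ℕ) := by
      by_contra h0
      simp [quadPos, show (j : ℕ) = 0 by omega] at hj
    have h4 : j ≠ D.sec := by
      rintro rfl
      exact lt_irrefl _ hj.2
    rcases lt_or_gt_of_ne h4 with hlt | hlt
    · exact Or.inr ⟨⟨h0, hlt⟩, h3⟩
    · exact Or.inl ⟨hlt, h3⟩
  · rintro (⟨-, h1⟩ | ⟨-, h1⟩) <;> rwa [InRegion3, posNonroot_eq h, posNonroot_eq h] at h1
  · rintro j ⟨h1, -⟩ ⟨h2, -⟩
    exact lt_asymm h1 h2.2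

/-- A b-edge is an edge j < s met before s at the non-root vertex. In planar order a smaller edge
comes later, so b-edges arise only from the reversed blocks: all of (a,b] if s is in (b,c], all of
(a,c] if s is in (c,d], and none otherwise. -/
theorem numB_eq (h : D.toRootedDipole.IsQuad a b c d) : D.numB =
    if (D.sec : ℕ) ≤ b then 0 else if (D.sec : ℕ) ≤ c then (b : ℕ) - a else
    if (D.sec : ℕ) ≤ d then (c : ℕ) - a else 0 := by
  have hs := D.sec_pos
  have hsn := D.sec.2
  have hab : (a : ℕ) < b := h.hab
  have hbc : (b : ℕ) < c := h.hbc
  have hcd : (c : ℕ) ≤ d := h.hcd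
  have hd := d.2
  -- The b-edges always form an open interval (l,u); it remains to identify it from the positions.
  have key : ∀ l u : ℕ, u ≤ n → (∀ j : ℕ, 0 < j → j < D.sec →
      (quadPos n a b c d j < quadPos n a b c d D.sec ↔ l < j ∧ j < u)) →
      (∀ j, l < j → j < u → j < D.sec) → D.numB = u - l - 1 := by
    intro l u hu hiff hlt
    rw [← ncard_fin_Ioo (n := n) l u hu, numB]
    congr 1
    ext j
    simp only [InRegion1, InRegion3, Set.mem_ofPred_eq, posNonroot_eq h]
    constructor
    · rintro ⟨⟨h1, h2⟩, -, h3⟩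
      exact (hiff j h1 h2).1 h3
    · rintro ⟨h1, h2⟩
      have h3 : (j : ℕ) < D.sec := hlt j h1 h2
      have h4 : 0 < (j : ℕ) := by omega
      refine ⟨⟨h4, h3⟩, ?_, (hiff j h4 h3).2 ⟨h1, h2⟩⟩
      rw [← posNonroot_eq h]
      exact posNonroot_pos h h4
  generalize (D.sec : ℕ) = s at *
  split_ifs with h1 h2 h3
  · have hp : n - d ≤ quadPos n a b c d s ∧ (s ≤ a → quadPos n a b c d s = n - s) ∧
        (a < s → quadPos n a b c d s = n - d + (b - s)) := by
      unfold quadPos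
      split_ifs <;> omega
    generalize quadPos n a b c d s = p at *
    -- The choice l = u = n encodes the empty interval.
    refine (key n n le_rfl (fun j hj hjs => ?_) (by omega)).trans (by omega)
    unfold quadPos
    split_ifs <;> omega
  · have hp : quadPos n a b c d s = n - d + (b - a) + (c - s) := by
      rw [quadPos, if_neg hs.ne', if_neg (by omega), if_neg h1, if_pos h2]
    rw [hp] at key
    refine (key a (b + 1) (by omega) (fun j hj hjs => ?_) (by omega)).trans (by omega)
    unfold quadPos
    split_ifs <;> omega
  · have hp : quadPos n a b c d s = n - d + (c - a) + (d - s) := by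
      rw [quadPos, if_neg hs.ne', if_neg (by omega), if_neg h1, if_neg h2, if_pos h3]
    rw [hp] at key
    refine (key a (c + 1) (by omega) (fun j hj hjs => ?_) (by omega)).trans (by omega)
    unfold quadPos
    split_ifs <;> omega
  · have hp : quadPos n a b c d s = n - s := by
      rw [quadPos, if_neg hs.ne', if_neg (by omega), if_neg h1, if_neg h2, if_neg h3]
    rw [hp] at key
    refine (key n n le_rfl (fun j hj hjs => ?_) (by omega)).trans (by omega)
    unfold quadPos
    split_ifs <;> omega

end BiRootedDipole

/-! ### Weights of toroidal dipoles -/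

namespace BiRootedDipole

variable {n : ℕ} {a b c d : Fin n} {D : BiRootedDipole n}

theorem eq_of_sec_eq {D D' : BiRootedDipole n} (h : D.toRootedDipole = D'.toRootedDipole)
    (hs : D.sec = D'.sec) : D = D' := by
  obtain ⟨D, s, hs⟩ := D
  obtain ⟨D', s', hs'⟩ := D'
  obtain rfl : D = D' := h
  obtain rfl : s = s' := hs
  rfl

/-- The factor of the weight of `D` that records its faces. -/
def faceWeight (D : BiRootedDipole n) : Series :=
  g D.rootString * (D.nonrootStrings.map fc).prod

/-- The weight of `D`, with `z` in place of `v`. -/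
def weightAt (z : Series) (D : BiRootedDipole n) : Series :=
  (1 / (((D.numA + 1).factorial * D.numB.factorial * (D.numC + D.numD).factorial : ℕ) : ℚ)) •
    (x ^ (D.numA + 1) * y ^ D.numB * z ^ (D.numC + D.numD) * w ^ D.numD * D.faceWeight)

theorem weightAt_v (D : BiRootedDipole n) : D.weightAt v = D.weight := by
  rw [weightAt, weight, faceWeight, mul_assoc]
  ring_nf

/-- As 0^0 = 1 and higher powers of 0 vanish, z = 0 selects the dipoles without c- and d-edges. Thus
one summation with general z serves both Γ and B. -/
theorem weightAt_zero (D : BiRootedDipole n) :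
    D.weightAt 0 = if D.numC = 0 ∧ D.numD = 0 then D.weight else 0 := by
  split_ifs with h
  · rw [← weightAt_v, weightAt, weightAt, h.1, h.2]
    simp
  · rw [weightAt, zero_pow (by omega)]
    simp

/-- There are s black and n − s white corners altogether. The numbers outside E are passed as
arguments satisfying additive equations, which avoids truncated subtraction in the applications. -/
theorem prod_color (D : BiRootedDipole n) (E : Finset (Fin n)) (N₁ N₂ : ℕ)
    (h₁ : N₁ + ∑ i ∈ E, (if (i : ℕ) < D.sec then 1 else 0) = D.sec)
    (h₂ : N₂ + ∑ i ∈ E, (if (i : ℕ) < D.sec then 0 else 1) = n - D.sec) :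
    ∏ i ∈ Finset.univ \ E, fc (Cycle.map D.color (([i] : List (Fin n)) : Cycle (Fin n))) =
      f [●] ^ N₁ * f [○] ^ N₂ := by
  have hc : ∀ i, fc (Cycle.map D.color (([i] : List (Fin n)) : Cycle (Fin n))) =
      if (i : ℕ) < D.sec then f [●] else f [○] := by
    intro i
    change fc (([D.color i] : List Dot) : Cycle Dot) = _
    rw [color]
    simp only [Fin.lt_def]
    split_ifs <;> rfl
  have hs := D.sec.2
  have e₁ := Finset.sum_sdiff (Finset.subset_univ E)
    (f := fun i : Fin n => if (i : ℕ) < D.sec then 1 else 0)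
  have e₂ := Finset.sum_sdiff (Finset.subset_univ E)
    (f := fun i : Fin n => if (i : ℕ) < D.sec then 0 else 1)
  have e₃ : ∑ i : Fin n, (if (i : ℕ) < D.sec then 1 else 0) = (D.sec : ℕ) := by
    rw [← Finset.card_filter]
    rw [Fin.card_filter_val_lt]
    omega
  have e₄ : ∑ i : Fin n, (if (i : ℕ) < D.sec then 0 else 1) = n - (D.sec : ℕ) := by
    have : ∑ i : Fin n, (if (i : ℕ) < D.sec then 1 else 0) +
        ∑ i : Fin n, (if (i : ℕ) < D.sec then 0 else 1) = n := by
      rw [← Finset.sum_add_distrib]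
      calc _ = ∑ i : Fin n, 1 := Finset.sum_congr rfl fun i _ => by split_ifs <;> rfl
        _ = n := by simp
    omega
  have e₅ : ∀ i : Fin n, (if (i : ℕ) < D.sec then 0 else 1) =
      if ¬ (i : ℕ) < D.sec then 1 else 0 := fun i => by split_ifs <;> rfl
  simp only [hc]
  rw [Finset.prod_ite, Finset.prod_const, Finset.prod_const, Finset.card_filter,
    Finset.card_filter]
  simp only [e₅] at e₂ e₄ h₂
  congr 2 <;> omega

theorem walk_three (h : D.IsQuad a b c c) : D.walk a = [a, b, c] := by
  have hm : minimalPeriod D.nextCorner a = 3 := by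
    rw [← periodicOrbit_length, h.periodicOrbit_three]
    rfl
  have h1 : D.nextCorner a = b := by simp [h.nextCorner_eq]
  rw [RootedDipole.walk, hm]
  simp [List.iterate, h1, h.nextCorner_b]

theorem walk_two (h : D.IsQuad a b c d) (hcd : c < d) : D.walk a = [a, c] := by
  have hm : minimalPeriod D.nextCorner a = 2 := by
    rw [← periodicOrbit_length, h.periodicOrbit_a hcd]
    rfl
  rw [RootedDipole.walk, hm]
  simp [List.iterate, h.nextCorner_a hcd]

theorem walk_root (h : D.IsQuad a b c d) (ha : D.root < a) : D.walk D.root = [D.root] := by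
  have hm : minimalPeriod D.nextCorner D.root = 1 := by
    rw [← periodicOrbit_length, h.periodicOrbit_of_ne ha.ne (ha.trans h.hab).ne
      (ha.trans h.ac).ne (ha.trans h.ad).ne]
    rfl
  rw [RootedDipole.walk, hm]
  simp [List.iterate]

theorem prod_nonrootStrings (D : BiRootedDipole n) : (D.nonrootStrings.map fc).prod =
    ∏ z ∈ D.faces.erase D.rootFace, fc (Cycle.map D.color z) := by
  rw [nonrootStrings, Multiset.map_map]
  rfl

theorem prod_image_singleton (S : Finset (Fin n)) (F : Cycle (Fin n) → Series) :
    ∏ z ∈ S.image (fun i => (([i] : List (Fin n)) : Cycle (Fin n))), F z =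
      ∏ i ∈ S, F (([i] : List (Fin n)) : Cycle (Fin n)) :=
  Finset.prod_image cycle_singleton_injective.injOn

/-- As a is least in the support, the root corner lies in a non-trivial face exactly when a is the
root. The root walk then starts at a, so the root string is read off without rotation. -/
theorem faceWeight_three_zero (h : D.IsQuad a b c c) (ha : a = D.root) (N₁ N₂ : ℕ)
    (h₁ : N₁ + ∑ i ∈ {a, b, c}, (if (i : ℕ) < D.sec then 1 else 0) = D.sec)
    (h₂ : N₂ + ∑ i ∈ {a, b, c}, (if (i : ℕ) < D.sec then 0 else 1) = n - D.sec) :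
    D.faceWeight = g [D.color a, D.color b, D.color c] * (f [●] ^ N₁ * f [○] ^ N₂) := by
  rw [faceWeight, rootString, prod_nonrootStrings, RootedDipole.rootFace, ← ha, walk_three h,
    h.faces_three, Finset.erase_insert (coe_notMem_image_singleton (by simp) _),
    prod_image_singleton, prod_color D _ N₁ N₂ h₁ h₂]
  rfl

/-- Here the root corner is a face by itself, which must be removed from the one-corner faces; the
whole non-trivial face moves to the f-part. -/
theorem faceWeight_three_pos (h : D.IsQuad a b c c) (ha : D.root < a) (N₁ N₂ : ℕ)
    (h₁ : N₁ + ∑ i ∈ {D.root, a, b, c}, (if (i : ℕ) < D.sec then 1 else 0) = D.sec)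
    (h₂ : N₂ + ∑ i ∈ {D.root, a, b, c}, (if (i : ℕ) < D.sec then 0 else 1) = n - D.sec) :
    D.faceWeight = g [D.color D.root] *
      (f [D.color a, D.color b, D.color c] * (f [●] ^ N₁ * f [○] ^ N₂)) := by
  rw [faceWeight, rootString, prod_nonrootStrings, RootedDipole.rootFace, walk_root h ha,
    h.faces_three, Finset.erase_insert_of_ne (coe_ne_singleton (by simp) _),
    Finset.prod_insert fun hm =>
      coe_notMem_image_singleton (by simp) _ (Finset.mem_of_mem_erase hm),
    image_singleton_erase, ← Finset.sdiff_insert, prod_image_singleton, prod_color D _ N₁ N₂ h₁ h₂]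
  rfl

theorem faceWeight_two_zero (h : D.IsQuad a b c d) (hcd : c < d) (ha : a = D.root) (N₁ N₂ : ℕ)
    (h₁ : N₁ + ∑ i ∈ {a, b, c, d}, (if (i : ℕ) < D.sec then 1 else 0) = D.sec)
    (h₂ : N₂ + ∑ i ∈ {a, b, c, d}, (if (i : ℕ) < D.sec then 0 else 1) = n - D.sec) :
    D.faceWeight = g [D.color a, D.color c] *
      (f [D.color b, D.color d] * (f [●] ^ N₁ * f [○] ^ N₂)) := by
  rw [faceWeight, rootString, prod_nonrootStrings, RootedDipole.rootFace, ← ha, walk_two h hcd,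
    h.faces_two hcd, Finset.erase_insert, Finset.prod_insert
      (coe_notMem_image_singleton (by simp) _),
    prod_image_singleton, prod_color D _ N₁ N₂ h₁ h₂]
  · rfl
  · rw [Finset.mem_insert, not_or]
    exact ⟨pair_ne_pair h.hab h.ad, coe_notMem_image_singleton (by simp) _⟩

theorem faceWeight_two_pos (h : D.IsQuad a b c d) (hcd : c < d) (ha : D.root < a) (N₁ N₂ : ℕ)
    (h₁ : N₁ + ∑ i ∈ {D.root, a, b, c, d}, (if (i : ℕ) < D.sec then 1 else 0) = D.sec)
    (h₂ : N₂ + ∑ i ∈ {D.root, a, b, c, d}, (if (i : ℕ) < D.sec then 0 else 1) = n - D.sec) :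
    D.faceWeight = g [D.color D.root] * (f [D.color a, D.color c] *
      (f [D.color b, D.color d] * (f [●] ^ N₁ * f [○] ^ N₂))) := by
  rw [faceWeight, rootString, prod_nonrootStrings, RootedDipole.rootFace, walk_root h ha,
    h.faces_two hcd, Finset.erase_insert_of_ne (coe_ne_singleton (by simp) _),
    Finset.erase_insert_of_ne (coe_ne_singleton (by simp) _), Finset.prod_insert,
    Finset.prod_insert fun hm =>
      coe_notMem_image_singleton (by simp) _ (Finset.mem_of_mem_erase hm),
    image_singleton_erase, ← Finset.sdiff_insert, prod_image_singleton, prod_color D _ N₁ N₂ h₁ h₂]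
  · rfl
  · rw [Finset.mem_insert, not_or]
    exact ⟨pair_ne_pair h.hab h.ad,
      fun hm => coe_notMem_image_singleton (by simp) _ (Finset.mem_of_mem_erase hm)⟩

/-- The weight in terms of exponential sums. -/
theorem weightAt_eq {z K P₁ P₂ P₃ : Series} {A B C : ℕ} (hA : D.numA + 1 = A) (hB : D.numB = B)
    (hC : D.numC + D.numD = C) (hf : w ^ D.numD * D.faceWeight = K * (P₁ * (P₂ * P₃))) :
    D.weightAt z = K * ((1 / (A.factorial : ℚ)) • (P₁ * x ^ A) *
      ((1 / (B.factorial : ℚ)) • (P₂ * y ^ B) * (1 / (C.factorial : ℚ)) • (P₃ * z ^ C))) := by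
  have h1 : (1 / ((A.factorial * B.factorial * C.factorial : ℕ) : ℚ)) =
      1 / (A.factorial : ℚ) * (1 / (B.factorial : ℚ) * (1 / (C.factorial : ℚ))) := by
    push_cast
    rw [one_div_mul_one_div, one_div_mul_one_div, mul_assoc]
  have h2 : x ^ A * y ^ B * z ^ C * (K * (P₁ * (P₂ * P₃))) =
      K * ((P₁ * x ^ A) * ((P₂ * y ^ B) * (P₃ * z ^ C))) := by ring
  rw [weightAt, hA, hB, hC, mul_assoc _ (w ^ _) D.faceWeight, hf, h1, h2, smul_mul_smul_comm,
    smul_mul_smul_comm, mul_smul_comm]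

end BiRootedDipole

/-! ### Configurations and their edge and face counts -/

/-- The data of a bi-rooted dipole of genus one: the number of edges, the support of the face
permutation, and the secondary edge. -/
@[ext]
structure Config where
  n : ℕ
  a : ℕ
  b : ℕ
  c : ℕ
  d : ℕ
  s : ℕ
  hab : a < b
  hbc : b < c
  hcd : c ≤ d
  hdn : d < n
  hs : 0 < s
  hsn : s < n

namespace Config

variable (q : Config)

/-- `a` as an edge. -/
abbrev ea : Fin q.n := ⟨q.a, by have := q.hab; have := q.hbc; have := q.hcd; have := q.hdn; omega⟩
/-- `b` as an edge. -/
abbrev eb : Fin q.n := ⟨q.b, by have := q.hbc; have := q.hcd; have := q.hdn; omega⟩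
/-- `c` as an edge. -/
abbrev ec : Fin q.n := ⟨q.c, by have := q.hcd; have := q.hdn; omega⟩
/-- `d` as an edge. -/
abbrev ed : Fin q.n := ⟨q.d, q.hdn⟩

/-- The bi-rooted dipole with the given data. -/
def dipole : BiRootedDipole q.n where
  toRootedDipole := ofQuad (a := q.ea) (b := q.eb) (c := q.ec) (d := q.ed) q.hab q.hbc q.hcd
  sec := ⟨q.s, q.hsn⟩
  sec_ne := fun h => q.hs.ne' (Fin.ext_iff.1 h)

theorem isQuad : q.dipole.IsQuad q.ea q.eb q.ec q.ed :=
  RootedDipole.isQuad_ofQuad (a := q.ea) (b := q.eb) (c := q.ec) (d := q.ed) q.hab q.hbc q.hcd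

/-- Uniqueness of the support; with `exists_dipole_eq`, the configurations parametrise the genus-one
dipoles bijectively. -/
theorem dipole_injective :
    Injective fun q : Config => (⟨q.n, q.dipole⟩ : Σ n, BiRootedDipole n) := by
  rintro q q' h
  have hn : q.n = q'.n := congrArg Sigma.fst h
  obtain ⟨n, a, b, c, d, s, h1, h2, h3, h4, h5, h6⟩ := q
  obtain ⟨n', a', b', c', d', s', h1', h2', h3', h4', h5', h6'⟩ := q'
  obtain rfl : n = n' := hn
  have hD := eq_of_heq (Sigma.mk.inj h).2
  have hs := congrArg (fun D : BiRootedDipole n => (D.sec : ℕ)) hD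
  have hq := isQuad ⟨n, a, b, c, d, s, h1, h2, h3, h4, h5, h6⟩
  have hq' := isQuad ⟨n, a', b', c', d', s', h1', h2', h3', h4', h5', h6'⟩
  rw [hD] at hq
  obtain ⟨e1, e2, e3, e4⟩ := hq.unique hq'
  rw [Fin.ext_iff] at e1 e2 e3 e4
  exact Config.ext rfl e1 e2 e3 e4 hs

theorem exists_dipole_eq {n : ℕ} (D : BiRootedDipole n) (h : D.twiceGenus = 2) :
    ∃ q : Config, (⟨q.n, q.dipole⟩ : Σ n, BiRootedDipole n) = ⟨n, D⟩ := by
  obtain ⟨a, b, c, d, hq⟩ := RootedDipole.twiceGenus_eq_two_iff.1 h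
  refine ⟨⟨n, a, b, c, d, D.sec, hq.hab, hq.hbc, hq.hcd, d.2, D.sec_pos, D.sec.2⟩, ?_⟩
  exact congrArg (Sigma.mk n) (BiRootedDipole.eq_of_sec_eq hq.eq_ofQuad.symm rfl)

/-- The weight of the dipole, with `z` in place of `v`. -/
def weightAt (z : Series) : Series := q.dipole.weightAt z

end Config

theorem formalSum_twiceGenus {z S : Series}
    (h : SumsTo (fun q : Config => q.weightAt z) S) :
    SumsTo (fun D : (Σ n, BiRootedDipole n) => if D.2.twiceGenus = 2 then D.2.weightAt z else 0)
      S := by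
  refine SumsTo.of_injective Config.dipole_injective ?_ (h.congr fun q => ?_)
  · rintro ⟨n, D⟩ hD
    exact if_neg fun hg => hD (Config.exists_dipole_eq D hg)
  · exact if_pos q.isQuad.twiceGenus_eq

namespace Config

variable (q : Config)

/-- The marking of corner `i`. -/
def mark (i : ℕ) : Dot := if i < q.s then ● else ○

theorem mark_of_lt {q : Config} {i : ℕ} (h : i < q.s) : q.mark i = ● := if_pos h

theorem mark_of_le {q : Config} {i : ℕ} (h : q.s ≤ i) : q.mark i = ○ := if_neg h.not_gt

/-- The three totals and the value of B determine A, C and D by linear arithmetic. The equations are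
stated for A + 1, the exponent of x. -/
theorem counts_aux {n a b c d s A B C D : ℕ} (hab : a < b) (hbc : b < c) (hcd : c ≤ d) (hdn : d < n)
    (hs : 0 < s) (hsn : s < n)
    (hB : B = if s ≤ b then 0 else if s ≤ c then b - a else if s ≤ d then c - a else 0)
    (hAB : A + B = quadPos n a b c d s - 1) (hAC : A + C = n - s - 1) (hBD : B + D = s - 1) :
    (s ≤ a → A + 1 = n - s ∧ B = 0 ∧ C = 0 ∧ D = s - 1) ∧
    (a < s → s ≤ b → A + 1 = n - d + (b - s) ∧ B = 0 ∧ C = d - b ∧ D = s - 1) ∧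
    (b < s → s ≤ c → A + 1 = n - d + (c - s) ∧ B = b - a ∧ C = d - c ∧ D = s - 1 - (b - a)) ∧
    (c < s → s ≤ d → A + 1 = n - s ∧ B = c - a ∧ C = 0 ∧ D = s - 1 - (c - a)) ∧
    (d < s → A + 1 = n - s ∧ B = 0 ∧ C = 0 ∧ D = s - 1) := by
  unfold quadPos at hAB
  split_ifs at hB <;> split_ifs at hAB <;>
    refine ⟨fun h => ?_, fun h h' => ?_, fun h h' => ?_, fun h h' => ?_, fun h => ?_⟩ <;> omega

theorem counts :
    (q.s ≤ q.a → q.dipole.numA + 1 = q.n - q.s ∧ q.dipole.numB = 0 ∧ q.dipole.numC = 0 ∧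
      q.dipole.numD = q.s - 1) ∧
    (q.a < q.s → q.s ≤ q.b → q.dipole.numA + 1 = q.n - q.d + (q.b - q.s) ∧ q.dipole.numB = 0 ∧
      q.dipole.numC = q.d - q.b ∧ q.dipole.numD = q.s - 1) ∧
    (q.b < q.s → q.s ≤ q.c → q.dipole.numA + 1 = q.n - q.d + (q.c - q.s) ∧
      q.dipole.numB = q.b - q.a ∧ q.dipole.numC = q.d - q.c ∧
      q.dipole.numD = q.s - 1 - (q.b - q.a)) ∧
    (q.c < q.s → q.s ≤ q.d → q.dipole.numA + 1 = q.n - q.s ∧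
      q.dipole.numB = q.c - q.a ∧ q.dipole.numC = 0 ∧ q.dipole.numD = q.s - 1 - (q.c - q.a)) ∧
    (q.d < q.s → q.dipole.numA + 1 = q.n - q.s ∧ q.dipole.numB = 0 ∧ q.dipole.numC = 0 ∧
      q.dipole.numD = q.s - 1) := by
  have hB := BiRootedDipole.numB_eq q.isQuad
  have hAB := BiRootedDipole.numA_add_numB q.isQuad
  have hAC := BiRootedDipole.numA_add_numC q.isQuad
  have hBD := BiRootedDipole.numB_add_numD q.isQuad
  exact counts_aux q.hab q.hbc q.hcd q.hdn q.hs q.hsn hB hAB hAC hBD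

theorem isQuad_three {q : Config} (hcd : q.c = q.d) : q.dipole.IsQuad q.ea q.eb q.ec q.ec := by
  have h : q.ed = q.ec := Fin.ext hcd.symm
  have hq := q.isQuad
  rwa [h] at hq

variable {q}

theorem sum_three (F : ℕ → ℕ) : ∑ i ∈ {q.ea, q.eb, q.ec}, F i = F q.a + F q.b + F q.c := by
  have h1 := q.hab
  have h2 := q.hbc
  rw [Finset.sum_insert (by simp [Fin.ext_iff]; omega), Finset.sum_insert (by
    simp [Fin.ext_iff]; omega), Finset.sum_singleton, add_assoc]

theorem sum_two (hcd : q.c < q.d) (F : ℕ → ℕ) :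
    ∑ i ∈ {q.ea, q.eb, q.ec, q.ed}, F i = F q.a + F q.b + F q.c + F q.d := by
  have h1 := q.hab
  have h2 := q.hbc
  rw [Finset.sum_insert (by simp [Fin.ext_iff]; omega), Finset.sum_insert (by
    simp [Fin.ext_iff]; omega), Finset.sum_insert (by simp [Fin.ext_iff]; omega),
    Finset.sum_singleton]
  ring

/-- `1` if `i < s`, and `0` otherwise. -/
def lo (q : Config) (i : ℕ) : ℕ := if i < q.s then 1 else 0

/-- `0` if `i < s`, and `1` otherwise. -/
def hi (q : Config) (i : ℕ) : ℕ := if i < q.s then 0 else 1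

theorem face_three_zero (hcd : q.c = q.d) (ha : q.a = 0) (N₁ N₂ : ℕ)
    (h₁ : N₁ + (q.lo q.a + q.lo q.b + q.lo q.c) = q.s)
    (h₂ : N₂ + (q.hi q.a + q.hi q.b + q.hi q.c) = q.n - q.s) :
    q.dipole.faceWeight =
      g [q.mark q.a, q.mark q.b, q.mark q.c] * (f [●] ^ N₁ * f [○] ^ N₂) :=
  BiRootedDipole.faceWeight_three_zero (isQuad_three hcd) (Fin.ext ha) N₁ N₂
    ((congrArg (N₁ + ·) (sum_three q.lo)).trans h₁) ((congrArg (N₂ + ·) (sum_three q.hi)).trans h₂)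

theorem face_three_pos (hcd : q.c = q.d) (ha : 0 < q.a) (N₁ N₂ : ℕ)
    (h₁ : N₁ + (1 + (q.lo q.a + q.lo q.b + q.lo q.c)) = q.s)
    (h₂ : N₂ + (q.hi q.a + q.hi q.b + q.hi q.c) = q.n - q.s) :
    q.dipole.faceWeight = g [●] * (f [q.mark q.a, q.mark q.b, q.mark q.c] *
      (f [●] ^ N₁ * f [○] ^ N₂)) := by
  have h1 := q.hab
  have h2 := q.hbc
  have hs : ∀ F : ℕ → ℕ, ∑ i ∈ {q.dipole.root, q.ea, q.eb, q.ec}, F i =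
      F 0 + (F q.a + F q.b + F q.c) := fun F => by
    rw [Finset.sum_insert (by simp [Fin.ext_iff, RootedDipole.root]; omega), sum_three]
    rfl
  have hr : q.dipole.color q.dipole.root = ● := if_pos q.hs
  have e₁ := hs q.lo
  have e₂ := hs q.hi
  rw [show q.lo 0 = 1 from if_pos q.hs] at e₁
  rw [show q.hi 0 = 0 from if_pos q.hs, zero_add] at e₂
  have h := BiRootedDipole.faceWeight_three_pos (isQuad_three hcd) ha N₁ N₂
    ((congrArg (N₁ + ·) e₁).trans h₁) ((congrArg (N₂ + ·) e₂).trans h₂)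
  rw [hr] at h
  exact h

theorem face_two_zero (hcd : q.c < q.d) (ha : q.a = 0) (N₁ N₂ : ℕ)
    (h₁ : N₁ + (q.lo q.a + q.lo q.b + q.lo q.c + q.lo q.d) = q.s)
    (h₂ : N₂ + (q.hi q.a + q.hi q.b + q.hi q.c + q.hi q.d) = q.n - q.s) :
    q.dipole.faceWeight = g [q.mark q.a, q.mark q.c] *
      (f [q.mark q.b, q.mark q.d] * (f [●] ^ N₁ * f [○] ^ N₂)) :=
  BiRootedDipole.faceWeight_two_zero q.isQuad hcd (Fin.ext ha) N₁ N₂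
    ((congrArg (N₁ + ·) (sum_two hcd q.lo)).trans h₁)
    ((congrArg (N₂ + ·) (sum_two hcd q.hi)).trans h₂)

theorem face_two_pos (hcd : q.c < q.d) (ha : 0 < q.a) (N₁ N₂ : ℕ)
    (h₁ : N₁ + (1 + (q.lo q.a + q.lo q.b + q.lo q.c + q.lo q.d)) = q.s)
    (h₂ : N₂ + (q.hi q.a + q.hi q.b + q.hi q.c + q.hi q.d) = q.n - q.s) :
    q.dipole.faceWeight = g [●] * (f [q.mark q.a, q.mark q.c] *
      (f [q.mark q.b, q.mark q.d] * (f [●] ^ N₁ * f [○] ^ N₂))) := by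
  have h1 := q.hab
  have h2 := q.hbc
  have hs : ∀ F : ℕ → ℕ, ∑ i ∈ {q.dipole.root, q.ea, q.eb, q.ec, q.ed}, F i =
      F 0 + (F q.a + F q.b + F q.c + F q.d) := fun F => by
    rw [Finset.sum_insert (by simp [Fin.ext_iff, RootedDipole.root]; omega), sum_two hcd]
    rfl
  have hr : q.dipole.color q.dipole.root = ● := if_pos q.hs
  have e₁ := hs q.lo
  have e₂ := hs q.hi
  rw [show q.lo 0 = 1 from if_pos q.hs] at e₁
  rw [show q.hi 0 = 0 from if_pos q.hs, zero_add] at e₂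
  have h := BiRootedDipole.faceWeight_two_pos q.isQuad hcd ha N₁ N₂
    ((congrArg (N₁ + ·) e₁).trans h₁) ((congrArg (N₂ + ·) e₂).trans h₂)
  rw [hr] at h
  exact h

/-- The interval between consecutive elements of the support that contains the secondary edge. -/
def region (q : Config) : Fin 5 :=
  if q.s ≤ q.a then 0 else if q.s ≤ q.b then 1 else if q.s ≤ q.c then 2 else
  if q.s ≤ q.d then 3 else 4

/-- The cases for the position of the secondary edge and the root edge, and for the cycle type. -/
def case (q : Config) : Fin 5 × Bool × Bool := (q.region, decide (q.a = 0), decide (q.c = q.d))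

theorem region_eq_zero : q.region = 0 ↔ q.s ≤ q.a := by
  unfold region; split_ifs <;> simp <;> omega

theorem region_eq_one : q.region = 1 ↔ q.a < q.s ∧ q.s ≤ q.b := by
  unfold region; have := q.hab; split_ifs <;> simp <;> omega

theorem region_eq_two : q.region = 2 ↔ q.b < q.s ∧ q.s ≤ q.c := by
  unfold region; have := q.hab; have := q.hbc; split_ifs <;> simp <;> omega

theorem region_eq_three : q.region = 3 ↔ q.c < q.s ∧ q.s ≤ q.d := by
  unfold region; have := q.hab; have := q.hbc; have := q.hcd; split_ifs <;> simp <;> omega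

theorem region_eq_four : q.region = 4 ↔ q.d < q.s := by
  unfold region; have := q.hab; have := q.hbc; have := q.hcd; split_ifs <;> simp <;> omega

theorem case_eq_iff {i : Fin 5} {p r : Bool} :
    q.case = (i, p, r) ↔ q.region = i ∧ (q.a = 0 ↔ p = true) ∧ (q.c = q.d ↔ r = true) := by
  cases p <;> cases r <;> simp [case]

theorem lo_of_lt {i : ℕ} (h : i < q.s) : q.lo i = 1 := if_pos h
theorem lo_of_le {i : ℕ} (h : q.s ≤ i) : q.lo i = 0 := if_neg h.not_gt
theorem hi_of_lt {i : ℕ} (h : i < q.s) : q.hi i = 0 := if_pos h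
theorem hi_of_le {i : ℕ} (h : q.s ≤ i) : q.hi i = 1 := if_neg h.not_gt

theorem bounds (q : Config) :
    q.a < q.b ∧ q.b < q.c ∧ q.c ≤ q.d ∧ q.d < q.n ∧ 0 < q.s ∧ q.s < q.n :=
  ⟨q.hab, q.hbc, q.hcd, q.hdn, q.hs, q.hsn⟩

end Config

/-! ### Summation of the weights in the sixteen non-empty cases -/

theorem constantCoeff_x : MvPowerSeries.constantCoeff x = 0 := MvPowerSeries.constantCoeff_X _
theorem constantCoeff_y : MvPowerSeries.constantCoeff y = 0 := MvPowerSeries.constantCoeff_X _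
theorem constantCoeff_v : MvPowerSeries.constantCoeff v = 0 := MvPowerSeries.constantCoeff_X _

/-- The sum of the weights in one case, from a parametrisation of the case by exponents. -/
theorem sumsTo_case {p r t : ℕ} {z : Series} (hz : MvPowerSeries.constantCoeff z = 0)
    (i : Fin 5 × Bool × Bool) (K : Series) (k₁ k₂ k₃ : ℕ)
    (u₁ : Fin p → Series) (u₂ : Fin r → Series) (u₃ : Fin t → Series)
    (φ : (Fin p → ℕ) × (Fin r → ℕ) × (Fin t → ℕ) → Config)
    (ψ : Config → (Fin p → ℕ) × (Fin r → ℕ) × (Fin t → ℕ))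
    (hψφ : ∀ e, ψ (φ e) = e) (hφψ : ∀ q : Config, q.case = i → φ (ψ q) = q)
    (hφ : ∀ e, (φ e).case = i)
    (hw : ∀ q : Config, q.case = i → q.dipole.numA + 1 = (∑ j, (ψ q).1 j) + k₁ ∧
      q.dipole.numB = (∑ j, (ψ q).2.1 j) + k₂ ∧
      q.dipole.numC + q.dipole.numD = (∑ j, (ψ q).2.2 j) + k₃ ∧
      w ^ q.dipole.numD * q.dipole.faceWeight = K * ((∏ j, u₁ j ^ (ψ q).1 j) *
        ((∏ j, u₂ j ^ (ψ q).2.1 j) * ∏ j, u₃ j ^ (ψ q).2.2 j))) :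
    SumsTo (fun q : Config => if q.case = i then q.weightAt z else 0)
      (K * (ESum x k₁ u₁ * (ESum y k₂ u₂ * ESum z k₃ u₃))) := by
  refine SumsTo.of_injective (φ := φ) (LeftInverse.injective hψφ) (fun q hq => if_neg fun h => ?_)
    ((((sumsTo_eTerm constantCoeff_x k₁ u₁).mul ((sumsTo_eTerm constantCoeff_y k₂ u₂).mul
      (sumsTo_eTerm hz k₃ u₃))).const_mul K).congr fun e => ?_)
  · exact hq ⟨_, hφψ q h⟩
  · obtain ⟨hA, hB, hC, hf⟩ := hw (φ e) (hφ e)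
    rw [hψφ] at hA hB hC hf
    simp only [comp_apply, hφ, if_true]
    exact BiRootedDipole.weightAt_eq hA hB hC hf

open Config

theorem exponents_ext {p r t : ℕ} {e e' : (Fin p → ℕ) × (Fin r → ℕ) × (Fin t → ℕ)}
    (h₁ : ∀ i, e.1 i = e'.1 i) (h₂ : ∀ i, e.2.1 i = e'.2.1 i) (h₃ : ∀ i, e.2.2 i = e'.2.2 i) :
    e = e' :=
  Prod.ext (funext h₁) (Prod.ext (funext h₂) (funext h₃))

variable {z : Series}

/-- The secondary edge precedes the support. Four gaps are white and counted by x; the s − 1 black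
corners other than the root corner match the d-edges, each with weight w f_(●). -/
theorem sumsTo_three_below (hz : MvPowerSeries.constantCoeff z = 0) :
    SumsTo (fun q : Config => if q.case = (0, false, true) then q.weightAt z else 0)
      (g [●] * f [○, ○, ○] * (ESum x 3 ![f [○], f [○], f [○], f [○]] *
        (ESum y 0 ![] * ESum z 0 ![w * f [●]]))) := by
  refine sumsTo_case hz _ _ _ _ _ _ _ _
    -- The configuration with prescribed gaps: `e.1`, `e.2.1`, `e.2.2` are the gaps counted by x, y
    -- and z, and each `+ 1` steps over a distinguished edge.
    (fun e => ⟨e.2.2 0 + 1 + e.1 0 + 1 + e.1 1 + 1 + e.1 2 + 1 + e.1 3,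
      e.2.2 0 + 1 + e.1 0, e.2.2 0 + 1 + e.1 0 + 1 + e.1 1,
      e.2.2 0 + 1 + e.1 0 + 1 + e.1 1 + 1 + e.1 2,
      e.2.2 0 + 1 + e.1 0 + 1 + e.1 1 + 1 + e.1 2,
      e.2.2 0 + 1,
      by omega, by omega, by omega, by omega, by omega, by omega⟩)
    (fun q => (![q.a - q.s, q.b - q.a - 1, q.c - q.b - 1, q.n - q.c - 1], ![],
      ![q.s - 1]))
    (fun e => ?_) (fun q hq => ?_) (fun e => ?_) (fun q hq => ?_)
  · refine exponents_ext (fun i => ?_) (fun i => ?_) (fun i => ?_) <;> fin_cases i <;>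
      simp <;> omega
  · obtain ⟨hr, ha, hc⟩ := case_eq_iff.1 hq
    have := region_eq_zero.1 hr
    have := q.bounds
    simp at ha hc
    ext <;> simp <;> omega
  · refine case_eq_iff.2 ⟨region_eq_zero.2 ?_, ?_, ?_⟩ <;> simp
  · obtain ⟨hr, ha, hc⟩ := case_eq_iff.1 hq
    replace hr := region_eq_zero.1 hr
    have := q.bounds
    simp only [iff_true, Bool.false_eq_true, iff_false] at ha hc
    obtain ⟨hA, hB, hC, hD⟩ := q.counts.1 hr
    refine ⟨?_, ?_, ?_, ?_⟩
    · simp [Fin.sum_univ_succ]; omega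
    · simp; omega
    · simp; omega
    · have hD' : q.dipole.numD =
          q.s - 1 := by omega
      rw [hD', face_three_pos (by omega) (by omega)
        (q.s - 1)
        ((q.a - q.s) + (q.b - q.a - 1) + (q.c - q.b - 1) + (q.n - q.c - 1))
        (by rw [lo_of_le (i := q.a) (by omega),
          lo_of_le (i := q.b) (by omega),
          lo_of_le (i := q.c) (by omega)]; omega)
        (by rw [hi_of_le (i := q.a) (by omega),
          hi_of_le (i := q.b) (by omega),
          hi_of_le (i := q.c) (by omega)]; omega),
        mark_of_le (i := q.a) (by omega),
        mark_of_le (i := q.b) (by omega),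
        mark_of_le (i := q.c) (by omega)]
      simp only [Fin.prod_univ_succ, Fin.prod_univ_zero, Matrix.cons_val_zero, Matrix.cons_val_succ,
        mul_pow, pow_add]
      ring

/-- The secondary edge splits the gap between a and b. The order of the z-arguments is that of the
symbols of φ in τ, with the argument to be split off last; the later cases follow the same
convention. -/
theorem sumsTo_three_ab_root (hz : MvPowerSeries.constantCoeff z = 0) :
    SumsTo (fun q : Config => if q.case = (1, true, true) then q.weightAt z else 0)
      (g [●, ○, ○] * (ESum x 1 ![f [○], f [○]] *
        (ESum y 0 ![] * ESum z 1 ![f [○], w * f [●]]))) := by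
  refine sumsTo_case hz _ _ _ _ _ _ _ _
    (fun e => ⟨e.2.2 1 + 1 + e.1 0 + 1 + e.2.2 0 + 1 + e.1 1,
      0, e.2.2 1 + 1 + e.1 0,
      e.2.2 1 + 1 + e.1 0 + 1 + e.2.2 0,
      e.2.2 1 + 1 + e.1 0 + 1 + e.2.2 0,
      e.2.2 1 + 1,
      by omega, by omega, by omega, by omega, by omega, by omega⟩)
    (fun q => (![q.b - q.s, q.n - q.c - 1], ![],
      ![q.c - q.b - 1, q.s - 1]))
    (fun e => ?_) (fun q hq => ?_) (fun e => ?_) (fun q hq => ?_)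
  · refine exponents_ext (fun i => ?_) (fun i => ?_) (fun i => ?_) <;> fin_cases i <;>
      simp <;> omega
  · obtain ⟨hr, ha, hc⟩ := case_eq_iff.1 hq
    have := region_eq_one.1 hr
    have := q.bounds
    simp at ha hc
    ext <;> simp <;> omega
  · refine case_eq_iff.2 ⟨region_eq_one.2 ?_, ?_, ?_⟩ <;> simp
  · obtain ⟨hr, ha, hc⟩ := case_eq_iff.1 hq
    replace hr := region_eq_one.1 hr
    have := q.bounds
    simp only [iff_true] at ha hc
    obtain ⟨hA, hB, hC, hD⟩ := q.counts.2.1 hr.1 hr.2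
    refine ⟨?_, ?_, ?_, ?_⟩
    · simp [Fin.sum_univ_succ]; omega
    · simp; omega
    · simp [Fin.sum_univ_succ]; omega
    · have hD' : q.dipole.numD =
          q.s - 1 := by omega
      rw [hD', face_three_zero (by omega) (by omega)
        (q.s - 1)
        ((q.b - q.s) + (q.n - q.c - 1) + (q.c - q.b - 1))
        (by rw [lo_of_lt (i := q.a) (by omega),
          lo_of_le (i := q.b) (by omega),
          lo_of_le (i := q.c) (by omega)]; omega)
        (by rw [hi_of_lt (i := q.a) (by omega),
          hi_of_le (i := q.b) (by omega),
          hi_of_le (i := q.c) (by omega)]; omega),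
        mark_of_lt (i := q.a) (by omega),
        mark_of_le (i := q.b) (by omega),
        mark_of_le (i := q.c) (by omega)]
      simp only [Fin.prod_univ_succ, Fin.prod_univ_zero, Matrix.cons_val_zero, Matrix.cons_val_succ,
        mul_pow, pow_add]
      ring

theorem sumsTo_three_ab (hz : MvPowerSeries.constantCoeff z = 0) :
    SumsTo (fun q : Config => if q.case = (1, false, true) then q.weightAt z else 0)
      (w * g [●] * f [●, ○, ○] * (ESum x 1 ![f [○], f [○]] *
        (ESum y 0 ![] * ESum z 2 ![w * f [●], f [○], w * f [●]]))) := by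
  refine sumsTo_case hz _ _ _ _ _ _ _ _
    (fun e => ⟨e.2.2 0 + 1 + 1 + e.2.2 2 + e.1 0 + 1 + e.2.2 1 + 1 + e.1 1,
      e.2.2 0 + 1, e.2.2 0 + 1 + 1 + e.2.2 2 + e.1 0,
      e.2.2 0 + 1 + 1 + e.2.2 2 + e.1 0 + 1 + e.2.2 1,
      e.2.2 0 + 1 + 1 + e.2.2 2 + e.1 0 + 1 + e.2.2 1,
      e.2.2 0 + 1 + 1 + e.2.2 2,
      by omega, by omega, by omega, by omega, by omega, by omega⟩)
    (fun q => (![q.b - q.s, q.n - q.c - 1], ![],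
      ![q.a - 1, q.c - q.b - 1, q.s - q.a - 1]))
    (fun e => ?_) (fun q hq => ?_) (fun e => ?_) (fun q hq => ?_)
  · refine exponents_ext (fun i => ?_) (fun i => ?_) (fun i => ?_) <;> fin_cases i <;>
      simp <;> omega
  · obtain ⟨hr, ha, hc⟩ := case_eq_iff.1 hq
    have := region_eq_one.1 hr
    have := q.bounds
    simp at ha hc
    ext <;> simp <;> omega
  · refine case_eq_iff.2 ⟨region_eq_one.2 ?_, ?_, ?_⟩ <;> simp <;> omega
  · obtain ⟨hr, ha, hc⟩ := case_eq_iff.1 hq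
    replace hr := region_eq_one.1 hr
    have := q.bounds
    simp only [iff_true, Bool.false_eq_true, iff_false] at ha hc
    obtain ⟨hA, hB, hC, hD⟩ := q.counts.2.1 hr.1 hr.2
    refine ⟨?_, ?_, ?_, ?_⟩
    · simp [Fin.sum_univ_succ]; omega
    · simp; omega
    · simp [Fin.sum_univ_succ]; omega
    -- The summand 1 is the d-edge a: its corner lies in the 3-corner face, so it contributes w but
    -- no f_(●).
    · have hD' : q.dipole.numD =
          (q.a - 1) + (q.s - q.a - 1) + 1 := by omega
      rw [hD', face_three_pos (by omega) (by omega)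
        ((q.a - 1) + (q.s - q.a - 1))
        ((q.b - q.s) + (q.n - q.c - 1) + (q.c - q.b - 1))
        (by rw [lo_of_lt (i := q.a) (by omega),
          lo_of_le (i := q.b) (by omega),
          lo_of_le (i := q.c) (by omega)]; omega)
        (by rw [hi_of_lt (i := q.a) (by omega),
          hi_of_le (i := q.b) (by omega),
          hi_of_le (i := q.c) (by omega)]; omega),
        mark_of_lt (i := q.a) (by omega),
        mark_of_le (i := q.b) (by omega),
        mark_of_le (i := q.c) (by omega)]
      simp only [Fin.prod_univ_succ, Fin.prod_univ_zero, Matrix.cons_val_zero, Matrix.cons_val_succ,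
        mul_pow, pow_add]
      ring

/-- The block (a,b] consists of b-edges; its last corner b is in the support, hence the series in y
has shift 1 and a single argument. -/
theorem sumsTo_three_bc_root (hz : MvPowerSeries.constantCoeff z = 0) :
    SumsTo (fun q : Config => if q.case = (2, true, true) then q.weightAt z else 0)
      (g [●, ●, ○] * (ESum x 1 ![f [○], f [○]] *
        (ESum y 1 ![f [●]] * ESum z 0 ![w * f [●]]))) := by
  refine sumsTo_case hz _ _ _ _ _ _ _ _
    (fun e => ⟨e.2.1 0 + 1 + 1 + e.2.2 0 + e.1 0 + 1 + e.1 1,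
      0, e.2.1 0 + 1,
      e.2.1 0 + 1 + 1 + e.2.2 0 + e.1 0,
      e.2.1 0 + 1 + 1 + e.2.2 0 + e.1 0,
      e.2.1 0 + 1 + 1 + e.2.2 0,
      by omega, by omega, by omega, by omega, by omega, by omega⟩)
    (fun q => (![q.c - q.s, q.n - q.c - 1], ![q.b - 1],
      ![q.s - q.b - 1]))
    (fun e => ?_) (fun q hq => ?_) (fun e => ?_) (fun q hq => ?_)
  · refine exponents_ext (fun i => ?_) (fun i => ?_) (fun i => ?_) <;> fin_cases i <;>
      simp <;> omega
  · obtain ⟨hr, ha, hc⟩ := case_eq_iff.1 hq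
    have := region_eq_two.1 hr
    have := q.bounds
    simp at ha hc
    ext <;> simp <;> omega
  · refine case_eq_iff.2 ⟨region_eq_two.2 ?_, ?_, ?_⟩ <;> simp <;> omega
  · obtain ⟨hr, ha, hc⟩ := case_eq_iff.1 hq
    replace hr := region_eq_two.1 hr
    have := q.bounds
    simp only [iff_true] at ha hc
    obtain ⟨hA, hB, hC, hD⟩ := q.counts.2.2.1 hr.1 hr.2
    refine ⟨?_, ?_, ?_, ?_⟩
    · simp [Fin.sum_univ_succ]; omega
    · simp; omega
    · simp; omega
    · have hD' : q.dipole.numD =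
          q.s - q.b - 1 := by omega
      rw [hD', face_three_zero (by omega) (by omega)
        ((q.b - 1) + (q.s - q.b - 1))
        ((q.c - q.s) + (q.n - q.c - 1))
        (by rw [lo_of_lt (i := q.a) (by omega),
          lo_of_lt (i := q.b) (by omega),
          lo_of_le (i := q.c) (by omega)]; omega)
        (by rw [hi_of_lt (i := q.a) (by omega),
          hi_of_lt (i := q.b) (by omega),
          hi_of_le (i := q.c) (by omega)]; omega),
        mark_of_lt (i := q.a) (by omega),
        mark_of_lt (i := q.b) (by omega),
        mark_of_le (i := q.c) (by omega)]
      simp only [Fin.prod_univ_succ, Fin.prod_univ_zero, Matrix.cons_val_zero, Matrix.cons_val_succ,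
        mul_pow, pow_add]
      ring

theorem sumsTo_three_bc (hz : MvPowerSeries.constantCoeff z = 0) :
    SumsTo (fun q : Config => if q.case = (2, false, true) then q.weightAt z else 0)
      (w * g [●] * f [●, ●, ○] * (ESum x 1 ![f [○], f [○]] *
        (ESum y 1 ![f [●]] * ESum z 1 ![w * f [●], w * f [●]]))) := by
  refine sumsTo_case hz _ _ _ _ _ _ _ _
    (fun e => ⟨e.2.2 0 + 1 + 1 + e.2.1 0 + 1 + e.2.2 1 + e.1 0 + 1 + e.1 1,
      e.2.2 0 + 1, e.2.2 0 + 1 + 1 + e.2.1 0,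
      e.2.2 0 + 1 + 1 + e.2.1 0 + 1 + e.2.2 1 + e.1 0,
      e.2.2 0 + 1 + 1 + e.2.1 0 + 1 + e.2.2 1 + e.1 0,
      e.2.2 0 + 1 + 1 + e.2.1 0 + 1 + e.2.2 1,
      by omega, by omega, by omega, by omega, by omega, by omega⟩)
    (fun q => (![q.c - q.s, q.n - q.c - 1], ![q.b - q.a - 1],
      ![q.a - 1, q.s - q.b - 1]))
    (fun e => ?_) (fun q hq => ?_) (fun e => ?_) (fun q hq => ?_)
  · refine exponents_ext (fun i => ?_) (fun i => ?_) (fun i => ?_) <;> fin_cases i <;>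
      simp <;> omega
  · obtain ⟨hr, ha, hc⟩ := case_eq_iff.1 hq
    have := region_eq_two.1 hr
    have := q.bounds
    simp at ha hc
    ext <;> simp <;> omega
  · refine case_eq_iff.2 ⟨region_eq_two.2 ?_, ?_, ?_⟩ <;> simp <;> omega
  · obtain ⟨hr, ha, hc⟩ := case_eq_iff.1 hq
    replace hr := region_eq_two.1 hr
    have := q.bounds
    simp only [iff_true, Bool.false_eq_true, iff_false] at ha hc
    obtain ⟨hA, hB, hC, hD⟩ := q.counts.2.2.1 hr.1 hr.2
    refine ⟨?_, ?_, ?_, ?_⟩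
    · simp [Fin.sum_univ_succ]; omega
    · simp; omega
    · simp [Fin.sum_univ_succ]; omega
    · have hD' : q.dipole.numD =
          (q.a - 1) + (q.s - q.b - 1) + 1 := by omega
      rw [hD', face_three_pos (by omega) (by omega)
        ((q.b - q.a - 1) + (q.a - 1) + (q.s - q.b - 1))
        ((q.c - q.s) + (q.n - q.c - 1))
        (by rw [lo_of_lt (i := q.a) (by omega),
          lo_of_lt (i := q.b) (by omega),
          lo_of_le (i := q.c) (by omega)]; omega)
        (by rw [hi_of_lt (i := q.a) (by omega),
          hi_of_lt (i := q.b) (by omega),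
          hi_of_le (i := q.c) (by omega)]; omega),
        mark_of_lt (i := q.a) (by omega),
        mark_of_lt (i := q.b) (by omega),
        mark_of_le (i := q.c) (by omega)]
      simp only [Fin.prod_univ_succ, Fin.prod_univ_zero, Matrix.cons_val_zero, Matrix.cons_val_succ,
        mul_pow, pow_add]
      ring

/-- All support corners are black. The n − s white corners are as many as the exponent A + 1 of x,
which is at least 1, so one factor f_(○) is left outside the series in x. -/
theorem sumsTo_three_above_root (hz : MvPowerSeries.constantCoeff z = 0) :
    SumsTo (fun q : Config => if q.case = (4, true, true) then q.weightAt z else 0)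
      (w ^ 2 * g [●, ●, ●] * f [○] * (ESum x 1 ![f [○]] *
        (ESum y 0 ![] * ESum z 2 ![w * f [●], w * f [●], w * f [●]]))) := by
  refine sumsTo_case hz _ _ _ _ _ _ _ _
    (fun e => ⟨e.2.2 0 + 1 + 1 + e.2.2 1 + 1 + e.2.2 2 + 1 + e.1 0,
      0, e.2.2 0 + 1,
      e.2.2 0 + 1 + 1 + e.2.2 1,
      e.2.2 0 + 1 + 1 + e.2.2 1,
      e.2.2 0 + 1 + 1 + e.2.2 1 + 1 + e.2.2 2,
      by omega, by omega, by omega, by omega, by omega, by omega⟩)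
    (fun q => (![q.n - q.s - 1], ![],
      ![q.b - 1, q.c - q.b - 1, q.s - q.c - 1]))
    (fun e => ?_) (fun q hq => ?_) (fun e => ?_) (fun q hq => ?_)
  · refine exponents_ext (fun i => ?_) (fun i => ?_) (fun i => ?_) <;> fin_cases i <;>
      simp <;> omega
  · obtain ⟨hr, ha, hc⟩ := case_eq_iff.1 hq
    have := region_eq_four.1 hr
    have := q.bounds
    simp at ha hc
    ext <;> simp <;> omega
  · refine case_eq_iff.2 ⟨region_eq_four.2 ?_, ?_, ?_⟩ <;> simp <;> omega
  · obtain ⟨hr, ha, hc⟩ := case_eq_iff.1 hq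
    replace hr := region_eq_four.1 hr
    have := q.bounds
    simp only [iff_true] at ha hc
    obtain ⟨hA, hB, hC, hD⟩ := q.counts.2.2.2.2 hr
    refine ⟨?_, ?_, ?_, ?_⟩
    · simp; omega
    · simp; omega
    · simp [Fin.sum_univ_succ]; omega
    -- The summand 2 counts the d-edges b and c, whose corners lie in the root face; a is the root
    -- edge and is not counted.
    · have hD' : q.dipole.numD =
          (q.b - 1) + (q.c - q.b - 1) + (q.s - q.c - 1) + 2 := by omega
      rw [hD', face_three_zero (by omega) (by omega)
        ((q.b - 1) + (q.c - q.b - 1) + (q.s - q.c - 1))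
        ((q.n - q.s - 1) + 1)
        (by rw [lo_of_lt (i := q.a) (by omega),
          lo_of_lt (i := q.b) (by omega),
          lo_of_lt (i := q.c) (by omega)]; omega)
        (by rw [hi_of_lt (i := q.a) (by omega),
          hi_of_lt (i := q.b) (by omega),
          hi_of_lt (i := q.c) (by omega)]; omega),
        mark_of_lt (i := q.a) (by omega),
        mark_of_lt (i := q.b) (by omega),
        mark_of_lt (i := q.c) (by omega)]
      simp only [Fin.prod_univ_succ, Fin.prod_univ_zero, Matrix.cons_val_zero, Matrix.cons_val_succ,
        mul_pow, pow_add]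
      ring

theorem sumsTo_three_above (hz : MvPowerSeries.constantCoeff z = 0) :
    SumsTo (fun q : Config => if q.case = (4, false, true) then q.weightAt z else 0)
      (w ^ 3 * g [●] * f [●, ●, ●] * f [○] * (ESum x 1 ![f [○]] *
        (ESum y 0 ![] * ESum z 3 ![w * f [●], w * f [●], w * f [●], w * f [●]]))) := by
  refine sumsTo_case hz _ _ _ _ _ _ _ _
    (fun e => ⟨e.2.2 0 + 1 + 1 + e.2.2 1 + 1 + e.2.2 2 + 1 + e.2.2 3 + 1 + e.1 0,
      e.2.2 0 + 1, e.2.2 0 + 1 + 1 + e.2.2 1,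
      e.2.2 0 + 1 + 1 + e.2.2 1 + 1 + e.2.2 2,
      e.2.2 0 + 1 + 1 + e.2.2 1 + 1 + e.2.2 2,
      e.2.2 0 + 1 + 1 + e.2.2 1 + 1 + e.2.2 2 + 1 + e.2.2 3,
      by omega, by omega, by omega, by omega, by omega, by omega⟩)
    (fun q => (![q.n - q.s - 1], ![],
      ![q.a - 1, q.b - q.a - 1, q.c - q.b - 1, q.s - q.c - 1]))
    (fun e => ?_) (fun q hq => ?_) (fun e => ?_) (fun q hq => ?_)
  · refine exponents_ext (fun i => ?_) (fun i => ?_) (fun i => ?_) <;> fin_cases i <;>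
      simp <;> omega
  · obtain ⟨hr, ha, hc⟩ := case_eq_iff.1 hq
    have := region_eq_four.1 hr
    have := q.bounds
    simp at ha hc
    ext <;> simp <;> omega
  · refine case_eq_iff.2 ⟨region_eq_four.2 ?_, ?_, ?_⟩ <;> simp <;> omega
  · obtain ⟨hr, ha, hc⟩ := case_eq_iff.1 hq
    replace hr := region_eq_four.1 hr
    have := q.bounds
    simp only [iff_true, Bool.false_eq_true, iff_false] at ha hc
    obtain ⟨hA, hB, hC, hD⟩ := q.counts.2.2.2.2 hr
    refine ⟨?_, ?_, ?_, ?_⟩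
    · simp; omega
    · simp; omega
    · simp [Fin.sum_univ_succ]; omega
    · have hD' : q.dipole.numD =
          (q.a - 1) + (q.b - q.a - 1) + (q.c - q.b - 1) + (q.s - q.c - 1) + 3 := by omega
      rw [hD', face_three_pos (by omega) (by omega)
        ((q.a - 1) + (q.b - q.a - 1) + (q.c - q.b - 1) + (q.s - q.c - 1))
        ((q.n - q.s - 1) + 1)
        (by rw [lo_of_lt (i := q.a) (by omega),
          lo_of_lt (i := q.b) (by omega),
          lo_of_lt (i := q.c) (by omega)]; omega)
        (by rw [hi_of_lt (i := q.a) (by omega),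
          hi_of_lt (i := q.b) (by omega),
          hi_of_lt (i := q.c) (by omega)]; omega),
        mark_of_lt (i := q.a) (by omega),
        mark_of_lt (i := q.b) (by omega),
        mark_of_lt (i := q.c) (by omega)]
      simp only [Fin.prod_univ_succ, Fin.prod_univ_zero, Matrix.cons_val_zero, Matrix.cons_val_succ,
        mul_pow, pow_add]
      ring

theorem sumsTo_two_below (hz : MvPowerSeries.constantCoeff z = 0) :
    SumsTo (fun q : Config => if q.case = (0, false, false) then q.weightAt z else 0)
      (g [●] * f [○, ○] ^ 2 * (ESum x 4 ![f [○], f [○], f [○], f [○], f [○]] *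
        (ESum y 0 ![] * ESum z 0 ![w * f [●]]))) := by
  refine sumsTo_case hz _ _ _ _ _ _ _ _
    (fun e => ⟨e.2.2 0 + 1 + e.1 0 + 1 + e.1 1 + 1 + e.1 2 + 1 + e.1 3 + 1 + e.1 4,
      e.2.2 0 + 1 + e.1 0, e.2.2 0 + 1 + e.1 0 + 1 + e.1 1,
      e.2.2 0 + 1 + e.1 0 + 1 + e.1 1 + 1 + e.1 2,
      e.2.2 0 + 1 + e.1 0 + 1 + e.1 1 + 1 + e.1 2 + 1 + e.1 3,
      e.2.2 0 + 1,
      by omega, by omega, by omega, by omega, by omega, by omega⟩)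
    (fun q => (![q.a - q.s, q.b - q.a - 1, q.c - q.b - 1, q.d - q.c - 1, q.n - q.d - 1], ![],
      ![q.s - 1]))
    (fun e => ?_) (fun q hq => ?_) (fun e => ?_) (fun q hq => ?_)
  · refine exponents_ext (fun i => ?_) (fun i => ?_) (fun i => ?_) <;> fin_cases i <;>
      simp <;> omega
  · obtain ⟨hr, ha, hc⟩ := case_eq_iff.1 hq
    have := region_eq_zero.1 hr
    have := q.bounds
    simp at ha hc
    ext <;> simp <;> omega
  · refine case_eq_iff.2 ⟨region_eq_zero.2 ?_, ?_, ?_⟩ <;> simp <;> omega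
  · obtain ⟨hr, ha, hc⟩ := case_eq_iff.1 hq
    replace hr := region_eq_zero.1 hr
    have := q.bounds
    simp only [Bool.false_eq_true, iff_false] at ha hc
    obtain ⟨hA, hB, hC, hD⟩ := q.counts.1 hr
    refine ⟨?_, ?_, ?_, ?_⟩
    · simp [Fin.sum_univ_succ]; omega
    · simp; omega
    · simp; omega
    · have hD' : q.dipole.numD =
          q.s - 1 := by omega
      rw [hD', face_two_pos (by omega) (by omega)
        (q.s - 1)
        ((q.a - q.s) + (q.b - q.a - 1) + (q.c - q.b - 1) + (q.d - q.c - 1) + (q.n - q.d - 1))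
        (by rw [lo_of_le (i := q.a) (by omega),
          lo_of_le (i := q.b) (by omega),
          lo_of_le (i := q.c) (by omega),
          lo_of_le (i := q.d) (by omega)]; omega)
        (by rw [hi_of_le (i := q.a) (by omega),
          hi_of_le (i := q.b) (by omega),
          hi_of_le (i := q.c) (by omega),
          hi_of_le (i := q.d) (by omega)]; omega),
        mark_of_le (i := q.a) (by omega),
        mark_of_le (i := q.b) (by omega),
        mark_of_le (i := q.c) (by omega),
        mark_of_le (i := q.d) (by omega)]
      simp only [Fin.prod_univ_succ, Fin.prod_univ_zero, Matrix.cons_val_zero, Matrix.cons_val_succ,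
        mul_pow, pow_add]
      ring

theorem sumsTo_two_ab_root (hz : MvPowerSeries.constantCoeff z = 0) :
    SumsTo (fun q : Config => if q.case = (1, true, false) then q.weightAt z else 0)
      (g [●, ○] * f [○, ○] * (ESum x 1 ![f [○], f [○]] *
        (ESum y 0 ![] * ESum z 2 ![f [○], f [○], w * f [●]]))) := by
  refine sumsTo_case hz _ _ _ _ _ _ _ _
    (fun e => ⟨e.2.2 2 + 1 + e.1 0 + 1 + e.2.2 0 + 1 + e.2.2 1 + 1 + e.1 1,
      0, e.2.2 2 + 1 + e.1 0,
      e.2.2 2 + 1 + e.1 0 + 1 + e.2.2 0,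
      e.2.2 2 + 1 + e.1 0 + 1 + e.2.2 0 + 1 + e.2.2 1,
      e.2.2 2 + 1,
      by omega, by omega, by omega, by omega, by omega, by omega⟩)
    (fun q => (![q.b - q.s, q.n - q.d - 1], ![],
      ![q.c - q.b - 1, q.d - q.c - 1, q.s - 1]))
    (fun e => ?_) (fun q hq => ?_) (fun e => ?_) (fun q hq => ?_)
  · refine exponents_ext (fun i => ?_) (fun i => ?_) (fun i => ?_) <;> fin_cases i <;>
      simp <;> omega
  · obtain ⟨hr, ha, hc⟩ := case_eq_iff.1 hq
    have := region_eq_one.1 hr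
    have := q.bounds
    simp at ha hc
    ext <;> simp <;> omega
  · refine case_eq_iff.2 ⟨region_eq_one.2 ?_, ?_, ?_⟩ <;> simp <;> omega
  · obtain ⟨hr, ha, hc⟩ := case_eq_iff.1 hq
    replace hr := region_eq_one.1 hr
    have := q.bounds
    simp only [iff_true, Bool.false_eq_true, iff_false] at ha hc
    obtain ⟨hA, hB, hC, hD⟩ := q.counts.2.1 hr.1 hr.2
    refine ⟨?_, ?_, ?_, ?_⟩
    · simp [Fin.sum_univ_succ]; omega
    · simp; omega
    · simp [Fin.sum_univ_succ]; omega
    · have hD' : q.dipole.numD =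
          q.s - 1 := by omega
      rw [hD', face_two_zero (by omega) (by omega)
        (q.s - 1)
        ((q.b - q.s) + (q.n - q.d - 1) + (q.c - q.b - 1) + (q.d - q.c - 1))
        (by rw [lo_of_lt (i := q.a) (by omega),
          lo_of_le (i := q.b) (by omega),
          lo_of_le (i := q.c) (by omega),
          lo_of_le (i := q.d) (by omega)]; omega)
        (by rw [hi_of_lt (i := q.a) (by omega),
          hi_of_le (i := q.b) (by omega),
          hi_of_le (i := q.c) (by omega),
          hi_of_le (i := q.d) (by omega)]; omega),
        mark_of_lt (i := q.a) (by omega),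
        mark_of_le (i := q.b) (by omega),
        mark_of_le (i := q.c) (by omega),
        mark_of_le (i := q.d) (by omega)]
      simp only [Fin.prod_univ_succ, Fin.prod_univ_zero, Matrix.cons_val_zero, Matrix.cons_val_succ,
        mul_pow, pow_add]
      ring

theorem sumsTo_two_ab (hz : MvPowerSeries.constantCoeff z = 0) :
    SumsTo (fun q : Config => if q.case = (1, false, false) then q.weightAt z else 0)
      (w * g [●] * f [●, ○] * f [○, ○] * (ESum x 1 ![f [○], f [○]] *
        (ESum y 0 ![] * ESum z 3 ![w * f [●], f [○], f [○], w * f [●]]))) := by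
  refine sumsTo_case hz _ _ _ _ _ _ _ _
    (fun e => ⟨e.2.2 0 + 1 + 1 + e.2.2 3 + e.1 0 + 1 + e.2.2 1 + 1 + e.2.2 2 + 1 + e.1 1,
      e.2.2 0 + 1, e.2.2 0 + 1 + 1 + e.2.2 3 + e.1 0,
      e.2.2 0 + 1 + 1 + e.2.2 3 + e.1 0 + 1 + e.2.2 1,
      e.2.2 0 + 1 + 1 + e.2.2 3 + e.1 0 + 1 + e.2.2 1 + 1 + e.2.2 2,
      e.2.2 0 + 1 + 1 + e.2.2 3,
      by omega, by omega, by omega, by omega, by omega, by omega⟩)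
    (fun q => (![q.b - q.s, q.n - q.d - 1], ![],
      ![q.a - 1, q.c - q.b - 1, q.d - q.c - 1, q.s - q.a - 1]))
    (fun e => ?_) (fun q hq => ?_) (fun e => ?_) (fun q hq => ?_)
  · refine exponents_ext (fun i => ?_) (fun i => ?_) (fun i => ?_) <;> fin_cases i <;>
      simp <;> omega
  · obtain ⟨hr, ha, hc⟩ := case_eq_iff.1 hq
    have := region_eq_one.1 hr
    have := q.bounds
    simp at ha hc
    ext <;> simp <;> omega
  · refine case_eq_iff.2 ⟨region_eq_one.2 ?_, ?_, ?_⟩ <;> simp <;> omega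
  · obtain ⟨hr, ha, hc⟩ := case_eq_iff.1 hq
    replace hr := region_eq_one.1 hr
    have := q.bounds
    simp only [Bool.false_eq_true, iff_false] at ha hc
    obtain ⟨hA, hB, hC, hD⟩ := q.counts.2.1 hr.1 hr.2
    refine ⟨?_, ?_, ?_, ?_⟩
    · simp [Fin.sum_univ_succ]; omega
    · simp; omega
    · simp [Fin.sum_univ_succ]; omega
    · have hD' : q.dipole.numD =
          (q.a - 1) + (q.s - q.a - 1) + 1 := by omega
      rw [hD', face_two_pos (by omega) (by omega)
        ((q.a - 1) + (q.s - q.a - 1))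
        ((q.b - q.s) + (q.n - q.d - 1) + (q.c - q.b - 1) + (q.d - q.c - 1))
        (by rw [lo_of_lt (i := q.a) (by omega),
          lo_of_le (i := q.b) (by omega),
          lo_of_le (i := q.c) (by omega),
          lo_of_le (i := q.d) (by omega)]; omega)
        (by rw [hi_of_lt (i := q.a) (by omega),
          hi_of_le (i := q.b) (by omega),
          hi_of_le (i := q.c) (by omega),
          hi_of_le (i := q.d) (by omega)]; omega),
        mark_of_lt (i := q.a) (by omega),
        mark_of_le (i := q.b) (by omega),
        mark_of_le (i := q.c) (by omega),
        mark_of_le (i := q.d) (by omega)]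
      simp only [Fin.prod_univ_succ, Fin.prod_univ_zero, Matrix.cons_val_zero, Matrix.cons_val_succ,
        mul_pow, pow_add]
      ring

theorem sumsTo_two_bc_root (hz : MvPowerSeries.constantCoeff z = 0) :
    SumsTo (fun q : Config => if q.case = (2, true, false) then q.weightAt z else 0)
      (g [●, ○] * f [●, ○] * (ESum x 1 ![f [○], f [○]] *
        (ESum y 1 ![f [●]] * ESum z 1 ![f [○], w * f [●]]))) := by
  refine sumsTo_case hz _ _ _ _ _ _ _ _
    (fun e => ⟨e.2.1 0 + 1 + 1 + e.2.2 1 + e.1 0 + 1 + e.2.2 0 + 1 + e.1 1,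
      0, e.2.1 0 + 1,
      e.2.1 0 + 1 + 1 + e.2.2 1 + e.1 0,
      e.2.1 0 + 1 + 1 + e.2.2 1 + e.1 0 + 1 + e.2.2 0,
      e.2.1 0 + 1 + 1 + e.2.2 1,
      by omega, by omega, by omega, by omega, by omega, by omega⟩)
    (fun q => (![q.c - q.s, q.n - q.d - 1], ![q.b - 1],
      ![q.d - q.c - 1, q.s - q.b - 1]))
    (fun e => ?_) (fun q hq => ?_) (fun e => ?_) (fun q hq => ?_)
  · refine exponents_ext (fun i => ?_) (fun i => ?_) (fun i => ?_) <;> fin_cases i <;>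
      simp <;> omega
  · obtain ⟨hr, ha, hc⟩ := case_eq_iff.1 hq
    have := region_eq_two.1 hr
    have := q.bounds
    simp at ha hc
    ext <;> simp <;> omega
  · refine case_eq_iff.2 ⟨region_eq_two.2 ?_, ?_, ?_⟩ <;> simp <;> omega
  · obtain ⟨hr, ha, hc⟩ := case_eq_iff.1 hq
    replace hr := region_eq_two.1 hr
    have := q.bounds
    simp only [iff_true, Bool.false_eq_true, iff_false] at ha hc
    obtain ⟨hA, hB, hC, hD⟩ := q.counts.2.2.1 hr.1 hr.2
    refine ⟨?_, ?_, ?_, ?_⟩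
    · simp [Fin.sum_univ_succ]; omega
    · simp; omega
    · simp [Fin.sum_univ_succ]; omega
    · have hD' : q.dipole.numD =
          q.s - q.b - 1 := by omega
      rw [hD', face_two_zero (by omega) (by omega)
        ((q.b - 1) + (q.s - q.b - 1))
        ((q.c - q.s) + (q.n - q.d - 1) + (q.d - q.c - 1))
        (by rw [lo_of_lt (i := q.a) (by omega),
          lo_of_lt (i := q.b) (by omega),
          lo_of_le (i := q.c) (by omega),
          lo_of_le (i := q.d) (by omega)]; omega)
        (by rw [hi_of_lt (i := q.a) (by omega),
          hi_of_lt (i := q.b) (by omega),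
          hi_of_le (i := q.c) (by omega),
          hi_of_le (i := q.d) (by omega)]; omega),
        mark_of_lt (i := q.a) (by omega),
        mark_of_lt (i := q.b) (by omega),
        mark_of_le (i := q.c) (by omega),
        mark_of_le (i := q.d) (by omega)]
      simp only [Fin.prod_univ_succ, Fin.prod_univ_zero, Matrix.cons_val_zero, Matrix.cons_val_succ,
        mul_pow, pow_add]
      ring

/-- Here s separates {a,b} from {c,d}, so both two-corner faces {a,c} and {b,d} are bicoloured; this
gives the square. -/
theorem sumsTo_two_bc (hz : MvPowerSeries.constantCoeff z = 0) :
    SumsTo (fun q : Config => if q.case = (2, false, false) then q.weightAt z else 0)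
      (w * g [●] * f [●, ○] ^ 2 * (ESum x 1 ![f [○], f [○]] *
        (ESum y 1 ![f [●]] * ESum z 2 ![w * f [●], f [○], w * f [●]]))) := by
  refine sumsTo_case hz _ _ _ _ _ _ _ _
    (fun e => ⟨e.2.2 0 + 1 + 1 + e.2.1 0 + 1 + e.2.2 2 + e.1 0 + 1 + e.2.2 1 + 1 + e.1 1,
      e.2.2 0 + 1, e.2.2 0 + 1 + 1 + e.2.1 0,
      e.2.2 0 + 1 + 1 + e.2.1 0 + 1 + e.2.2 2 + e.1 0,
      e.2.2 0 + 1 + 1 + e.2.1 0 + 1 + e.2.2 2 + e.1 0 + 1 + e.2.2 1,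
      e.2.2 0 + 1 + 1 + e.2.1 0 + 1 + e.2.2 2,
      by omega, by omega, by omega, by omega, by omega, by omega⟩)
    (fun q => (![q.c - q.s, q.n - q.d - 1], ![q.b - q.a - 1],
      ![q.a - 1, q.d - q.c - 1, q.s - q.b - 1]))
    (fun e => ?_) (fun q hq => ?_) (fun e => ?_) (fun q hq => ?_)
  · refine exponents_ext (fun i => ?_) (fun i => ?_) (fun i => ?_) <;> fin_cases i <;>
      simp <;> omega
  · obtain ⟨hr, ha, hc⟩ := case_eq_iff.1 hq
    have := region_eq_two.1 hr
    have := q.bounds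
    simp at ha hc
    ext <;> simp <;> omega
  · refine case_eq_iff.2 ⟨region_eq_two.2 ?_, ?_, ?_⟩ <;> simp <;> omega
  · obtain ⟨hr, ha, hc⟩ := case_eq_iff.1 hq
    replace hr := region_eq_two.1 hr
    have := q.bounds
    simp only [Bool.false_eq_true, iff_false] at ha hc
    obtain ⟨hA, hB, hC, hD⟩ := q.counts.2.2.1 hr.1 hr.2
    refine ⟨?_, ?_, ?_, ?_⟩
    · simp [Fin.sum_univ_succ]; omega
    · simp; omega
    · simp [Fin.sum_univ_succ]; omega
    · have hD' : q.dipole.numD =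
          (q.a - 1) + (q.s - q.b - 1) + 1 := by omega
      rw [hD', face_two_pos (by omega) (by omega)
        ((q.b - q.a - 1) + (q.a - 1) + (q.s - q.b - 1))
        ((q.c - q.s) + (q.n - q.d - 1) + (q.d - q.c - 1))
        (by rw [lo_of_lt (i := q.a) (by omega),
          lo_of_lt (i := q.b) (by omega),
          lo_of_le (i := q.c) (by omega),
          lo_of_le (i := q.d) (by omega)]; omega)
        (by rw [hi_of_lt (i := q.a) (by omega),
          hi_of_lt (i := q.b) (by omega),
          hi_of_le (i := q.c) (by omega),
          hi_of_le (i := q.d) (by omega)]; omega),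
        mark_of_lt (i := q.a) (by omega),
        mark_of_lt (i := q.b) (by omega),
        mark_of_le (i := q.c) (by omega),
        mark_of_le (i := q.d) (by omega)]
      simp only [Fin.prod_univ_succ, Fin.prod_univ_zero, Matrix.cons_val_zero, Matrix.cons_val_succ,
        mul_pow, pow_add]
      ring

/-- The b-edges now fill (a,b] and (b,c], whence two gaps in y and, later, φ₂(y). Only this interval
requires c < d. -/
theorem sumsTo_two_cd_root (hz : MvPowerSeries.constantCoeff z = 0) :
    SumsTo (fun q : Config => if q.case = (3, true, false) then q.weightAt z else 0)
      (g [●, ●] * f [●, ○] * (ESum x 1 ![f [○], f [○]] *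
        (ESum y 2 ![f [●], f [●]] * ESum z 0 ![w * f [●]]))) := by
  refine sumsTo_case hz _ _ _ _ _ _ _ _
    (fun e => ⟨e.2.1 0 + 1 + 1 + e.2.1 1 + 1 + e.2.2 0 + e.1 0 + 1 + e.1 1,
      0, e.2.1 0 + 1,
      e.2.1 0 + 1 + 1 + e.2.1 1,
      e.2.1 0 + 1 + 1 + e.2.1 1 + 1 + e.2.2 0 + e.1 0,
      e.2.1 0 + 1 + 1 + e.2.1 1 + 1 + e.2.2 0,
      by omega, by omega, by omega, by omega, by omega, by omega⟩)
    (fun q => (![q.d - q.s, q.n - q.d - 1], ![q.b - 1, q.c - q.b - 1],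
      ![q.s - q.c - 1]))
    (fun e => ?_) (fun q hq => ?_) (fun e => ?_) (fun q hq => ?_)
  · refine exponents_ext (fun i => ?_) (fun i => ?_) (fun i => ?_) <;> fin_cases i <;>
      simp <;> omega
  · obtain ⟨hr, ha, hc⟩ := case_eq_iff.1 hq
    have := region_eq_three.1 hr
    have := q.bounds
    simp at ha hc
    ext <;> simp <;> omega
  · refine case_eq_iff.2 ⟨region_eq_three.2 ?_, ?_, ?_⟩ <;> simp <;> omega
  · obtain ⟨hr, ha, hc⟩ := case_eq_iff.1 hq
    replace hr := region_eq_three.1 hr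
    have := q.bounds
    simp only [iff_true, Bool.false_eq_true, iff_false] at ha hc
    obtain ⟨hA, hB, hC, hD⟩ := q.counts.2.2.2.1 hr.1 hr.2
    refine ⟨?_, ?_, ?_, ?_⟩
    · simp [Fin.sum_univ_succ]; omega
    · simp [Fin.sum_univ_succ]; omega
    · simp; omega
    · have hD' : q.dipole.numD =
          q.s - q.c - 1 := by omega
      rw [hD', face_two_zero (by omega) (by omega)
        ((q.b - 1) + (q.c - q.b - 1) + (q.s - q.c - 1))
        ((q.d - q.s) + (q.n - q.d - 1))
        (by rw [lo_of_lt (i := q.a) (by omega),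
          lo_of_lt (i := q.b) (by omega),
          lo_of_lt (i := q.c) (by omega),
          lo_of_le (i := q.d) (by omega)]; omega)
        (by rw [hi_of_lt (i := q.a) (by omega),
          hi_of_lt (i := q.b) (by omega),
          hi_of_lt (i := q.c) (by omega),
          hi_of_le (i := q.d) (by omega)]; omega),
        mark_of_lt (i := q.a) (by omega),
        mark_of_lt (i := q.b) (by omega),
        mark_of_lt (i := q.c) (by omega),
        mark_of_le (i := q.d) (by omega)]
      simp only [Fin.prod_univ_succ, Fin.prod_univ_zero, Matrix.cons_val_zero, Matrix.cons_val_succ,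
        mul_pow, pow_add]
      ring

theorem sumsTo_two_cd (hz : MvPowerSeries.constantCoeff z = 0) :
    SumsTo (fun q : Config => if q.case = (3, false, false) then q.weightAt z else 0)
      (w * g [●] * f [●, ●] * f [●, ○] * (ESum x 1 ![f [○], f [○]] *
        (ESum y 2 ![f [●], f [●]] * ESum z 1 ![w * f [●], w * f [●]]))) := by
  refine sumsTo_case hz _ _ _ _ _ _ _ _
    (fun e => ⟨e.2.2 0 + 1 + 1 + e.2.1 0 + 1 + e.2.1 1 + 1 + e.2.2 1 + e.1 0 + 1 + e.1 1,
      e.2.2 0 + 1, e.2.2 0 + 1 + 1 + e.2.1 0,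
      e.2.2 0 + 1 + 1 + e.2.1 0 + 1 + e.2.1 1,
      e.2.2 0 + 1 + 1 + e.2.1 0 + 1 + e.2.1 1 + 1 + e.2.2 1 + e.1 0,
      e.2.2 0 + 1 + 1 + e.2.1 0 + 1 + e.2.1 1 + 1 + e.2.2 1,
      by omega, by omega, by omega, by omega, by omega, by omega⟩)
    (fun q => (![q.d - q.s, q.n - q.d - 1], ![q.b - q.a - 1, q.c - q.b - 1],
      ![q.a - 1, q.s - q.c - 1]))
    (fun e => ?_) (fun q hq => ?_) (fun e => ?_) (fun q hq => ?_)
  · refine exponents_ext (fun i => ?_) (fun i => ?_) (fun i => ?_) <;> fin_cases i <;>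
      simp <;> omega
  · obtain ⟨hr, ha, hc⟩ := case_eq_iff.1 hq
    have := region_eq_three.1 hr
    have := q.bounds
    simp at ha hc
    ext <;> simp <;> omega
  · refine case_eq_iff.2 ⟨region_eq_three.2 ?_, ?_, ?_⟩ <;> simp <;> omega
  · obtain ⟨hr, ha, hc⟩ := case_eq_iff.1 hq
    replace hr := region_eq_three.1 hr
    have := q.bounds
    simp only [Bool.false_eq_true, iff_false] at ha hc
    obtain ⟨hA, hB, hC, hD⟩ := q.counts.2.2.2.1 hr.1 hr.2
    refine ⟨?_, ?_, ?_, ?_⟩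
    · simp [Fin.sum_univ_succ]; omega
    · simp [Fin.sum_univ_succ]; omega
    · simp [Fin.sum_univ_succ]; omega
    · have hD' : q.dipole.numD =
          (q.a - 1) + (q.s - q.c - 1) + 1 := by omega
      rw [hD', face_two_pos (by omega) (by omega)
        ((q.b - q.a - 1) + (q.c - q.b - 1) + (q.a - 1) + (q.s - q.c - 1))
        ((q.d - q.s) + (q.n - q.d - 1))
        (by rw [lo_of_lt (i := q.a) (by omega),
          lo_of_lt (i := q.b) (by omega),
          lo_of_lt (i := q.c) (by omega),
          lo_of_le (i := q.d) (by omega)]; omega)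
        (by rw [hi_of_lt (i := q.a) (by omega),
          hi_of_lt (i := q.b) (by omega),
          hi_of_lt (i := q.c) (by omega),
          hi_of_le (i := q.d) (by omega)]; omega),
        mark_of_lt (i := q.a) (by omega),
        mark_of_lt (i := q.b) (by omega),
        mark_of_lt (i := q.c) (by omega),
        mark_of_le (i := q.d) (by omega)]
      simp only [Fin.prod_univ_succ, Fin.prod_univ_zero, Matrix.cons_val_zero, Matrix.cons_val_succ,
        mul_pow, pow_add]
      ring

theorem sumsTo_two_above_root (hz : MvPowerSeries.constantCoeff z = 0) :
    SumsTo (fun q : Config => if q.case = (4, true, false) then q.weightAt z else 0)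
      (w ^ 3 * g [●, ●] * f [●, ●] * f [○] * (ESum x 1 ![f [○]] *
        (ESum y 0 ![] * ESum z 3 ![w * f [●], w * f [●], w * f [●], w * f [●]]))) := by
  refine sumsTo_case hz _ _ _ _ _ _ _ _
    (fun e => ⟨e.2.2 0 + 1 + 1 + e.2.2 1 + 1 + e.2.2 2 + 1 + e.2.2 3 + 1 + e.1 0,
      0, e.2.2 0 + 1,
      e.2.2 0 + 1 + 1 + e.2.2 1,
      e.2.2 0 + 1 + 1 + e.2.2 1 + 1 + e.2.2 2,
      e.2.2 0 + 1 + 1 + e.2.2 1 + 1 + e.2.2 2 + 1 + e.2.2 3,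
      by omega, by omega, by omega, by omega, by omega, by omega⟩)
    (fun q => (![q.n - q.s - 1], ![],
      ![q.b - 1, q.c - q.b - 1, q.d - q.c - 1, q.s - q.d - 1]))
    (fun e => ?_) (fun q hq => ?_) (fun e => ?_) (fun q hq => ?_)
  · refine exponents_ext (fun i => ?_) (fun i => ?_) (fun i => ?_) <;> fin_cases i <;>
      simp <;> omega
  · obtain ⟨hr, ha, hc⟩ := case_eq_iff.1 hq
    have := region_eq_four.1 hr
    have := q.bounds
    simp at ha hc
    ext <;> simp <;> omega
  · refine case_eq_iff.2 ⟨region_eq_four.2 ?_, ?_, ?_⟩ <;> simp <;> omega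
  · obtain ⟨hr, ha, hc⟩ := case_eq_iff.1 hq
    replace hr := region_eq_four.1 hr
    have := q.bounds
    simp only [iff_true, Bool.false_eq_true, iff_false] at ha hc
    obtain ⟨hA, hB, hC, hD⟩ := q.counts.2.2.2.2 hr
    refine ⟨?_, ?_, ?_, ?_⟩
    · simp; omega
    · simp; omega
    · simp [Fin.sum_univ_succ]; omega
    · have hD' : q.dipole.numD =
          (q.b - 1) + (q.c - q.b - 1) + (q.d - q.c - 1) + (q.s - q.d - 1) + 3 := by omega
      rw [hD', face_two_zero (by omega) (by omega)
        ((q.b - 1) + (q.c - q.b - 1) + (q.d - q.c - 1) + (q.s - q.d - 1))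
        ((q.n - q.s - 1) + 1)
        (by rw [lo_of_lt (i := q.a) (by omega),
          lo_of_lt (i := q.b) (by omega),
          lo_of_lt (i := q.c) (by omega),
          lo_of_lt (i := q.d) (by omega)]; omega)
        (by rw [hi_of_lt (i := q.a) (by omega),
          hi_of_lt (i := q.b) (by omega),
          hi_of_lt (i := q.c) (by omega),
          hi_of_lt (i := q.d) (by omega)]; omega),
        mark_of_lt (i := q.a) (by omega),
        mark_of_lt (i := q.b) (by omega),
        mark_of_lt (i := q.c) (by omega),
        mark_of_lt (i := q.d) (by omega)]
      simp only [Fin.prod_univ_succ, Fin.prod_univ_zero, Matrix.cons_val_zero, Matrix.cons_val_succ,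
        mul_pow, pow_add]
      ring

theorem sumsTo_two_above (hz : MvPowerSeries.constantCoeff z = 0) :
    SumsTo (fun q : Config => if q.case = (4, false, false) then q.weightAt z else 0)
      (w ^ 4 * g [●] * f [●, ●] ^ 2 * f [○] * (ESum x 1 ![f [○]] *
        (ESum y 0 ![] * ESum z 4 ![w * f [●], w * f [●], w * f [●], w * f [●], w * f [●]]))) := by
  refine sumsTo_case hz _ _ _ _ _ _ _ _
    (fun e => ⟨e.2.2 0 + 1 + 1 + e.2.2 1 + 1 + e.2.2 2 + 1 + e.2.2 3 + 1 + e.2.2 4 + 1 + e.1 0,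
      e.2.2 0 + 1, e.2.2 0 + 1 + 1 + e.2.2 1,
      e.2.2 0 + 1 + 1 + e.2.2 1 + 1 + e.2.2 2,
      e.2.2 0 + 1 + 1 + e.2.2 1 + 1 + e.2.2 2 + 1 + e.2.2 3,
      e.2.2 0 + 1 + 1 + e.2.2 1 + 1 + e.2.2 2 + 1 + e.2.2 3 + 1 + e.2.2 4,
      by omega, by omega, by omega, by omega, by omega, by omega⟩)
    (fun q => (![q.n - q.s - 1], ![],
      ![q.a - 1, q.b - q.a - 1, q.c - q.b - 1, q.d - q.c - 1, q.s - q.d - 1]))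
    (fun e => ?_) (fun q hq => ?_) (fun e => ?_) (fun q hq => ?_)
  · refine exponents_ext (fun i => ?_) (fun i => ?_) (fun i => ?_) <;> fin_cases i <;>
      simp <;> omega
  · obtain ⟨hr, ha, hc⟩ := case_eq_iff.1 hq
    have := region_eq_four.1 hr
    have := q.bounds
    simp at ha hc
    ext <;> simp <;> omega
  · refine case_eq_iff.2 ⟨region_eq_four.2 ?_, ?_, ?_⟩ <;> simp <;> omega
  · obtain ⟨hr, ha, hc⟩ := case_eq_iff.1 hq
    replace hr := region_eq_four.1 hr
    have := q.bounds
    simp only [Bool.false_eq_true, iff_false] at ha hc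
    obtain ⟨hA, hB, hC, hD⟩ := q.counts.2.2.2.2 hr
    refine ⟨?_, ?_, ?_, ?_⟩
    · simp; omega
    · simp; omega
    · simp [Fin.sum_univ_succ]; omega
    · have hD' : q.dipole.numD =
          (q.a - 1) + (q.b - q.a - 1) + (q.c - q.b - 1) + (q.d - q.c - 1) + (q.s - q.d - 1) +
            4 := by omega
      rw [hD', face_two_pos (by omega) (by omega)
        ((q.a - 1) + (q.b - q.a - 1) + (q.c - q.b - 1) + (q.d - q.c - 1) + (q.s - q.d - 1))
        ((q.n - q.s - 1) + 1)
        (by rw [lo_of_lt (i := q.a) (by omega),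
          lo_of_lt (i := q.b) (by omega),
          lo_of_lt (i := q.c) (by omega),
          lo_of_lt (i := q.d) (by omega)]; omega)
        (by rw [hi_of_lt (i := q.a) (by omega),
          hi_of_lt (i := q.b) (by omega),
          hi_of_lt (i := q.c) (by omega),
          hi_of_lt (i := q.d) (by omega)]; omega),
        mark_of_lt (i := q.a) (by omega),
        mark_of_lt (i := q.b) (by omega),
        mark_of_lt (i := q.c) (by omega),
        mark_of_lt (i := q.d) (by omega)]
      simp only [Fin.prod_univ_succ, Fin.prod_univ_zero, Matrix.cons_val_zero, Matrix.cons_val_succ,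
        mul_pow, pow_add]
      ring

/-! ### Assembly of the cases -/

/-- The sums of the weights in the cases for a quadruple and a secondary edge. -/
def caseSum (z : Series) : Fin 5 × Bool × Bool → Series
  | (0, false, true) => g [●] * f [○, ○, ○] * (ESum x 3 ![f [○], f [○], f [○], f [○]] *
    (ESum y 0 ![] * ESum z 0 ![w * f [●]]))
  | (1, true, true) => g [●, ○, ○] * (ESum x 1 ![f [○], f [○]] *
    (ESum y 0 ![] * ESum z 1 ![f [○], w * f [●]]))
  | (1, false, true) => w * g [●] * f [●, ○, ○] * (ESum x 1 ![f [○], f [○]] *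
    (ESum y 0 ![] * ESum z 2 ![w * f [●], f [○], w * f [●]]))
  | (2, true, true) => g [●, ●, ○] * (ESum x 1 ![f [○], f [○]] *
    (ESum y 1 ![f [●]] * ESum z 0 ![w * f [●]]))
  | (2, false, true) => w * g [●] * f [●, ●, ○] * (ESum x 1 ![f [○], f [○]] *
    (ESum y 1 ![f [●]] * ESum z 1 ![w * f [●], w * f [●]]))
  | (4, true, true) => w ^ 2 * g [●, ●, ●] * f [○] * (ESum x 1 ![f [○]] *
    (ESum y 0 ![] * ESum z 2 ![w * f [●], w * f [●], w * f [●]]))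
  | (4, false, true) => w ^ 3 * g [●] * f [●, ●, ●] * f [○] * (ESum x 1 ![f [○]] *
    (ESum y 0 ![] * ESum z 3 ![w * f [●], w * f [●], w * f [●], w * f [●]]))
  | (0, false, false) => g [●] * f [○, ○] ^ 2 * (ESum x 4 ![f [○], f [○], f [○], f [○], f [○]] *
    (ESum y 0 ![] * ESum z 0 ![w * f [●]]))
  | (1, true, false) => g [●, ○] * f [○, ○] * (ESum x 1 ![f [○], f [○]] *
    (ESum y 0 ![] * ESum z 2 ![f [○], f [○], w * f [●]]))
  | (1, false, false) => w * g [●] * f [●, ○] * f [○, ○] * (ESum x 1 ![f [○], f [○]] *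
    (ESum y 0 ![] * ESum z 3 ![w * f [●], f [○], f [○], w * f [●]]))
  | (2, true, false) => g [●, ○] * f [●, ○] * (ESum x 1 ![f [○], f [○]] *
    (ESum y 1 ![f [●]] * ESum z 1 ![f [○], w * f [●]]))
  | (2, false, false) => w * g [●] * f [●, ○] ^ 2 * (ESum x 1 ![f [○], f [○]] *
    (ESum y 1 ![f [●]] * ESum z 2 ![w * f [●], f [○], w * f [●]]))
  | (3, true, false) => g [●, ●] * f [●, ○] * (ESum x 1 ![f [○], f [○]] *
    (ESum y 2 ![f [●], f [●]] * ESum z 0 ![w * f [●]]))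
  | (3, false, false) => w * g [●] * f [●, ●] * f [●, ○] * (ESum x 1 ![f [○], f [○]] *
    (ESum y 2 ![f [●], f [●]] * ESum z 1 ![w * f [●], w * f [●]]))
  | (4, true, false) => w ^ 3 * g [●, ●] * f [●, ●] * f [○] * (ESum x 1 ![f [○]] *
    (ESum y 0 ![] * ESum z 3 ![w * f [●], w * f [●], w * f [●], w * f [●]]))
  | (4, false, false) => w ^ 4 * g [●] * f [●, ●] ^ 2 * f [○] * (ESum x 1 ![f [○]] *
    (ESum y 0 ![] * ESum z 4 ![w * f [●], w * f [●], w * f [●], w * f [●], w * f [●]]))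
  | (0, true, _) => 0
  | (3, _, true) => 0

theorem SumsTo.if_false {ι : Type} {p : ι → Prop} [DecidablePred p] {F : ι → Series}
    (h : ∀ i, ¬ p i) : SumsTo (fun i => if p i then F i else 0) 0 :=
  SumsTo.zero.congr fun i => if_neg (h i)

theorem sumsTo_caseSum {z : Series} (hz : MvPowerSeries.constantCoeff z = 0) :
    ∀ t, SumsTo (fun q : Config => if q.case = t then q.weightAt z else 0) (caseSum z t)
  | (0, false, true) => sumsTo_three_below hz
  | (1, true, true) => sumsTo_three_ab_root hz
  | (1, false, true) => sumsTo_three_ab hz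
  | (2, true, true) => sumsTo_three_bc_root hz
  | (2, false, true) => sumsTo_three_bc hz
  | (4, true, true) => sumsTo_three_above_root hz
  | (4, false, true) => sumsTo_three_above hz
  | (0, false, false) => sumsTo_two_below hz
  | (1, true, false) => sumsTo_two_ab_root hz
  | (1, false, false) => sumsTo_two_ab hz
  | (2, true, false) => sumsTo_two_bc_root hz
  | (2, false, false) => sumsTo_two_bc hz
  | (3, true, false) => sumsTo_two_cd_root hz
  | (3, false, false) => sumsTo_two_cd hz
  | (4, true, false) => sumsTo_two_above_root hz
  | (4, false, false) => sumsTo_two_above hz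
  -- Empty, since 0 < s ≤ a contradicts a = 0.
  | (0, true, _) => SumsTo.if_false fun q hq => by
    obtain ⟨hr, ha, -⟩ := case_eq_iff.1 hq
    have h1 := region_eq_zero.1 hr
    have h2 := q.hs
    have h3 := ha.2 rfl
    omega
  -- Empty, since c < s ≤ d contradicts c = d.
  | (3, p, true) => by
    rw [show caseSum z (3, p, true) = 0 by cases p <;> rfl]
    refine SumsTo.if_false fun q hq => ?_
    obtain ⟨hr, -, hc⟩ := case_eq_iff.1 hq
    have h1 := region_eq_three.1 hr
    have h2 := hc.2 rfl
    omega

theorem sumsTo_weightAt {z : Series} (hz : MvPowerSeries.constantCoeff z = 0) :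
    SumsTo (fun D : (Σ n, BiRootedDipole n) => if D.2.twiceGenus = 2 then D.2.weightAt z else 0)
      (∑ t, caseSum z t) :=
  formalSum_twiceGenus (SumsTo.of_cases Config.case (sumsTo_caseSum hz))

theorem GamGenus_one : GamGenus 1 = ∑ t, caseSum v t := by
  rw [GamGenus, Gam, PowerSeries.coeff_mk]
  exact ((sumsTo_weightAt constantCoeff_v).congr fun D => by
    rw [BiRootedDipole.weightAt_v]).formalSum_eq

/-- Outside the index type of B the weight at z = 0 vanishes, and on it the weight is the original
one. -/
theorem BGenus_one : BGenus 1 = ∑ t, caseSum 0 t := by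
  rw [BGenus, B, PowerSeries.coeff_mk]
  refine SumsTo.formalSum_eq (((SumsTo.comp_injective_iff (φ := Subtype.val)
    Subtype.val_injective fun D hD => ?_).2 (sumsTo_weightAt (map_zero _))).congr fun D => ?_)
  · rw [BiRootedDipole.weightAt_zero, if_neg fun h => hD ⟨⟨D, h⟩, rfl⟩, ite_self]
  · simp only [comp_apply, BiRootedDipole.weightAt_zero, if_pos D.2]

theorem sum_caseSum (F : Fin 5 × Bool × Bool → Series) :
    ∑ t, F t = F (0, true, true) + F (0, true, false) + F (0, false, true) + F (0, false, false) +
      (F (1, true, true) + F (1, true, false) + F (1, false, true) + F (1, false, false)) +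
      (F (2, true, true) + F (2, true, false) + F (2, false, true) + F (2, false, false)) +
      (F (3, true, true) + F (3, true, false) + F (3, false, true) + F (3, false, false)) +
      (F (4, true, true) + F (4, true, false) + F (4, false, true) + F (4, false, false)) := by
  simp only [Fintype.sum_prod_type, Fin.sum_univ_five, Fintype.sum_bool]
  ring

/-! ### Common normal form for both sides of the formula -/

theorem ESum_one {z : Series} (hz : MvPowerSeries.constantCoeff z = 0) (k : ℕ) (a : Series) :
    ESum z k ![a] = ESum z k ![] + a * ESum z (k + 1) ![a] :=
  (ESum_snoc hz k _).trans (by congr; funext i; exact i.elim0)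

theorem ESum_two {z : Series} (hz : MvPowerSeries.constantCoeff z = 0) (k : ℕ) (a b : Series) :
    ESum z k ![a, b] = ESum z k ![a] + b * ESum z (k + 1) ![a, b] :=
  (ESum_snoc hz k _).trans (by congr; funext i; fin_cases i; rfl)

theorem ESum_three {z : Series} (hz : MvPowerSeries.constantCoeff z = 0) (k : ℕ)
    (a b c : Series) :
    ESum z k ![a, b, c] = ESum z k ![a, b] + c * ESum z (k + 1) ![a, b, c] :=
  (ESum_snoc hz k _).trans (by congr; funext i; fin_cases i <;> rfl)

theorem ESum_four {z : Series} (hz : MvPowerSeries.constantCoeff z = 0) (k : ℕ)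
    (a b c d : Series) :
    ESum z k ![a, b, c, d] = ESum z k ![a, b, c] + d * ESum z (k + 1) ![a, b, c, d] :=
  (ESum_snoc hz k _).trans (by congr; funext i; fin_cases i <;> rfl)

theorem ESum_five {z : Series} (hz : MvPowerSeries.constantCoeff z = 0) (k : ℕ)
    (a b c d e : Series) :
    ESum z k ![a, b, c, d, e] = ESum z k ![a, b, c, d] + e * ESum z (k + 1) ![a, b, c, d, e] :=
  (ESum_snoc hz k _).trans (by congr; funext i; fin_cases i <;> rfl)

theorem ESum_nil (z : Series) : ESum z 0 ![] = 1 := ESum_elim0 z _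

theorem phiStr_one (a : Dot) : phiStr [a] = ESum v 1 ![phiArg a] :=
  (phi_eq_ESum constantCoeff_v _).trans (congrArg _ (funext fun i => by fin_cases i; rfl))

theorem phiStr_two (a b : Dot) : phiStr [a, b] = ESum v 2 ![phiArg a, phiArg b] :=
  (phi_eq_ESum constantCoeff_v _).trans (congrArg _ (funext fun i => by fin_cases i <;> rfl))

theorem phiStr_three (a b c : Dot) :
    phiStr [a, b, c] = ESum v 3 ![phiArg a, phiArg b, phiArg c] :=
  (phi_eq_ESum constantCoeff_v _).trans (congrArg _ (funext fun i => by fin_cases i <;> rfl))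

theorem phiStr_four (a b c d : Dot) :
    phiStr [a, b, c, d] = ESum v 4 ![phiArg a, phiArg b, phiArg c, phiArg d] :=
  (phi_eq_ESum constantCoeff_v _).trans (congrArg _ (funext fun i => by fin_cases i <;> rfl))

theorem phiStr_five (a b c d e : Dot) :
    phiStr [a, b, c, d, e] = ESum v 5 ![phiArg a, phiArg b, phiArg c, phiArg d, phiArg e] :=
  (phi_eq_ESum constantCoeff_v _).trans (congrArg _ (funext fun i => by fin_cases i <;> rfl))

theorem phiNum_one : phiNum 1 = ESum y 1 ![f [●]] :=
  (phi_eq_ESum constantCoeff_y _).trans (congrArg _ (funext fun i => by fin_cases i; rfl))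

theorem phiNum_two : phiNum 2 = ESum y 2 ![f [●], f [●]] :=
  (phi_eq_ESum constantCoeff_y _).trans (congrArg _ (funext fun i => by fin_cases i <;> rfl))

theorem sum_composition_one {M : Type*} [AddCommMonoid M] (F : Composition 1 → M) :
    ∑ c, F c = F (Composition.single 1 one_pos) := by
  have h : (Finset.univ : Finset (Composition 1)) = {Composition.single 1 one_pos} :=
    (Finset.eq_of_subset_of_card_le (Finset.subset_univ _)
      (by rw [Finset.card_univ, composition_card]; rfl)).symm
  rw [h, Finset.sum_singleton]

/-- A number n ≥ 1 has 2^{n−1} compositions. Only strings of length at most two occur in the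
formula, so these sums expand every τ in it. -/
theorem sum_composition_two {M : Type*} [AddCommMonoid M] (F : Composition 2 → M) :
    ∑ c, F c = F (Composition.single 2 two_pos) + F (Composition.ones 2) := by
  have h : (Finset.univ : Finset (Composition 2)) =
    {Composition.single 2 two_pos, Composition.ones 2} :=
    (Finset.eq_of_subset_of_card_le (Finset.subset_univ _)
      (by rw [Finset.card_univ, composition_card, Finset.card_pair (by decide)]; rfl)).symm
  rw [h, Finset.sum_pair (by decide)]

theorem tau_nil (S : List Dot) : tau [] S = g [●] * phiStr (● :: S) := if_pos rfl

theorem tau_one (a : Dot) (S : List Dot) :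
    tau [a] S = g [●, a] * phiStr (a :: S) + w * g [●] * f [●, a] * phiStr (● :: a :: S) := by
  rw [tau, if_neg (List.cons_ne_nil _ _)]
  refine (sum_composition_one _).trans ?_
  have h : parts [a] (Composition.single 1 one_pos) = [[a]] := rfl
  simp [h, iota, heads, Omega]

theorem tau_two (a b : Dot) (S : List Dot) :
    tau [a, b] S = g [●, a, b] * phiStr (a :: S) + w * g [●] * f [●, a, b] * phiStr (● :: a :: S) +
      w ^ [b].count ● * (g [●, b] * f [a, b] * phiStr (b :: a :: S) +
        w * g [●] * f [●, b] * f [a, b] * phiStr (● :: b :: a :: S)) := by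
  rw [tau, if_neg (List.cons_ne_nil _ _)]
  refine (sum_composition_two _).trans ?_
  have h : parts [a, b] (Composition.single 2 two_pos) = [[a, b]] := rfl
  have h' : parts [a, b] (Composition.ones 2) = [[a], [b]] := rfl
  simp [h, h', iota, heads, Omega, pow_succ]
  ring

theorem tauNum_two (a b : Dot) :
    tauNum [a, b] 0 = phiNum 1 * g [●, a, b] + phiNum 2 * (g [●, a] * f [●, b]) := by
  refine (sum_composition_two _).trans ?_
  have h : parts [a, b] (Composition.single 2 two_pos) = [[a, b]] := rfl
  have h' : parts [a, b] (Composition.ones 2) = [[a], [b]] := rfl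
  simp [h, h']

theorem sumsTo_exp (c : Series) :
    SumsTo (fun j : ℕ => (1 / (j.factorial : ℚ)) • (x * c) ^ j) (ESum x 0 ![c]) := by
  have h := sumsTo_const (n := 1) constantCoeff_x 0 c
  rw [show (fun _ : Fin 1 => c) = ![c] from funext fun i => by fin_cases i; rfl] at h
  exact h.congr fun j => by simp [mul_pow, mul_comm]

theorem expS_eq (c : Series) : expS (x * c) = ESum x 0 ![c] := (sumsTo_exp c).formalSum_eq

theorem expS_sub_one (c : Series) : expS (x * c) - 1 = c * ESum x 1 ![c] := by
  rw [expS_eq, ESum_one constantCoeff_x, ESum_nil, add_sub_cancel_left]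

/-- There are j + 1 monomials of degree j in two variables, and (j + 1)/(j + 1)! = 1/j!. -/
theorem x_mul_expS (c : Series) : x * expS (x * c) = ESum x 1 ![c, c] := by
  rw [expS_eq]
  have h := sumsTo_const (n := 2) constantCoeff_x 1 c
  rw [show (fun _ : Fin 2 => c) = ![c, c] from funext fun i => by fin_cases i <;> rfl] at h
  refine ((sumsTo_exp c).const_mul x).unique (h.congr fun j => ?_)
  rw [mul_smul_comm, Nat.multichoose_two, Nat.factorial_succ, Nat.cast_mul,
    div_mul_cancel_left₀ (by positivity), one_div, mul_pow]
  ring_nf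

/-- C(k+3,3) and C(k+4,4) count the monomials of degree k in four and five variables: they
distribute the white corners among the gaps left by the support. -/
theorem psiSum_eq : psiSum =
    f [○, ○, ○] * ESum x 3 ![f [○], f [○], f [○], f [○]] +
      f [○, ○] ^ 2 * ESum x 4 ![f [○], f [○], f [○], f [○], f [○]] := by
  have h₁ := sumsTo_const (n := 4) constantCoeff_x 3 (f [○])
  have h₂ := sumsTo_const (n := 5) constantCoeff_x 4 (f [○])
  rw [show (fun _ : Fin 4 => f [○]) = ![f [○], f [○], f [○], f [○]] from
    funext fun i => by fin_cases i <;> rfl] at h₁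
  rw [show (fun _ : Fin 5 => f [○]) = ![f [○], f [○], f [○], f [○], f [○]] from
    funext fun i => by fin_cases i <;> rfl] at h₂
  refine congrArg₂ _ ((h₁.const_mul _).congr fun k => ?_).formalSum_eq
    ((h₂.const_mul _).congr fun k => ?_).formalSum_eq
  · rw [psi_lam3, Nat.multichoose_eq, show 4 + k - 1 = k + 3 by omega, Nat.choose_symm_add,
      mul_smul_comm]
    ring_nf
  · rw [psi_lam22, Nat.multichoose_eq, show 5 + k - 1 = k + 4 by omega, Nat.choose_symm_add,
      mul_smul_comm]
    ring_nf

/-- At v = 0 only the cases whose v-series has shift 0 survive: s at or below a, and, with a = 0, s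
in (b,c] with c = d or s in (c,d] with c < d. -/
theorem BGenus_one_eq : BGenus 1 = tauNum [●, ○] 0 * (x * expS (x * f [○])) + g [●] * psiSum := by
  rw [BGenus_one, sum_caseSum, tauNum_two, x_mul_expS, psiSum_eq, phiNum_one, phiNum_two]
  simp only [caseSum, ESum_zero_zero, ESum_zero_succ, ESum_nil]
  ring

/-- The lines correspond to s in (a,b], s above d, s in (b,c], s in (c,d], and s ≤ a. The terms 1
split off from the v-series of shift 0 add up to B. -/
theorem GamGenus_one_eq : GamGenus 1 =
      (w * f [●] * tau [○, ○] [●] + tau [○, ○] []) * (x * expS (x * f [○]))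
      + (w ^ 2 * tau [●, ●] [●] + w ^ 3 * f [●] * tau [●, ●] [●, ●]) * (expS (x * f [○]) - 1)
      + (w * f [●, ●, ○] * tau [] [] + w * f [●] * tau [●, ○] [] + f [●, ○] * tau [○] [])
          * phiNum 1 * (x * expS (x * f [○]))
      + (w * f [●, ●] * tau [] [] + w * f [●] * tau [●] [])
          * f [●, ○] * phiNum 2 * (x * expS (x * f [○]))
      + w * f [●] * tau [] [] * psiSum
      + BGenus 1 := by
  rw [BGenus_one_eq, GamGenus_one, sum_caseSum]
  -- Each v-series of the case sums has k + 1 arguments; splitting off the last expresses it in the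
  -- functions φ, after which both sides are polynomials in the same quantities.
  have hone := ESum_one constantCoeff_v 0
  have htwo := ESum_two constantCoeff_v 1
  have hthree := ESum_three constantCoeff_v 2
  have hfour := ESum_four constantCoeff_v 3
  have hfive := ESum_five constantCoeff_v 4
  simp only [tauNum_two, x_mul_expS, expS_sub_one, psiSum_eq, phiNum_one, phiNum_two, caseSum,
    tau_nil, tau_one, tau_two, phiStr_one, phiStr_two, phiStr_three, phiStr_four, phiStr_five,
    phiArg, hone, htwo, hthree, hfour, hfive, ESum_nil]
  simp
  ring

end Dipole

end

open Dipole in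
theorem mainTheorem5 :
    (GamGenus 1 =
      (w * f [●] * tau [○, ○] [●] + tau [○, ○] []) * (x * expS (x * f [○]))
      + (w ^ 2 * tau [●, ●] [●] + w ^ 3 * f [●] * tau [●, ●] [●, ●]) * (expS (x * f [○]) - 1)
      + (w * f [●, ●, ○] * tau [] [] + w * f [●] * tau [●, ○] [] + f [●, ○] * tau [○] [])
          * phiNum 1 * (x * expS (x * f [○]))
      + (w * f [●, ●] * tau [] [] + w * f [●] * tau [●] [])
          * f [●, ○] * phiNum 2 * (x * expS (x * f [○]))
      + w * f [●] * tau [] [] * psiSum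
      + BGenus 1) ∧
    BGenus 1 = tauNum [●, ○] 0 * (x * expS (x * f [○])) + g [●] * psiSum ∧
    (∀ k : ℕ, (psi (lam3 k) : ℚ) = psiClosed (lam3 k)) ∧
    (∀ k : ℕ, (psi (lam22 k) : ℚ) = psiClosed (lam22 k)) :=
  ⟨Dipole.GamGenus_one_eq, Dipole.BGenus_one_eq,
    fun k => by rw [Dipole.psi_lam3, Dipole.psiClosed_lam3],
    fun k => by rw [Dipole.psi_lam22, Dipole.psiClosed_lam22]⟩
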